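/- Write a point $B$ of affine $9$-space $V$ in the coordinates $b_{11},b_{12},b_{13},b_{14},b_{22},b_{24},b_{33},b_{34},b_{44}$ (the space of symmetric $4\times4$ matrices with $b_{23}=-b_{14}$), and let $$q(B)=-b_{11}b_{44}-b_{22}b_{33}-2b_{12}b_{34}-2b_{13}b_{24}-2b_{14}^2 .$$ Put $e(x)=e^{2\pi i x}$. For integers $r\ge 1$ and primes $p$ set $$C_q(r)=\frac1{r^9}\sum_{\substack{0\le a<r\\ \gcd(a,r)=1}}\ \sum_{B\in V(\mathbb Z/r\mathbb Z)} e\Big(\frac ar q(B)\Big),\qquad \mathfrak S(q)=\sum_{r\ge1}C_q(r),\qquad \mathfrak S(q;p)=\sum_{\ell\ge0}C_q(p^\ell).$$ Let $c_1,c_2,c_3>0$ be constants. Let $0<\delta<0.01$, let $X\ge 2$ be real, and let $\mathcal B\subset V(\mathbb R)$ be the box $|b_{ij}|\le X_{ij}$, where the nine real numbers $X_{ij}$ satisfy $$c_1^{-1}X^{1-2\delta}\le X_{ij}\le c_1X^{1+2\delta},\qquad X_{14}=c_2X,\qquad X_{11}X_{44}=X_{22}X_{33}=X_{12}X_{34}=X_{13}X_{24}=c_2^2X^2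 .$$ Set $$\mathfrak S_\infty(\mathcal B;q)=\int_{\mathbb R}\int_{\mathcal B}e(\theta q(B))\,dB\,d\theta .$$ The series $\mathfrak S(q)$ and, for every prime $p$, $\mathfrak S(q;p)$ converge absolutely and have positive (real) values; the function $\theta\mapsto\int_{\mathcal B}e(\theta q(B))\,dB$ is absolutely integrable over $\mathbb R$, and $\mathfrak S_\infty(\mathcal B;q)$ is a positive real number. Moreover, let $m$ be an odd squarefree positive integer with $m\le c_3X^{1/3}$, and let $B_0\in V(\mathbb Z)$ be such that $m\mid q(B_0)$ and $B_0\not\equiv 0\pmod p$ for every prime $p\mid m$. Then the number $N_q(\mathcal B;m,B_0)$ of $B\in\mathcal B\cap V(\mathbb Z)$ with $B\equiv B_0\pmod m$ and $q(B)=0$ satisfies $$N_q(\mathcal B;m,B_0)=\frac1{m^8}\Big(\prod_{p\mid m}\mathfrak S(q;p)^{-1}\Big)\,\mathfrak S(q)\,\mathfrak S_\infty(\mathcal B;q)+O\Big(\frac{X^{6.85(1+2\delta)}}{m^{5.5}}\log X\Big),$$ where the implied constant depends only on $c_1,c_2,c_3$ (and not on $\delta$, $X$, the $X_{ij}$, $m$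 or $B_0$). -/

import Mathlib

noncomputable section

namespace QuadricCount

/-- The nine-dimensional space `V` of symmetric `4 × 4` matrices with `b₂₃ = -b₁₄`, with points in
`R`, in the coordinates
`b₁₁, b₁₂, b₁₃, b₁₄, b₂₂, b₂₄, b₃₃, b₃₄, b₄₄` (indices `0, 1, …, 8` in this order). -/
abbrev V (R : Type*) : Type _ := Fin 9 → R

/-- `q(B) = -b₁₁b₄₄ - b₂₂b₃₃ - 2b₁₂b₃₄ - 2b₁₃b₂₄ - 2b₁₄²`. -/
def q {R : Type*} [CommRing R] (B : V R) : R :=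
  -(B 0 * B 8) - B 4 * B 6 - 2 * (B 1 * B 7) - 2 * (B 2 * B 5) - 2 * B 3 ^ 2

/-- `e(x) = exp(2πix)`. -/
def e (x : ℝ) : ℂ := Complex.exp (2 * Real.pi * Complex.I * x)

/-- The box `|b_{ij}| ≤ X_{ij}` in `V(ℝ)`. -/
def box (Y : V ℝ) : Set (V ℝ) := {B | ∀ i, |B i| ≤ Y i}

/-- The number of integral points `B` of the box with `B ≡ B₀ (mod m)` and `q(B) = 0`. -/
def count (Y : V ℝ) (m : ℕ) (B₀ : V ℤ) : ℕ :=
  Set.ncard {B : V ℤ |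
    (fun i => (B i : ℝ)) ∈ box Y ∧ (∀ i, B i ≡ B₀ i [ZMOD (m : ℤ)]) ∧ q B = 0}

/-- `C_q(r) = r⁻⁹ ∑_{0 ≤ a < r, gcd(a, r) = 1} ∑_{B mod r} e(a q(B) / r)`; residue classes are
represented by `0, …, r - 1`. -/
def C (r : ℕ) : ℂ :=
  1 / (r : ℂ) ^ 9 * ∑ a ∈ (Finset.range r).filter (fun a => Nat.gcd a r = 1),
    ∑ B : V (Fin r), e ((a : ℝ) / (r : ℝ) * ((q (fun i => ((B i : ℕ) : ℤ)) : ℤ) : ℝ))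

/-- The singular series `𝔖(q) = ∑_{r ≥ 1} C_q(r)`. -/
def singularSeries : ℂ := ∑' r : ℕ+, C (r : ℕ)

/-- The local series `𝔖(q; p) = ∑_{ℓ ≥ 0} C_q(p^ℓ)`. -/
def localSeries (p : ℕ) : ℂ := ∑' l : ℕ, C (p ^ l)

/-- The oscillatory integral `∫_𝓑 e(θ q(B)) dB` over the box. -/
def boxIntegral (Y : V ℝ) (θ : ℝ) : ℂ := ∫ B in box Y, e (θ * q B)

/-- The singular integral `𝔖_∞(𝓑; q) = ∫_ℝ ∫_𝓑 e(θ q(B)) dB dθ`. -/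
def singularIntegral (Y : V ℝ) : ℂ := ∫ θ : ℝ, boxIntegral Y θ

end QuadricCount

end

open Finset MeasureTheory Filter Topology

namespace QuadricCount

/-! ### The additive character `e` -/

/-! The proof is the Hardy–Littlewood circle method. On the class of `B₀` modulo `m` every value `q
B` is a multiple of `m`, so the count is the integral over a unit interval of `boxSum`, the sum of
`e (β * q B / m)`. Since `q` is a sum of four multiples of hyperbolic planes and a multiple of one
square, `boxSum`, the complete sums and `boxIntegral` all factor accordingly (`boxSum_eq`,
`fullRes_eq`, `boxIntegral_eq`), and estimates in one or two variables suffice.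

Major arcs: near `a / r` with `r ≤ m P`, `boxSum` is close to a complete sum modulo `r` times an
oscillatory integral (`norm_boxSum_sub_le`). Summed over `a`, the complete sum is `r ^ 9 * C r` if
`r` is prime to `m`, and it vanishes otherwise (`sum_residues_eq`): for an odd prime `p` dividing
both, `B₀` is nonzero modulo `p`, so the linear form `polar B₀` is nonzero there, and a translation
by a multiple of `r / p` multiplies the sum by a nontrivial root of unity. The main term thus
carries the singular series over moduli prime to `m`. By multiplicativity of `C` this is the full
series with the Euler factors at `p ∣ m` divided out (`coprimeSeries_eq`). Convergence comes from
`‖C r‖ ≤ 4 / r ^ 3`.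

Minor arcs: there `β m` has an approximation with denominator between `P` and `Q`, which bounds two
of the plane sums pointwise by `O(Q log Q)`. The other two are handled in mean square by the divisor
bound, and the square sum trivially (`norm_integral_minor_le`).

The parameters are `P = X ^ 0.1` and `Q = c₂² X ^ 1.9 / m ^ 2`. Up to small powers of `X` the minor
arcs contribute `X ^ 6.84 / m ^ 7`, the approximation on the major arcs `X ^ 6.32 / m ^ 4`, and the
completion of series and integral `X ^ 6.8 / m ^ 10`. Using `m ≪ X ^ (1/3)` in the second, all are
`O(X ^ 6.85 / m ^ 5.5)`, uniformly in `δ` and without the logarithm.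

Positivity: `C 1 = 1` outweighs the absolute sum of the other terms, which is at most `7 / 12`. In
the singular integral the plane integrals are real and occur squared, because the products of
coupled sides agree, while the square contributes a Fresnel-type integral with positive real part.
-/

theorem e_eq (x : ℝ) : e x = Complex.exp ((2 * Real.pi * x : ℝ) * Complex.I) := by
  unfold e; congr 1; push_cast; ring

theorem e_zero : e 0 = 1 := by simp [e]

theorem e_add (x y : ℝ) : e (x + y) = e x * e y := by
  unfold e; rw [← Complex.exp_add]; congr 1; push_cast; ring

theorem norm_e (x : ℝ) : ‖e x‖ = 1 := by
  rw [e_eq]; exact Complex.norm_exp_ofReal_mul_I _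

theorem e_int (n : ℤ) : e n = 1 := by
  unfold e
  rw [Complex.exp_eq_one_iff]
  exact ⟨n, by push_cast; ring⟩

theorem e_add_int (x : ℝ) (n : ℤ) : e (x + n) = e x := by rw [e_add, e_int, mul_one]

theorem conj_e (x : ℝ) : (starRingEnd ℂ) (e x) = e (-x) := by
  unfold e
  rw [← Complex.exp_conj]
  congr 1
  simp [Complex.conj_ofNat]

theorem e_re (x : ℝ) : (e x).re = Real.cos (2 * Real.pi * x) := by
  rw [e_eq, Complex.exp_ofReal_mul_I_re]

@[fun_prop]
theorem continuous_e : Continuous e := by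
  unfold e; fun_prop

theorem hasDerivAt_e (x : ℝ) : HasDerivAt e (2 * Real.pi * Complex.I * e x) x := by
  have h : HasDerivAt (fun t : ℝ => 2 * Real.pi * Complex.I * (t : ℂ)) (2 * Real.pi * Complex.I) x := by
    simpa using (Complex.ofRealCLM.hasDerivAt (x := x)).const_mul (2 * (Real.pi : ℂ) * Complex.I)
  have := h.cexp
  unfold e
  convert! this using 1
  ring

theorem norm_e_sub_e_le (x y : ℝ) : ‖e x - e y‖ ≤ 2 * Real.pi * |x - y| := by
  have h1 : e x - e y = e y * (e (x - y) - 1) := by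
    rw [mul_sub, ← e_add, mul_one]; congr 2; ring
  rw [h1, norm_mul, norm_e, one_mul, e_eq]
  have := Real.norm_exp_I_mul_ofReal_sub_one_le (x := 2 * Real.pi * (x - y))
  rw [mul_comm Complex.I] at this
  refine this.trans (le_of_eq ?_)
  rw [Real.norm_eq_abs, abs_mul, abs_of_pos (by positivity)]

theorem norm_e_sub_one_ge {t : ℝ} (ht : |t| ≤ 1 / 2) : 4 * |t| ≤ ‖e t - 1‖ := by
  rw [e_eq, mul_comm _ Complex.I, Complex.norm_exp_I_mul_ofReal_sub_one, Real.norm_eq_abs, abs_mul]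
  have h := Real.mul_abs_le_abs_sin (x := 2 * Real.pi * t / 2) (by
    rw [show 2 * Real.pi * t / 2 = Real.pi * t by ring, abs_mul, abs_of_pos Real.pi_pos]
    nlinarith [Real.pi_pos, abs_nonneg t])
  have h2 : 2 / Real.pi * |2 * Real.pi * t / 2| = 2 * |t| := by
    rw [show 2 * Real.pi * t / 2 = Real.pi * t by ring, abs_mul, abs_of_pos Real.pi_pos]
    field_simp
  rw [h2] at h
  simp only [abs_two]
  linarith

/-- The starting point `κ` is left free because the circle is later cut at `-1 / Q`. -/
theorem integral_e_int (κ : ℝ) (n : ℤ) :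
    ∫ β in κ..(κ + 1), e (β * n) = if n = 0 then 1 else 0 := by
  split_ifs with h
  · simp [h, e_zero]
  · have hn : (2 * Real.pi * Complex.I * (n : ℂ)) ≠ 0 := by
      simp [Real.pi_ne_zero, h]
    have hd : ∀ x ∈ Set.uIcc κ (κ + 1), HasDerivAt
        (fun β : ℝ => (2 * Real.pi * Complex.I * (n : ℂ))⁻¹ * e (β * n)) (e (x * n)) x := by
      intro x _
      have := ((hasDerivAt_e (x * n)).scomp x ((hasDerivAt_id x).mul_const (n : ℝ))).const_mul
        (2 * Real.pi * Complex.I * (n : ℂ))⁻¹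
      convert! this using 1
      simp only [one_mul, Complex.real_smul]
      push_cast
      field_simp
    rw [intervalIntegral.integral_eq_sub_of_hasDerivAt hd
      (Continuous.intervalIntegrable (by fun_prop) _ _)]
    rw [add_mul, one_mul, e_add_int, sub_self]

/-! ### Factorization of sums over `V` into its hyperbolic planes and the line of `b₁₄` -/

/-- The splitting of a point of `V` into the pairs of coordinates that `q` couples. -/
def splitEquiv (R : Type*) : V R ≃ (R × R) × (R × R) × (R × R) × (R × R) × R where
  toFun B := ((B 0, B 8), (B 4, B 6), (B 1, B 7), (B 2, B 5), B 3)
  invFun z := ![z.1.1, z.2.2.1.1, z.2.2.2.1.1, z.2.2.2.2, z.2.1.1, z.2.2.2.1.2, z.2.1.2,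
    z.2.2.1.2, z.1.2]
  left_inv B := by funext i; fin_cases i <;> rfl
  right_inv z := rfl

theorem splitEquiv_apply {R : Type*} (B : V R) :
    splitEquiv R B = ((B 0, B 8), (B 4, B 6), (B 1, B 7), (B 2, B 5), B 3) := rfl

theorem mem_piFinset_split {R : Type*} [DecidableEq R] (S : Fin 9 → Finset R) (B : V R) :
    B ∈ Fintype.piFinset S ↔ splitEquiv R B ∈
      (S 0 ×ˢ S 8) ×ˢ (S 4 ×ˢ S 6) ×ˢ (S 1 ×ˢ S 7) ×ˢ (S 2 ×ˢ S 5) ×ˢ S 3 := by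
  simp only [Fintype.mem_piFinset, splitEquiv_apply, mem_product]
  constructor
  · intro h; simp [h]
  · rintro ⟨⟨h0, h8⟩, ⟨h4, h6⟩, ⟨h1, h7⟩, ⟨h2, h5⟩, h3⟩ i
    fin_cases i <;> assumption

/-- The one source of all factorizations of finite sums: it serves the complete sums modulo `r`, the
sums over the box, and the complete sums on the class of `B₀`. -/
theorem sum_piFinset_split {R : Type*} [DecidableEq R] (S : Fin 9 → Finset R)
    (f₁ f₂ f₃ f₄ : R → R → ℂ) (g : R → ℂ) :
    ∑ B ∈ Fintype.piFinset S, f₁ (B 0) (B 8) * f₂ (B 4) (B 6) * f₃ (B 1) (B 7) * f₄ (B 2) (B 5)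
        * g (B 3) =
      (∑ x ∈ S 0, ∑ y ∈ S 8, f₁ x y) * (∑ x ∈ S 4, ∑ y ∈ S 6, f₂ x y) *
      (∑ x ∈ S 1, ∑ y ∈ S 7, f₃ x y) * (∑ x ∈ S 2, ∑ y ∈ S 5, f₄ x y) * ∑ z ∈ S 3, g z := by
  rw [Finset.sum_equiv (splitEquiv R)
    (t := (S 0 ×ˢ S 8) ×ˢ (S 4 ×ˢ S 6) ×ˢ (S 1 ×ˢ S 7) ×ˢ (S 2 ×ˢ S 5) ×ˢ S 3)
    (g := fun z => f₁ z.1.1 z.1.2 * (f₂ z.2.1.1 z.2.1.2 * (f₃ z.2.2.1.1 z.2.2.1.2 *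
      (f₄ z.2.2.2.1.1 z.2.2.2.1.2 * g z.2.2.2.2))))
    (mem_piFinset_split S) (by intro B _; simp only [splitEquiv_apply]; ring)]
  simp only [mul_assoc, ← sum_product']
  rw [sum_mul_sum, sum_mul_sum, sum_mul_sum, sum_mul_sum]
  simp only [← sum_product', mul_sum]

/-! ### The complete exponential sums -/

theorem e_div_eq_stdAddChar (r : ℕ) [NeZero r] (n : ℤ) :
    e ((n : ℝ) / r) = ZMod.stdAddChar (n : ZMod r) := by
  rw [ZMod.stdAddChar_coe, e]
  congr 1
  push_cast
  ring

theorem map_q {R S : Type*} [CommRing R] [CommRing S] (f : R →+* S) (B : V R) :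
    q (fun i => f (B i)) = f (q B) := by
  simp [q, map_ofNat]

theorem sum_filter_coprime (r : ℕ) [NeZero r] (F : ZMod r → ℂ) :
    ∑ a ∈ (range r).filter (fun a => Nat.gcd a r = 1), F (a : ZMod r) =
      ∑ u : (ZMod r)ˣ, F u := by
  refine sum_bij (fun a ha => ZMod.unitOfCoprime a (mem_filter.1 ha).2) (fun _ _ => mem_univ _)
    ?_ ?_ ?_
  · intro a ha b hb h
    have h' := congrArg (Units.val) h
    simp only [ZMod.coe_unitOfCoprime] at h'
    rw [ZMod.natCast_eq_natCast_iff'] at h'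
    rwa [Nat.mod_eq_of_lt (mem_range.1 (mem_filter.1 ha).1),
      Nat.mod_eq_of_lt (mem_range.1 (mem_filter.1 hb).1)] at h'
  · intro u _
    refine ⟨(u : ZMod r).val, mem_filter.2 ⟨mem_range.2 (ZMod.val_lt _), ZMod.val_coe_unit_coprime u⟩, ?_⟩
    ext
    simp
  · intro a ha
    simp

theorem sum_fin_eq_sum_zmod (r : ℕ) [NeZero r] (F : V (ZMod r) → ℂ) :
    ∑ B : V (Fin r), F (fun i => ((B i : ℕ) : ZMod r)) = ∑ B : V (ZMod r), F B := by
  have hbij : Function.Bijective (fun j : Fin r => ((j : ℕ) : ZMod r)) := by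
    rw [Fintype.bijective_iff_injective_and_card]
    refine ⟨fun a b h => ?_, by simp [ZMod.card]⟩
    simp only [ZMod.natCast_eq_natCast_iff'] at h
    rwa [Nat.mod_eq_of_lt a.2, Nat.mod_eq_of_lt b.2, ← Fin.ext_iff] at h
  exact Equiv.sum_comp (Equiv.piCongrRight fun _ : Fin 9 => Equiv.ofBijective _ hbij) F

theorem sum_Ico_eq_sum_zmod (r : ℕ) [NeZero r] (F : V (ZMod r) → ℂ) :
    ∑ B ∈ Fintype.piFinset (fun _ : Fin 9 => Ico (0 : ℤ) r), F (fun i => (B i : ZMod r)) =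
      ∑ B : V (ZMod r), F B := by
  refine sum_bij' (fun B _ i => (B i : ZMod r)) (fun B _ i => ((B i).val : ℤ))
    (fun _ _ => mem_univ _) ?_ ?_ ?_ ?_
  · intro B _
    simp only [Fintype.mem_piFinset, mem_Ico]
    exact fun i => ⟨by positivity, by exact_mod_cast ZMod.val_lt _⟩
  · intro B hB
    simp only [Fintype.mem_piFinset, mem_Ico] at hB
    funext i
    simp only [ZMod.val_intCast]
    exact Int.emod_eq_of_lt (hB i).1 (hB i).2
  · intro B _
    funext i
    simp
  · intro B _; rfl

/-- The inner exponential sum `∑_B e(a q(B) / r)`. -/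
noncomputable def expSum (r : ℕ) [NeZero r] (a : ZMod r) : ℂ := ∑ B : V (ZMod r), ZMod.stdAddChar (a * q B)

theorem C_eq (r : ℕ) [NeZero r] :
    C r = 1 / (r : ℂ) ^ 9 * ∑ a : (ZMod r)ˣ, expSum r a := by
  unfold C
  congr 1
  rw [← sum_filter_coprime r (expSum r)]
  refine sum_congr rfl fun a _ => ?_
  rw [expSum, ← sum_fin_eq_sum_zmod]
  refine sum_congr rfl fun B _ => ?_
  have h : (fun i => ((B i : ℕ) : ZMod r)) = fun i => (Int.castRingHom (ZMod r)) ((B i : ℕ) : ℤ) := by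
    funext i; simp
  rw [h, map_q, div_mul_eq_mul_div]
  have := e_div_eq_stdAddChar r ((a : ℤ) * q (fun i => ((B i : ℕ) : ℤ)))
  push_cast at this
  rw [eq_intCast, ← this]

theorem C_zero : C 0 = 0 := by simp [C]

theorem C_one : C 1 = 1 := by
  rw [C_eq]
  simp [expSum, Subsingleton.elim _ (0 : ZMod 1)]

/-- Orthogonality in `y` leaves only those `x` killed by `c`. -/
theorem sum_bilinear (r : ℕ) [NeZero r] (c : ZMod r) :
    ∑ x : ZMod r, ∑ y : ZMod r, ZMod.stdAddChar (c * x * y) =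
      (r : ℂ) * ((univ.filter fun x : ZMod r => c * x = 0).card : ℂ) := by
  have h : ∀ x : ZMod r, ∑ y : ZMod r, ZMod.stdAddChar (c * x * y) =
      if c * x = 0 then (r : ℂ) else 0 := by
    intro x
    have := AddChar.sum_mulShift (c * x) (ZMod.isPrimitive_stdAddChar r)
    simp only [mul_comm _ (c * x)] at this
    rw [this]; simp [ZMod.card]
  simp_rw [h]
  rw [← sum_filter, sum_const, nsmul_eq_mul, mul_comm]

/-- Controls the loss at even moduli, where the coefficient `2` of two of the planes is not a unit.
-/
theorem card_two_mul_eq_zero_le (r : ℕ) [NeZero r] :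
    (univ.filter fun x : ZMod r => 2 * x = 0).card ≤ 2 := by
  have hsub : (univ.filter fun x : ZMod r => 2 * x = 0) ⊆ {0, ((r / 2 : ℕ) : ZMod r)} := by
    intro x hx
    simp only [mem_filter, mem_univ, true_and] at hx
    have h1 : ((2 * x.val : ℕ) : ZMod r) = 0 := by push_cast; simpa using hx
    rw [ZMod.natCast_eq_zero_iff] at h1
    have h2 := ZMod.val_lt x
    obtain ⟨k, hk⟩ := h1
    have hk2 : k < 2 := by
      by_contra h
      have : r * 2 ≤ r * k := Nat.mul_le_mul_left _ (by omega)
      omega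
    rw [mem_insert, mem_singleton]
    interval_cases k
    · left; rw [← ZMod.natCast_zmod_val x, show x.val = 0 by omega, Nat.cast_zero]
    · right; rw [← ZMod.natCast_zmod_val x]; congr 1; omega
  exact (card_le_card hsub).trans card_le_two

theorem q_eq {R : Type*} [CommRing R] (a : R) (B : V R) : a * q B =
    -a * B 0 * B 8 + -a * B 4 * B 6 + 2 * -a * B 1 * B 7 + 2 * -a * B 2 * B 5
      + 2 * -a * B 3 ^ 2 := by
  simp only [q]; ring

/-- The planes contribute `r`, `r`, at most `2r` and at most `2r`. The Gauss sum of the square is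
bounded trivially by `r`: its square-root cancellation is not required. -/
theorem norm_expSum_le (r : ℕ) [NeZero r] (a : (ZMod r)ˣ) :
    ‖expSum r a‖ ≤ 4 * (r : ℝ) ^ 5 := by
  have h := sum_piFinset_split (R := ZMod r) (fun _ => univ)
    (fun x y => ZMod.stdAddChar (-(a : ZMod r) * x * y))
    (fun x y => ZMod.stdAddChar (-(a : ZMod r) * x * y))
    (fun x y => ZMod.stdAddChar (2 * -(a : ZMod r) * x * y))
    (fun x y => ZMod.stdAddChar (2 * -(a : ZMod r) * x * y))
    (fun z => ZMod.stdAddChar (2 * -(a : ZMod r) * z ^ 2))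
  rw [Fintype.piFinset_univ] at h
  simp only [sum_bilinear] at h
  have hu : ∀ x : ZMod r, -(a : ZMod r) * x = 0 ↔ x = 0 := fun x => by
    rw [neg_mul, neg_eq_zero, Units.mul_right_eq_zero]
  have hu2 : ∀ x : ZMod r, 2 * -(a : ZMod r) * x = 0 ↔ 2 * x = 0 := fun x => by
    rw [mul_assoc, mul_left_comm, hu]
  simp only [hu, hu2, filter_eq', mem_univ, if_true, card_singleton] at h
  have h2 : expSum r a = _ := (sum_congr rfl fun B _ => by
    rw [q_eq]; simp only [AddChar.map_add_eq_mul]).trans h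
  rw [h2]
  simp only [norm_mul, Complex.norm_natCast, Nat.cast_one, mul_one]
  have hg : ‖∑ z : ZMod r, (ZMod.stdAddChar (2 * -(a : ZMod r) * z ^ 2) : ℂ)‖ ≤ r := by
    refine (norm_sum_le _ _).trans ?_
    simp [AddChar.norm_apply, ZMod.card]
  have hc : ((univ.filter fun x : ZMod r => 2 * x = 0).card : ℝ) ≤ 2 := by
    exact_mod_cast card_two_mul_eq_zero_le r
  calc _ ≤ (r : ℝ) * r * (r * 2) * (r * 2) * r := by gcongr
    _ = _ := by ring

theorem norm_C_le_totient (r : ℕ) [NeZero r] : ‖C r‖ ≤ 4 * (r.totient : ℝ) / (r : ℝ) ^ 4 := by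
  have hr : (0 : ℝ) < r := by exact_mod_cast NeZero.pos r
  rw [C_eq, norm_mul, norm_div, norm_one, norm_pow, Complex.norm_natCast]
  have : ‖∑ a : (ZMod r)ˣ, expSum r a‖ ≤ r.totient * (4 * (r : ℝ) ^ 5) := by
    refine (norm_sum_le _ _).trans ((sum_le_sum fun a _ => norm_expSum_le r a).trans ?_)
    simp [ZMod.card_units_eq_totient]
  calc _ ≤ 1 / (r : ℝ) ^ 9 * (r.totient * (4 * (r : ℝ) ^ 5)) := by gcongr
    _ = _ := by field_simp

theorem norm_C_le (r : ℕ) : ‖C r‖ ≤ 4 / (r : ℝ) ^ 3 := by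
  rcases Nat.eq_zero_or_pos r with rfl | h
  · simp [C_zero]
  have : NeZero r := ⟨h.ne'⟩
  have hr : (0 : ℝ) < r := by exact_mod_cast h
  refine (norm_C_le_totient r).trans ?_
  have : (r.totient : ℝ) ≤ r := by exact_mod_cast Nat.totient_le r
  calc _ ≤ 4 * (r : ℝ) / r ^ 4 := by gcongr
    _ = _ := by field_simp

/-- Telescoping: `4 / n ^ 3 ≤ 4 / ((n - 1) n (n + 1)) = 2 / ((n - 1) n) - 2 / (n (n + 1))`. -/
theorem sum_range_four_div_cube_le (N : ℕ) (hN : 1 ≤ N) (k : ℕ) :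
    ∑ i ∈ range k, 4 / ((i + (N + 1) : ℕ) : ℝ) ^ 3 ≤
      2 / ((N : ℝ) * (N + 1)) - 2 / (((N : ℝ) + k) * (N + k + 1)) := by
  have hN' : (1 : ℝ) ≤ N := by exact_mod_cast hN
  induction k with
  | zero => simp
  | succ k ih =>
    rw [sum_range_succ]
    have : 4 / ((k + (N + 1) : ℕ) : ℝ) ^ 3 ≤ 2 / (((N : ℝ) + k) * (N + k + 1))
        - 2 / (((N : ℝ) + (k + 1 : ℕ)) * (N + (k + 1 : ℕ) + 1)) := by
      push_cast
      set t : ℝ := N + k with ht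
      have ht1 : 1 ≤ t := by rw [ht]; have : (0 : ℝ) ≤ k := k.cast_nonneg; linarith
      rw [show (k : ℝ) + (N + 1) = t + 1 by rw [ht]; ring, ← add_assoc, ← ht,
        div_sub_div _ _ (by positivity) (by positivity), div_le_div_iff₀ (by positivity) (by positivity)]
      have : 0 < t + 1 := by linarith
      nlinarith [mul_pos this this, pow_pos this 3]
    linarith

theorem summable_norm_C : Summable fun r : ℕ => ‖C r‖ := by
  refine Summable.of_nonneg_of_le (fun _ => norm_nonneg _) norm_C_le ?_
  have := (Real.summable_one_div_nat_pow (p := 3)).2 (by norm_num)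
  simpa [div_eq_mul_inv] using this.mul_left 4

theorem tsum_tail_le (N : ℕ) (hN : 1 ≤ N) :
    ∑' i : ℕ, ‖C (i + (N + 1))‖ ≤ 2 / ((N : ℝ) * (N + 1)) := by
  refine Real.tsum_le_of_sum_range_le (fun _ => norm_nonneg _) fun k => ?_
  refine (sum_le_sum fun i _ => norm_C_le _).trans ((sum_range_four_div_cube_le N hN k).trans ?_)
  have : 0 ≤ 2 / (((N : ℝ) + k) * (N + k + 1)) := by positivity
  linarith

/-- The totient bound gives `1 / 4` at `r = 2`, and the tail from `r = 3` is at most `1 / 3`. Any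
total below `1` yields positivity of the global and local series. -/
theorem tsum_norm_C_le : ∑' i : ℕ, ‖C (i + 2)‖ ≤ 7 / 12 := by
  have hs : Summable fun i : ℕ => ‖C (i + 2)‖ := (summable_nat_add_iff 2).2 summable_norm_C
  rw [hs.tsum_eq_zero_add]
  have h1 := tsum_tail_le 2 (by norm_num)
  have h2 := norm_C_le_totient 2
  norm_num at h1 h2 ⊢
  have h3 : (fun b => ‖C (b + 1 + 2)‖) = fun b => ‖C (b + 3)‖ := by
    funext b; rw [add_assoc]
  simp only [add_assoc] at h1 ⊢
  norm_num at h1 ⊢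
  linarith

theorem expSum_neg (r : ℕ) [NeZero r] (a : ZMod r) :
    (starRingEnd ℂ) (expSum r a) = expSum r (-a) := by
  unfold expSum
  rw [map_sum]
  refine sum_congr rfl fun B _ => ?_
  rw [AddChar.starComp_apply (by rw [ZMod.ringChar_zmod_n]; exact NeZero.pos r), neg_mul,
    AddChar.inv_apply]

theorem conj_C (r : ℕ) : (starRingEnd ℂ) (C r) = C r := by
  rcases Nat.eq_zero_or_pos r with rfl | h
  · simp [C_zero]
  have : NeZero r := ⟨h.ne'⟩
  rw [C_eq, map_mul, map_sum]
  simp only [expSum_neg]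
  congr 1
  · simp
  · exact Equiv.sum_comp (Equiv.neg (ZMod r)ˣ) fun a : (ZMod r)ˣ => expSum r a

theorem C_eq_re (r : ℕ) : C r = ((C r).re : ℂ) := (Complex.conj_eq_iff_re.1 (conj_C r)).symm

/-! ### Multiplicativity of `C` -/

/-- With `u₀ s + v₀ r ≡ 1` modulo `r s`, one has `n / (r s) ≡ u₀ n / r + v₀ n / s` modulo `1`. The
twists `u`, `v` are units, so they disappear once `a` is summed over all units. -/
theorem stdAddChar_chineseRemainder {r s : ℕ} [NeZero r] [NeZero s] (h : r.Coprime s) :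
    ∃ (u : (ZMod r)ˣ) (v : (ZMod s)ˣ), ∀ x : ZMod (r * s),
      (ZMod.stdAddChar x : ℂ) = ZMod.stdAddChar ((u : ZMod r) * (ZMod.chineseRemainder h x).1) *
        ZMod.stdAddChar ((v : ZMod s) * (ZMod.chineseRemainder h x).2) := by
  have hr : (r : ℝ) ≠ 0 := by exact_mod_cast NeZero.ne r
  have hs : (s : ℝ) ≠ 0 := by exact_mod_cast NeZero.ne s
  refine ⟨(ZMod.unitOfCoprime s h.symm)⁻¹, (ZMod.unitOfCoprime r h)⁻¹, fun x => ?_⟩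
  set u := (ZMod.unitOfCoprime s h.symm)⁻¹ with hu
  set v := (ZMod.unitOfCoprime r h)⁻¹ with hv
  have hus : (u : ZMod r) * s = 1 := by
    rw [hu, ← ZMod.coe_unitOfCoprime s h.symm, Units.inv_mul]
  have hvr : (v : ZMod s) * r = 1 := by
    rw [hv, ← ZMod.coe_unitOfCoprime r h, Units.inv_mul]
  obtain ⟨u₀, hu₀⟩ := ZMod.intCast_surjective (u : ZMod r)
  obtain ⟨v₀, hv₀⟩ := ZMod.intCast_surjective (v : ZMod s)
  have hdvd : ((r : ℤ) * s) ∣ u₀ * s + v₀ * r - 1 := by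
    refine IsCoprime.mul_dvd (Nat.isCoprime_iff_coprime.2 h) ?_ ?_
    · rw [← ZMod.intCast_zmod_eq_zero_iff_dvd]
      push_cast; rw [hu₀, hus]; simp
    · rw [← ZMod.intCast_zmod_eq_zero_iff_dvd]
      push_cast; rw [hv₀, hvr]; simp
  obtain ⟨k, hk⟩ := hdvd
  obtain ⟨n, rfl⟩ := ZMod.intCast_surjective x
  simp only [map_intCast, Prod.fst_intCast, Prod.snd_intCast]
  rw [← hu₀, ← hv₀, ← Int.cast_mul, ← Int.cast_mul, ← e_div_eq_stdAddChar, ← e_div_eq_stdAddChar,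
    ← e_div_eq_stdAddChar, ← e_add, ← e_add_int _ (k * n)]
  congr 1
  have hk' : (u₀ : ℝ) * s + v₀ * r - 1 = r * s * k := by exact_mod_cast hk
  push_cast
  field_simp
  linear_combination -(n : ℝ) * hk'

theorem sum_ringEquiv_prod {R S T : Type*} [CommRing R] [CommRing S] [CommRing T] [Fintype R]
    [Fintype S] [Fintype T] (c : T ≃+* R × S) (f : R → ℂ) (g : S → ℂ) :
    ∑ B : V T, f (c (q B)).1 * g (c (q B)).2 = (∑ B : V R, f (q B)) * ∑ B : V S, g (q B) := by
  rw [sum_mul_sum, ← sum_product', univ_product_univ]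
  let φ : V T ≃ V R × V S :=
    (Equiv.piCongrRight fun _ : Fin 9 => c.toEquiv).trans (Equiv.arrowProdEquivProdArrow _ _ _)
  refine Fintype.sum_equiv φ _ _ fun B => ?_
  have h1 : q (φ B).1 = (c (q B)).1 := map_q ((RingHom.fst _ _).comp (c : T →+* R × S)) B
  have h2 : q (φ B).2 = (c (q B)).2 := map_q ((RingHom.snd _ _).comp (c : T →+* R × S)) B
  rw [h1, h2]

theorem expSum_mul {r s : ℕ} [NeZero r] [NeZero s] (h : r.Coprime s) :
    ∃ (u : (ZMod r)ˣ) (v : (ZMod s)ˣ), ∀ a : ZMod (r * s),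
      expSum (r * s) a = expSum r (u * (ZMod.chineseRemainder h a).1) *
        expSum s (v * (ZMod.chineseRemainder h a).2) := by
  obtain ⟨u, v, huv⟩ := stdAddChar_chineseRemainder h
  refine ⟨u, v, fun a => ?_⟩
  unfold expSum
  rw [← sum_ringEquiv_prod (ZMod.chineseRemainder h)
    (fun x => ZMod.stdAddChar ((u : ZMod r) * (ZMod.chineseRemainder h a).1 * x))
    (fun x => ZMod.stdAddChar ((v : ZMod s) * (ZMod.chineseRemainder h a).2 * x))]
  refine sum_congr rfl fun B _ => ?_
  rw [huv, map_mul (ZMod.chineseRemainder h), Prod.fst_mul, Prod.snd_mul, mul_assoc, mul_assoc]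

theorem C_mul {r s : ℕ} (h : r.Coprime s) : C (r * s) = C r * C s := by
  rcases Nat.eq_zero_or_pos r with rfl | hr
  · simp [C_zero]
  rcases Nat.eq_zero_or_pos s with rfl | hs
  · simp [C_zero]
  have : NeZero r := ⟨hr.ne'⟩
  have : NeZero s := ⟨hs.ne'⟩
  obtain ⟨u, v, huv⟩ := expSum_mul h
  have key : ∑ a : (ZMod (r * s))ˣ, expSum (r * s) a =
      (∑ a : (ZMod r)ˣ, expSum r a) * ∑ a : (ZMod s)ˣ, expSum s a := by
    rw [sum_mul_sum, ← sum_product', univ_product_univ]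
    -- The Chinese remainder bijection on units, composed with multiplication by `u` and `v` so as
    -- to absorb the twists.
    let φ : (ZMod (r * s))ˣ ≃ (ZMod r)ˣ × (ZMod s)ˣ :=
      ((Units.mapEquiv (ZMod.chineseRemainder h).toMulEquiv).trans MulEquiv.prodUnits).toEquiv.trans
        ((Equiv.mulLeft u).prodCongr (Equiv.mulLeft v))
    refine Fintype.sum_equiv φ _ _ fun a => ?_
    rw [huv]
    rfl
  rw [C_eq, C_eq, C_eq, key]
  push_cast
  ring

/-! ### The Euler product -/

/-- The part of the singular series over the moduli prime to `m`. -/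
noncomputable def coprimeSeries (m : ℕ) : ℂ := ∑' r : ℕ, if r.Coprime m then C r else 0

theorem summable_norm_coprime (m : ℕ) :
    Summable fun r : ℕ => ‖if r.Coprime m then C r else 0‖ := by
  refine Summable.of_nonneg_of_le (fun _ => norm_nonneg _) (fun r => ?_) summable_norm_C
  split_ifs <;> simp

theorem singularSeries_eq : singularSeries = ∑' r : ℕ, C r := by
  unfold singularSeries
  rw [← tsum_zero_pnat_eq_tsum_nat summable_norm_C.of_norm, C_zero, zero_add]

/-- The restriction of `C` to moduli prime to `m` is still multiplicative on coprime arguments. At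
`p ∣ m` only the exponent `0` survives, so the factor is `1`. The case `m = 1` is the Euler product
of `singularSeries`. -/
theorem hasProd_coprimeSeries {m : ℕ} :
    HasProd (fun p : Nat.Primes => if (p : ℕ) ∣ m then 1 else localSeries p) (coprimeSeries m) := by
  have h := EulerProduct.eulerProduct_hasProd (f := fun r : ℕ => if r.Coprime m then C r else 0)
    (by simp [C_one]) (fun {a b} hab => by
      simp only [Nat.coprime_mul_iff_left, C_mul hab]
      split_ifs <;> simp_all)
    (summable_norm_coprime m) (by simp [C_zero])
  unfold coprimeSeries
  convert h using 2 with p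
  split_ifs with hp
  · rw [tsum_eq_single 0]
    · simp [C_one]
    · intro l hl
      rw [if_neg]
      rw [Nat.coprime_pow_left_iff (Nat.pos_of_ne_zero hl), p.2.coprime_iff_not_dvd]
      simpa using hp
  · refine tsum_congr fun l => ?_
    rw [if_pos]
    exact Nat.Coprime.pow_left _ ((p.2.coprime_iff_not_dvd).2 hp)

theorem singularSeries_eq_prod_mul (m : ℕ) (hm : m ≠ 0) :
    singularSeries = (∏ p ∈ m.primeFactors, localSeries p) * coprimeSeries m := by
  have h1 := hasProd_coprimeSeries (m := 1)
  have h1' : coprimeSeries 1 = singularSeries := by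
    simp [coprimeSeries, singularSeries_eq]
  rw [h1'] at h1
  let s : Finset Nat.Primes := m.primeFactors.subtype Nat.Prime
  have h2 : HasProd (fun p : Nat.Primes => if (p : ℕ) ∣ m then localSeries p else 1)
      (∏ p ∈ s, if (p : ℕ) ∣ m then localSeries p else 1) := by
    refine hasProd_prod_of_ne_finset_one fun p hp => ?_
    rw [if_neg]
    intro hd
    exact hp (mem_subtype.2 (Nat.mem_primeFactors.2 ⟨p.2, hd, hm⟩))
  have h3 := h2.mul (hasProd_coprimeSeries (m := m))
  refine HasProd.unique (h1.congr_fun ?_) (h3) |>.trans ?_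
  · intro p
    have := p.2.one_lt
    by_cases hp : (p : ℕ) ∣ m <;> simp [hp, p.2.ne_one]
  · congr 1
    rw [← prod_subtype_of_mem (s := m.primeFactors) (p := Nat.Prime) localSeries
      fun p hp => Nat.prime_of_mem_primeFactors hp]
    refine prod_congr rfl fun p hp => ?_
    rw [if_pos]
    exact Nat.dvd_of_mem_primeFactors (mem_subtype.1 hp)

/-! ### Positivity of the singular series and of the local series -/

theorem pos_of_tsum {f : ℕ → ℂ} (hf : Summable fun n => ‖f n‖) (h0 : f 0 = 1)
    (him : ∀ n, (f n).im = 0) (hlt : ∑' n, ‖f (n + 1)‖ < 1) :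
    (∑' n, f n).im = 0 ∧ 0 < (∑' n, f n).re := by
  refine ⟨by rw [Complex.im_tsum hf.of_norm]; simp [him], ?_⟩
  rw [hf.of_norm.tsum_eq_zero_add, h0, Complex.add_re, Complex.one_re]
  have h1 : Summable fun n => ‖f (n + 1)‖ := (summable_nat_add_iff 1).2 hf
  have h2 := (Complex.abs_re_le_norm _).trans (norm_tsum_le_tsum_norm h1)
  have h3 := (abs_le.1 h2).1
  linarith

theorem C_im (r : ℕ) : (C r).im = 0 := by rw [C_eq_re]; simp

theorem singularSeries_pos : singularSeries.im = 0 ∧ 0 < singularSeries.re := by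
  have : singularSeries = ∑' n : ℕ, C (n + 1) := by
    rw [singularSeries_eq, summable_norm_C.of_norm.tsum_eq_zero_add, C_zero, zero_add]
  rw [this]
  refine pos_of_tsum ((summable_nat_add_iff 1).2 summable_norm_C) (by simp [C_one])
    (fun n => C_im _) ?_
  exact tsum_norm_C_le.trans_lt (by norm_num)

theorem summable_local {p : ℕ} (hp : p.Prime) : Summable fun l : ℕ => ‖C (p ^ l)‖ :=
  summable_norm_C.comp_injective (Nat.pow_right_injective hp.two_le)

theorem localSeries_pos {p : ℕ} (hp : p.Prime) :
    (localSeries p).im = 0 ∧ 0 < (localSeries p).re := by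
  refine pos_of_tsum (summable_local hp) (by simp [C_one]) (fun n => C_im _) ?_
  have h2 : ∀ l, 2 ≤ p ^ (l + 1) := fun l =>
    hp.two_le.trans (Nat.le_self_pow (by omega) p)
  -- The powers `p ^ (l + 1)` are distinct integers `≥ 2`, so their terms form a subfamily of the
  -- global tail.
  have := tsum_comp_le_tsum_of_inj ((summable_nat_add_iff 2).2 summable_norm_C)
    (i := fun l : ℕ => p ^ (l + 1) - 2) (fun _ => norm_nonneg _) (fun a b hab => by
      have h3 := h2 a; have h4 := h2 b
      have : p ^ (a + 1) = p ^ (b + 1) := by simp only at hab; omega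
      have := Nat.pow_right_injective hp.two_le this
      omega)
  refine lt_of_le_of_lt (le_of_eq ?_) (this.trans_lt (tsum_norm_C_le.trans_lt (by norm_num)))
  refine tsum_congr fun l => ?_
  simp only [Function.comp, Nat.sub_add_cancel (h2 l)]

theorem localSeries_ne_zero {p : ℕ} (hp : p.Prime) : localSeries p ≠ 0 := by
  intro h
  have := (localSeries_pos hp).2
  simp [h] at this

theorem coprimeSeries_eq (m : ℕ) (hm : m ≠ 0) :
    (∏ p ∈ m.primeFactors, (localSeries p)⁻¹) * singularSeries = coprimeSeries m := by
  rw [singularSeries_eq_prod_mul m hm, prod_inv_distrib, inv_mul_cancel_left₀]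
  exact prod_ne_zero_iff.2 fun p hp => localSeries_ne_zero (Nat.prime_of_mem_primeFactors hp)

/-! ### Exponential sums over a residue class modulo `m` -/

/-- The polar form of `q`. -/
def polar {R : Type*} [CommRing R] (A B : V R) : R := q (A + B) - q A - q B

theorem q_add_smul {R : Type*} [CommRing R] (A B : V R) (t : R) :
    q (A + t • B) = q A + t * polar A B + t ^ 2 * q B := by
  simp only [polar, q, Pi.add_apply, Pi.smul_apply, smul_eq_mul]; ring

theorem polar_smul {R : Type*} [CommRing R] (A B : V R) (t : R) :
    polar A (t • B) = t * polar A B := by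
  simp only [polar, q, Pi.add_apply, Pi.smul_apply, smul_eq_mul]; ring

theorem polar_add {R : Type*} [CommRing R] (A B B' : V R) :
    polar A (B + B') = polar A B + polar A B' := by
  simp only [polar, q, Pi.add_apply]; ring

theorem map_polar {R S : Type*} [CommRing R] [CommRing S] (f : R →+* S) (A B : V R) :
    polar (fun i => f (A i)) (fun i => f (B i)) = f (polar A B) := by
  simp [polar, q, map_ofNat]

theorem exists_polar_not_dvd {p : ℕ} (hp : p.Prime) (hp2 : p ≠ 2) (B₀ : V ℤ)
    (h : ∃ i, ¬ (p : ℤ) ∣ B₀ i) : ∃ B : V ℤ, ¬ (p : ℤ) ∣ polar B₀ B := by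
  obtain ⟨i, hi⟩ := h
  have h2 : ¬ (p : ℤ) ∣ 2 := fun h => hp2 ((Nat.prime_dvd_prime_iff_eq hp Nat.prime_two).1
    (by exact_mod_cast h))
  have hpz := Nat.prime_iff_prime_int.1 hp
  -- The list sends each coordinate to its partner under `q`, and `b₁₄` to itself. The polar form
  -- against that basis vector is `-1`, `-2` or `-4` times `B₀ i`; multiplying up to `4 * B₀ i`
  -- treats all nine cases alike.
  refine ⟨Pi.single (![8, 7, 5, 3, 6, 2, 4, 1, 0] i) 1, fun hd => ?_⟩
  suffices h : (p : ℤ) ∣ 2 * (2 * B₀ i) by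
    rcases hpz.dvd_or_dvd h with h | h
    · exact h2 h
    · exact (hpz.dvd_or_dvd h).elim h2 hi
  fin_cases i <;> simp [polar, q] at hd ⊢ <;> ring_nf at hd ⊢ <;>
    rw [dvd_neg] at hd <;>
    first
    | exact hd
    | exact hd.mul_right 4
    | (have := hd.mul_right 2; ring_nf at this; exact this)

/-- The exponential sum of `q(B₀ + m B) / m` modulo `r`, where `q(B₀) = m f₀`. -/
noncomputable def twistedSum (r : ℕ) [NeZero r] (m : ℕ) (B₀ : V ℤ) (f₀ : ℤ) (a : ZMod r) : ℂ :=
  ∑ B : V (ZMod r),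
    ZMod.stdAddChar (a * ((f₀ : ZMod r) + polar (fun i => (B₀ i : ZMod r)) B + (m : ZMod r) * q B))

/-- When `m` is invertible modulo `r`, replace `a` by `a m`: the argument becomes `a * q (B₀ + m
B)`, and `B ↦ B₀ + m B` is a bijection modulo `r`. The equality needs the sum over `a`; individual
terms need not agree. -/
theorem sum_twistedSum_of_coprime (r : ℕ) [NeZero r] (m : ℕ) (B₀ : V ℤ) (f₀ : ℤ)
    (h₀ : q B₀ = m * f₀) (hc : r.Coprime m) :
    ∑ a : (ZMod r)ˣ, twistedSum r m B₀ f₀ a = ∑ a : (ZMod r)ˣ, expSum r a := by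
  let u := ZMod.unitOfCoprime m hc.symm
  have hu : (u : ZMod r) = m := ZMod.coe_unitOfCoprime m hc.symm
  refine (Equiv.sum_comp (Equiv.mulRight u) fun a : (ZMod r)ˣ => twistedSum r m B₀ f₀ a).symm.trans ?_
  refine sum_congr rfl fun a _ => ?_
  unfold twistedSum expSum
  let φ : V (ZMod r) ≃ V (ZMod r) := Equiv.piCongrRight fun i : Fin 9 =>
    (Units.mulLeft u).trans (Equiv.addLeft (B₀ i : ZMod r))
  refine Fintype.sum_equiv φ _ _ fun B => ?_
  have hφ : φ B = (fun i => (B₀ i : ZMod r)) + (m : ZMod r) • B := by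
    funext i
    simp only [Pi.add_apply, Pi.smul_apply, smul_eq_mul, ← hu]
    rfl
  have hq : q (fun i => (B₀ i : ZMod r)) = m * f₀ := by
    have := map_q (Int.castRingHom (ZMod r)) B₀
    simp only [eq_intCast] at this
    rw [this, h₀]; push_cast; rfl
  rw [hφ, q_add_smul, hq, Equiv.coe_mulRight, Units.val_mul, hu]
  congr 1
  ring

/-- Translate `B` by `w = (r / p) v`. As `m r / p ≡ 0` modulo `r`, the quadratic term is unchanged,
while the linear term contributes the phase `e (a * polar B₀ v / p)`. This is not `1` for suitable
`v`, so the sum equals itself times a nontrivial root of unity. -/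
theorem twistedSum_eq_zero (r : ℕ) [NeZero r] {m : ℕ} (hm : Odd m) (B₀ : V ℤ) (f₀ : ℤ)
    {p : ℕ} (hp : p.Prime) (hpm : p ∣ m) (hpr : p ∣ r) (h : ∃ i, ¬ (p : ℤ) ∣ B₀ i)
    (a : (ZMod r)ˣ) : twistedSum r m B₀ f₀ a = 0 := by
  have hp2 : p ≠ 2 := by
    rintro rfl
    exact (Nat.not_even_iff_odd.2 hm) (even_iff_two_dvd.2 hpm)
  obtain ⟨v, hv⟩ := exists_polar_not_dvd hp hp2 B₀ h
  obtain ⟨s, hs⟩ := hpr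
  obtain ⟨m', hm'⟩ := hpm
  let w : V (ZMod r) := (s : ZMod r) • fun i => (v i : ZMod r)
  have hms : (m : ZMod r) * s = 0 := by
    rw [← Nat.cast_mul, ZMod.natCast_eq_zero_iff, hm', hs]
    exact ⟨m', by ring⟩
  have hpol : polar (fun i => (B₀ i : ZMod r)) w = ((s * polar B₀ v : ℤ) : ZMod r) := by
    have := map_polar (Int.castRingHom (ZMod r)) B₀ v
    simp only [eq_intCast] at this
    rw [polar_smul, this]; push_cast; rfl
  have hqw : ∀ B : V (ZMod r), (m : ZMod r) * q (B + w) = m * q B := by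
    intro B
    rw [q_add_smul]
    linear_combination (polar B (fun i => (v i : ZMod r)) + s * q (fun i => (v i : ZMod r))) * hms
  have hne : (ZMod.stdAddChar ((a : ZMod r) * ((s * polar B₀ v : ℤ) : ZMod r)) : ℂ) ≠ 1 := by
    rw [← AddChar.map_zero_eq_one (ZMod.stdAddChar (N := r))]
    intro h
    have h1 := ZMod.injective_stdAddChar h
    rw [Units.mul_right_eq_zero, ZMod.intCast_zmod_eq_zero_iff_dvd, hs] at h1
    apply hv
    have hs0 : (s : ℤ) ≠ 0 := by
      rintro h0
      have : s = 0 := by exact_mod_cast h0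
      exact NeZero.ne r (by rw [hs, this, mul_zero])
    push_cast at h1
    rw [mul_comm (p : ℤ)] at h1
    exact (mul_dvd_mul_iff_left hs0).1 h1
  have key : twistedSum r m B₀ f₀ a =
      ZMod.stdAddChar ((a : ZMod r) * ((s * polar B₀ v : ℤ) : ZMod r)) *
        twistedSum r m B₀ f₀ a := by
    conv_lhs => unfold twistedSum
    rw [← Equiv.sum_comp (Equiv.addRight w), twistedSum, mul_sum]
    refine sum_congr rfl fun B _ => ?_
    rw [Equiv.coe_addRight, ← AddChar.map_add_eq_mul, polar_add, hpol, hqw]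
    congr 1
    ring
  have h2 : (1 - (ZMod.stdAddChar ((a : ZMod r) * ((s * polar B₀ v : ℤ) : ZMod r)) : ℂ)) *
      twistedSum r m B₀ f₀ a = 0 := by
    linear_combination key
  exact (mul_eq_zero.1 h2).resolve_left (sub_ne_zero.2 hne.symm)

theorem sum_residues_eq (r : ℕ) [NeZero r] {m : ℕ} (hm : Odd m) (B₀ : V ℤ)
    (h₀ : (m : ℤ) ∣ q B₀) (h : ∀ p : ℕ, p.Prime → p ∣ m → ∃ i, ¬ (p : ℤ) ∣ B₀ i) :
    ∑ a ∈ (range r).filter (fun a => Nat.gcd a r = 1),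
      ∑ B ∈ Fintype.piFinset (fun _ : Fin 9 => Ico (0 : ℤ) r),
        e ((a : ℝ) / r * ((q (fun i => B₀ i + m * B i) : ℤ) : ℝ) / m) =
      (r : ℂ) ^ 9 * if r.Coprime m then C r else 0 := by
  obtain ⟨f₀, hf₀⟩ := h₀
  have hm0 : (m : ℝ) ≠ 0 := by
    have := hm.pos
    positivity
  have h1 : ∑ a ∈ (range r).filter (fun a => Nat.gcd a r = 1),
      ∑ B ∈ Fintype.piFinset (fun _ : Fin 9 => Ico (0 : ℤ) r),
        e ((a : ℝ) / r * ((q (fun i => B₀ i + m * B i) : ℤ) : ℝ) / m) =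
      ∑ a : (ZMod r)ˣ, twistedSum r m B₀ f₀ a := by
    rw [← sum_filter_coprime r (twistedSum r m B₀ f₀)]
    refine sum_congr rfl fun a _ => ?_
    rw [twistedSum, ← sum_Ico_eq_sum_zmod]
    refine sum_congr rfl fun B _ => ?_
    have hq : q (fun i => B₀ i + m * B i) = m * (f₀ + polar B₀ B + m * q B) := by
      rw [show (fun i => B₀ i + m * B i) = B₀ + (m : ℤ) • B from rfl, q_add_smul, hf₀]
      ring
    have hp := map_polar (Int.castRingHom (ZMod r)) B₀ B
    have hqB := map_q (Int.castRingHom (ZMod r)) B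
    simp only [eq_intCast] at hp hqB
    rw [hp, hqB, hq]
    have := e_div_eq_stdAddChar r ((a : ℤ) * (f₀ + polar B₀ B + m * q B))
    push_cast at this ⊢
    rw [← this]
    congr 1
    field_simp
  rw [h1]
  split_ifs with hc
  · rw [sum_twistedSum_of_coprime r m B₀ f₀ hf₀ hc, C_eq]
    have : (r : ℂ) ≠ 0 := by exact_mod_cast NeZero.ne r
    field_simp
  · obtain ⟨p, hp, hpr, hpm⟩ := Nat.Prime.not_coprime_iff_dvd.1 hc
    rw [mul_zero]
    exact sum_eq_zero fun a _ => twistedSum_eq_zero r hm B₀ f₀ hp hpm hpr (h p hp hpm) a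

/-! ### Fresnel-type integrals -/

/-- If `c ≤ π / 2` the integrand is positive inside the interval. Otherwise cut at the first zero
`w` of the cosine, `c w² = π / 2`: the part up to `w` is at least `(1 - π² / 40) w > 0.75 w`, by
`cos x ≥ 1 - x² / 2`, and the rest is at least `-(2 / π) w > -0.64 w`, by integration by parts. -/
theorem integral_cos_mul_sq_pos {c : ℝ} (hc : 0 ≤ c) : 0 < ∫ z in (0 : ℝ)..1, Real.cos (c * z ^ 2) := by
  rcases le_or_gt c (Real.pi / 2) with h | h
  · refine intervalIntegral.intervalIntegral_pos_of_pos_on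
      (Continuous.intervalIntegrable (by fun_prop) _ _) (fun z hz => ?_) one_pos
    have h1 : z ^ 2 < 1 := by nlinarith [hz.1, hz.2]
    have h2 : 0 ≤ z ^ 2 := sq_nonneg z
    refine Real.cos_pos_of_mem_Ioo ⟨?_, ?_⟩
    · nlinarith [Real.pi_pos]
    · nlinarith [Real.pi_pos]
  · have hpi := Real.pi_pos
    have hc0 : 0 < c := by linarith
    set w := Real.sqrt (Real.pi / (2 * c)) with hw
    have hwpos : 0 < w := Real.sqrt_pos.2 (by positivity)
    have hw2 : c * w ^ 2 = Real.pi / 2 := by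
      rw [hw, Real.sq_sqrt (by positivity)]; field_simp
    have hw1 : w < 1 := by
      by_contra hcon
      push Not at hcon
      have : c * 1 ≤ c * w ^ 2 := by gcongr; nlinarith
      linarith
    have hint : ∀ a b : ℝ, IntervalIntegrable (fun z => Real.cos (c * z ^ 2)) volume a b :=
      fun a b => Continuous.intervalIntegrable (by fun_prop) _ _
    rw [← intervalIntegral.integral_add_adjacent_intervals (hint 0 w) (hint w 1)]
    have h1 : w - c ^ 2 * w ^ 5 / 10 ≤ ∫ z in (0 : ℝ)..w, Real.cos (c * z ^ 2) := by
      have : ∫ z in (0 : ℝ)..w, (1 - c ^ 2 / 2 * z ^ 4) = w - c ^ 2 * w ^ 5 / 10 := by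
        rw [intervalIntegral.integral_sub (by simp) (Continuous.intervalIntegrable (by fun_prop) _ _),
          intervalIntegral.integral_const_mul, integral_pow]
        simp; ring
      rw [← this]
      refine intervalIntegral.integral_mono_on hwpos.le
        (Continuous.intervalIntegrable (by fun_prop) _ _) (hint _ _) fun z _ => ?_
      have := Real.one_sub_sq_div_two_le_cos (x := c * z ^ 2)
      refine le_trans (le_of_eq ?_) this
      ring
    -- The primitive `sin + 1` in place of `sin` makes the remaining integral of the integration by
    -- parts nonnegative, so it can be dropped.
    have h2 : (Real.sin (c * 1 ^ 2) + 1) / (2 * c * 1) - (Real.sin (c * w ^ 2) + 1) / (2 * c * w) ≤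
        ∫ z in w..1, Real.cos (c * z ^ 2) := by
      have hpos : ∀ z ∈ Set.uIcc w 1, 0 < z := fun z hz => by
        rw [Set.uIcc_of_le hw1.le] at hz; exact hwpos.trans_le hz.1
      have hcont : ContinuousOn
          (fun z => Real.cos (c * z ^ 2) - (Real.sin (c * z ^ 2) + 1) / (2 * c * z ^ 2))
          (Set.uIcc w 1) := by
        refine ContinuousOn.sub (by fun_prop) (ContinuousOn.div (by fun_prop) (by fun_prop) ?_)
        intro z hz
        have := hpos z hz
        positivity
      rw [← intervalIntegral.integral_eq_sub_of_hasDerivAt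
        (f := fun z => (Real.sin (c * z ^ 2) + 1) / (2 * c * z))
        (f' := fun z => Real.cos (c * z ^ 2) - (Real.sin (c * z ^ 2) + 1) / (2 * c * z ^ 2))
        ?_ hcont.intervalIntegrable]
      · refine intervalIntegral.integral_mono_on hw1.le hcont.intervalIntegrable (hint _ _)
          fun z hz => ?_
        have h3 := Real.neg_one_le_sin (c * z ^ 2)
        have : 0 ≤ (Real.sin (c * z ^ 2) + 1) / (2 * c * z ^ 2) :=
          div_nonneg (by linarith) (by positivity)
        linarith
      · intro z hz
        have hz0 := hpos z hz
        have hd1 : HasDerivAt (fun z : ℝ => c * z ^ 2) (c * (2 * z)) z := by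
          simpa using (hasDerivAt_pow 2 z).const_mul c
        have hd2 : HasDerivAt (fun z : ℝ => 2 * c * z) (2 * c) z := by
          simpa using (hasDerivAt_id z).const_mul (2 * c)
        have := (hd1.sin.add_const 1).div hd2 (by positivity)
        convert! this using 1
        field_simp
    rw [hw2, Real.sin_pi_div_two] at h2
    have h4 : 0 ≤ (Real.sin (c * 1 ^ 2) + 1) / (2 * c * 1) :=
      div_nonneg (by linarith [Real.neg_one_le_sin (c * 1 ^ 2)]) (by positivity)
    have h5 : ((1 : ℝ) + 1) / (2 * c * w) = w * (2 / Real.pi) := by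
      have : Real.pi = 2 * (c * w ^ 2) := by linarith
      rw [this]; field_simp; norm_num
    have h6 : w - c ^ 2 * w ^ 5 / 10 = w * (1 - Real.pi ^ 2 / 40) := by
      have : Real.pi = 2 * (c * w ^ 2) := by linarith
      rw [this]; ring
    have h7 : 2 / Real.pi < 0.64 := by
      rw [div_lt_iff₀ hpi]; nlinarith [Real.pi_gt_d2]
    have h8 : Real.pi ^ 2 / 40 < 0.25 := by nlinarith [Real.pi_lt_d2]
    rw [h5] at h2
    rw [h6] at h1
    have : 0 < w * (1 - Real.pi ^ 2 / 40) - w * (2 / Real.pi) := by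
      rw [← mul_sub]; apply mul_pos hwpos; linarith
    linarith

/-! ### The oscillatory integrals of the two kinds of coordinates -/

/-- The oscillatory integral of a hyperbolic plane. -/
noncomputable def pairIntegral (U W φ : ℝ) : ℂ :=
  ∫ x in (-U)..U, ∫ y in (-W)..W, e (φ * x * y)

/-- The oscillatory integral of a square. -/
noncomputable def squareIntegral (U φ : ℝ) : ℂ := ∫ z in (-U)..U, e (φ * z ^ 2)

theorem integral_neg_comp_mul {E : Type*} [NormedAddCommGroup E] [NormedSpace ℝ E]
    {U : ℝ} (hU : 0 < U) (f : ℝ → E) :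
    ∫ x in (-U)..U, f x = U • ∫ x in (-1 : ℝ)..1, f (U * x) := by
  rw [intervalIntegral.integral_comp_mul_left f hU.ne', smul_inv_smul₀ hU.ne']
  simp

/-- Up to the factor `U * W`, the integral depends only on `U * W * φ`. Planes with equal products
of sides and equal coefficients therefore have the same integral, which is what produces squares in
`boxIntegral_eq_sq`. -/
theorem pairIntegral_scale {U W : ℝ} (hU : 0 < U) (hW : 0 < W) (φ : ℝ) :
    pairIntegral U W φ = (U * W : ℝ) * pairIntegral 1 1 (U * W * φ) := by
  unfold pairIntegral
  rw [integral_neg_comp_mul hU, mul_comm U W]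
  simp_rw [integral_neg_comp_mul hW, intervalIntegral.integral_smul]
  rw [smul_smul, Complex.real_smul, mul_comm U W]
  congr 1
  refine intervalIntegral.integral_congr fun x _ => intervalIntegral.integral_congr fun y _ => ?_
  exact congrArg e (by ring)

theorem conj_intervalIntegral (a b : ℝ) (f : ℝ → ℂ) :
    (starRingEnd ℂ) (∫ x in a..b, f x) = ∫ x in a..b, (starRingEnd ℂ) (f x) := by
  simp only [intervalIntegral, map_sub, integral_conj]

theorem conj_pairIntegral (U W φ : ℝ) :
    (starRingEnd ℂ) (pairIntegral U W φ) = pairIntegral U W φ := by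
  unfold pairIntegral
  rw [conj_intervalIntegral]
  refine intervalIntegral.integral_congr fun x _ => ?_
  have h := intervalIntegral.integral_comp_neg (a := -W) (b := W) fun y => e (φ * x * y)
  rw [neg_neg] at h
  rw [conj_intervalIntegral, ← h]
  refine intervalIntegral.integral_congr fun y _ => ?_
  simp only [conj_e]
  congr 1; ring

theorem pairIntegral_eq_re (U W φ : ℝ) : pairIntegral U W φ = ((pairIntegral U W φ).re : ℂ) :=
  (Complex.conj_eq_iff_re.1 (conj_pairIntegral U W φ)).symm

theorem norm_integral_e_le_two {W : ℝ} (hW : 0 ≤ W) (f : ℝ → ℝ) :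
    ‖∫ y in (-W)..W, e (f y)‖ ≤ 2 * W := by
  have := intervalIntegral.norm_integral_le_of_norm_le_const (a := -W) (b := W) (C := 1)
    (f := fun y => e (f y)) (fun y _ => (norm_e _).le)
  rw [one_mul, sub_neg_eq_add, abs_of_nonneg (by linarith)] at this
  linarith

theorem norm_integral_e_linear_le (W : ℝ) {c : ℝ} (hc : c ≠ 0) :
    ‖∫ y in (-W)..W, e (c * y)‖ ≤ 1 / |c| := by
  have hn : (2 * Real.pi * Complex.I * (c : ℂ)) ≠ 0 := by simp [Real.pi_ne_zero, hc]
  have hd : ∀ x ∈ Set.uIcc (-W) W, HasDerivAt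
      (fun y : ℝ => (2 * Real.pi * Complex.I * (c : ℂ))⁻¹ * e (c * y)) (e (c * x)) x := by
    intro x _
    have := ((hasDerivAt_e (c * x)).scomp x ((hasDerivAt_id x).const_mul c)).const_mul
      (2 * Real.pi * Complex.I * (c : ℂ))⁻¹
    convert! this using 1
    have hc' : (c : ℂ) ≠ 0 := by exact_mod_cast hc
    simp only [mul_one, Complex.real_smul]
    field_simp
  rw [intervalIntegral.integral_eq_sub_of_hasDerivAt hd
    (Continuous.intervalIntegrable (by fun_prop) _ _), ← mul_sub, norm_mul, norm_inv]
  have h1 : ‖e (c * W) - e (c * -W)‖ ≤ 2 := (norm_sub_le _ _).trans (by rw [norm_e, norm_e]; norm_num)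
  have h2 : ‖2 * Real.pi * Complex.I * (c : ℂ)‖ = 2 * Real.pi * |c| := by
    simp [abs_of_pos Real.pi_pos]
  rw [h2]
  have hc' : 0 < |c| := abs_pos.2 hc
  have hpi := Real.pi_gt_three
  calc (2 * Real.pi * |c|)⁻¹ * ‖e (c * W) - e (c * -W)‖ ≤ (2 * Real.pi * |c|)⁻¹ * 2 := by gcongr
    _ = 1 / (Real.pi * |c|) := by field_simp
    _ ≤ 1 / |c| := by
      apply one_div_le_one_div_of_le hc'
      nlinarith

/-- An interpolation between the bounds `2` and `1 / |c|`. The exponent `3 / 4` is below `1`, so the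
bound can be integrated in `x` across `0`, and four such factors give the decay `|θ| ^ (-3)` of the
box integral. -/
theorem norm_integral_e_linear_le_rpow {c : ℝ} (hc : c ≠ 0) :
    ‖∫ y in (-1 : ℝ)..1, e (c * y)‖ ≤ 2 * |c| ^ (-(3 / 4) : ℝ) := by
  have hc' : 0 < |c| := abs_pos.2 hc
  rcases le_total |c| 1 with h | h
  · refine (norm_integral_e_le_two zero_le_one _).trans ?_
    have := Real.one_le_rpow_of_pos_of_le_one_of_nonpos hc' h (z := -(3 / 4)) (by norm_num)
    linarith
  · refine (norm_integral_e_linear_le 1 hc).trans ?_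
    have : |c| ^ (-1 : ℝ) ≤ |c| ^ (-(3 / 4) : ℝ) :=
      Real.rpow_le_rpow_of_exponent_le h (by norm_num)
    rw [Real.rpow_neg_one] at this
    have h3 : 0 ≤ |c| ^ (-(3 / 4) : ℝ) := by positivity
    rw [one_div]; linarith

theorem continuous_inner_integral (W φ : ℝ) :
    Continuous fun x : ℝ => ∫ y in (-W)..W, e (φ * x * y) :=
  intervalIntegral.continuous_parametric_intervalIntegral_of_continuous' (by fun_prop) _ _

theorem norm_pairIntegral_one_le (φ : ℝ) : ‖pairIntegral 1 1 φ‖ ≤ 4 := by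
  have := intervalIntegral.norm_integral_le_of_norm_le_const (a := -1) (b := 1) (C := 2)
    (f := fun x => ∫ y in (-1 : ℝ)..1, e (φ * x * y))
    (fun y _ => (norm_integral_e_le_two zero_le_one _).trans (by norm_num))
  norm_num at this
  exact this

/-- Integrate the inner bound over `x`: each half of the interval gives `2 * 4 = 8`, since `x ^
(-3/4)` has integral `4` over the unit interval. -/
theorem norm_pairIntegral_one_le_rpow {φ : ℝ} (hφ : φ ≠ 0) :
    ‖pairIntegral 1 1 φ‖ ≤ 16 * |φ| ^ (-(3 / 4) : ℝ) := by
  set J : ℝ → ℂ := fun x => ∫ y in (-1 : ℝ)..1, e (φ * x * y) with hJ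
  have hint : ∀ a b, IntervalIntegrable J volume a b := fun a b =>
    (continuous_inner_integral 1 φ).intervalIntegrable a b
  have hI : IntervalIntegrable (fun x : ℝ => 2 * |φ| ^ (-(3 / 4) : ℝ) * x ^ (-(3 / 4) : ℝ))
      volume 0 1 := (intervalIntegral.intervalIntegrable_rpow' (by norm_num)).const_mul _
  have hval : ∫ x in (0 : ℝ)..1, 2 * |φ| ^ (-(3 / 4) : ℝ) * x ^ (-(3 / 4) : ℝ) =
      8 * |φ| ^ (-(3 / 4) : ℝ) := by
    rw [intervalIntegral.integral_const_mul, integral_rpow (Or.inl (by norm_num))]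
    norm_num
    ring
  have hb : ∀ s : ℝ, |s| = 1 → ‖∫ x in (0 : ℝ)..1, J (s * x)‖ ≤ 8 * |φ| ^ (-(3 / 4) : ℝ) := by
    intro s hs
    rw [← hval]
    refine intervalIntegral.norm_integral_le_of_norm_le zero_le_one
      (Filter.Eventually.of_forall fun x hx => ?_) hI
    have hs0 : s ≠ 0 := by intro h; simp [h] at hs
    have := norm_integral_e_linear_le_rpow (c := φ * (s * x))
      (mul_ne_zero hφ (mul_ne_zero hs0 hx.1.ne'))
    rw [abs_mul, abs_mul, hs, one_mul, abs_of_pos hx.1,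
      Real.mul_rpow (abs_nonneg _) hx.1.le, ← mul_assoc (2 : ℝ)] at this
    exact this
  have h1 : pairIntegral 1 1 φ = (∫ x in (0 : ℝ)..1, J (-1 * x)) + ∫ x in (0 : ℝ)..1, J (1 * x) := by
    have := intervalIntegral.integral_comp_neg (a := 0) (b := 1) J
    simp only [neg_one_mul, one_mul, this, neg_zero]
    rw [intervalIntegral.integral_add_adjacent_intervals (hint _ _) (hint _ _)]
    rfl
  rw [h1]
  refine (norm_add_le _ _).trans ?_
  have := hb (-1) (by simp)
  have := hb 1 (by simp)
  linarith

theorem squareIntegral_re_pos {U : ℝ} (hU : 0 < U) (φ : ℝ) : 0 < (squareIntegral U φ).re := by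
  have h1 : (squareIntegral U φ).re = U * ∫ z in (-1 : ℝ)..1, Real.cos (|2 * Real.pi * φ * U ^ 2| * z ^ 2) := by
    unfold squareIntegral
    have hi : IntervalIntegrable (fun z => e (φ * z ^ 2)) volume (-U) U :=
      Continuous.intervalIntegrable (by fun_prop) _ _
    have := (Complex.reCLM.intervalIntegral_comp_comm hi)
    simp only [Complex.reCLM_apply] at this
    rw [← this, integral_neg_comp_mul hU, smul_eq_mul]
    congr 1
    refine intervalIntegral.integral_congr fun z _ => ?_
    rw [e_re, ← Real.cos_abs, ← Real.cos_abs (_ * z ^ 2), abs_mul |_|, abs_abs, ← abs_mul]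
    congr 2; ring
  rw [h1]
  refine mul_pos hU ?_
  set c := |2 * Real.pi * φ * U ^ 2|
  have hint : ∀ a b : ℝ, IntervalIntegrable (fun z => Real.cos (c * z ^ 2)) volume a b :=
    fun a b => Continuous.intervalIntegrable (by fun_prop) _ _
  rw [← intervalIntegral.integral_add_adjacent_intervals (hint (-1) 0) (hint 0 1)]
  have h2 := intervalIntegral.integral_comp_neg (a := 0) (b := 1) fun z => Real.cos (c * z ^ 2)
  simp only [neg_sq, neg_zero] at h2
  rw [← h2]
  have := integral_cos_mul_sq_pos (c := c) (abs_nonneg _)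
  linarith

/-! ### Factorization of the oscillatory integral over the box -/

/-- `splitEquiv` as a measurable equivalence of real spaces. -/
noncomputable def splitMeasurableEquiv : V ℝ ≃ᵐ (ℝ × ℝ) × (ℝ × ℝ) × (ℝ × ℝ) × (ℝ × ℝ) × ℝ where
  toEquiv := splitEquiv ℝ
  measurable_toFun := by
    change Measurable fun B : V ℝ => ((B 0, B 8), (B 4, B 6), (B 1, B 7), (B 2, B 5), B 3)
    fun_prop
  measurable_invFun := by
    refine measurable_pi_lambda _ fun i => ?_
    change Measurable fun z : (ℝ × ℝ) × (ℝ × ℝ) × (ℝ × ℝ) × (ℝ × ℝ) × ℝ =>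
      (![z.1.1, z.2.2.1.1, z.2.2.2.1.1, z.2.2.2.2, z.2.1.1, z.2.2.2.1.2, z.2.1.2, z.2.2.1.2,
        z.1.2] : Fin 9 → ℝ) i
    fin_cases i <;> simp <;> fun_prop

theorem measurePreserving_split : MeasurePreserving splitMeasurableEquiv := by
  refine MeasurePreserving.symm splitMeasurableEquiv.symm ⟨splitMeasurableEquiv.symm.measurable, ?_⟩
  refine (Measure.pi_eq fun s hs => ?_).symm
  rw [Measure.map_apply splitMeasurableEquiv.symm.measurable (MeasurableSet.univ_pi hs)]
  have : splitMeasurableEquiv.symm ⁻¹' (Set.univ.pi s) =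
      (s 0 ×ˢ s 8) ×ˢ (s 4 ×ˢ s 6) ×ˢ (s 1 ×ˢ s 7) ×ˢ (s 2 ×ˢ s 5) ×ˢ s 3 := by
    ext z
    simp only [Set.mem_preimage, Set.mem_pi, Set.mem_univ, true_imp_iff, Set.mem_prod]
    constructor
    · intro h
      exact ⟨⟨h 0, h 8⟩, ⟨h 4, h 6⟩, ⟨h 1, h 7⟩, ⟨h 2, h 5⟩, h 3⟩
    · rintro ⟨⟨h0, h8⟩, ⟨h4, h6⟩, ⟨h1, h7⟩, ⟨h2, h5⟩, h3⟩ i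
      fin_cases i <;> assumption
  rw [this]
  simp only [Measure.volume_eq_prod, Measure.prod_prod]
  simp only [Fin.prod_univ_succ, Fin.succ_zero_eq_one, Fin.succ_one_eq_two]
  simp
  ring_nf

theorem integral_Icc_prod {U W : ℝ} (hU : 0 ≤ U) (hW : 0 ≤ W) {f : ℝ → ℝ → ℂ}
    (hf : Continuous f.uncurry) :
    ∫ z in Set.Icc (-U) U ×ˢ Set.Icc (-W) W, f z.1 z.2 = ∫ x in (-U)..U, ∫ y in (-W)..W, f x y := by
  rw [Measure.volume_eq_prod, setIntegral_prod]
  · rw [integral_Icc_eq_integral_Ioc, ← intervalIntegral.integral_of_le (by linarith)]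
    refine intervalIntegral.integral_congr fun x _ => ?_
    dsimp only
    rw [integral_Icc_eq_integral_Ioc, ← intervalIntegral.integral_of_le (by linarith)]
  · exact hf.continuousOn.integrableOn_compact (isCompact_Icc.prod isCompact_Icc)

theorem box_eq (Y : V ℝ) : box Y = splitMeasurableEquiv ⁻¹'
    ((Set.Icc (-Y 0) (Y 0) ×ˢ Set.Icc (-Y 8) (Y 8)) ×ˢ (Set.Icc (-Y 4) (Y 4) ×ˢ Set.Icc (-Y 6) (Y 6)) ×ˢ
      (Set.Icc (-Y 1) (Y 1) ×ˢ Set.Icc (-Y 7) (Y 7)) ×ˢ (Set.Icc (-Y 2) (Y 2) ×ˢ Set.Icc (-Y 5) (Y 5)) ×ˢ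
        Set.Icc (-Y 3) (Y 3)) := by
  ext B
  simp only [box, Set.mem_ofPred_eq, Set.mem_preimage]
  change _ ↔ ((B 0, B 8), (B 4, B 6), (B 1, B 7), (B 2, B 5), B 3) ∈ _
  simp only [Set.mem_prod, Set.mem_Icc, abs_le]
  constructor
  · intro h
    exact ⟨⟨h 0, h 8⟩, ⟨h 4, h 6⟩, ⟨h 1, h 7⟩, ⟨h 2, h 5⟩, h 3⟩
  · rintro ⟨⟨h0, h8⟩, ⟨h4, h6⟩, ⟨h1, h7⟩, ⟨h2, h5⟩, h3⟩ i
    fin_cases i <;> assumption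

theorem boxIntegral_eq {Y : V ℝ} (hY : ∀ i, 0 ≤ Y i) (θ : ℝ) :
    boxIntegral Y θ = pairIntegral (Y 0) (Y 8) (-θ) * pairIntegral (Y 4) (Y 6) (-θ) *
      pairIntegral (Y 1) (Y 7) (-2 * θ) * pairIntegral (Y 2) (Y 5) (-2 * θ) *
        squareIntegral (Y 3) (-2 * θ) := by
  have h1 : ∀ B : V ℝ, e (θ * q B) = e (-θ * B 0 * B 8) * (e (-θ * B 4 * B 6) *
      (e (-2 * θ * B 1 * B 7) * (e (-2 * θ * B 2 * B 5) * e (-2 * θ * B 3 ^ 2)))) := by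
    intro B
    simp only [← e_add]
    congr 1
    unfold q; ring
  unfold boxIntegral
  simp_rw [h1]
  rw [box_eq]
  refine (measurePreserving_split.setIntegral_preimage_emb splitMeasurableEquiv.measurableEmbedding
    (fun z : (ℝ × ℝ) × (ℝ × ℝ) × (ℝ × ℝ) × (ℝ × ℝ) × ℝ =>
      e (-θ * z.1.1 * z.1.2) * (e (-θ * z.2.1.1 * z.2.1.2) * (e (-2 * θ * z.2.2.1.1 * z.2.2.1.2) *
      (e (-2 * θ * z.2.2.2.1.1 * z.2.2.2.1.2) * e (-2 * θ * z.2.2.2.2 ^ 2))))) _).trans ?_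
  simp only [Measure.volume_eq_prod ((ℝ × ℝ))]
  rw [setIntegral_prod_mul (fun z : ℝ × ℝ => e (-θ * z.1 * z.2)) (fun w : (ℝ × ℝ) × (ℝ × ℝ) × (ℝ × ℝ) × ℝ =>
      (e (-θ * w.1.1 * w.1.2) * (e (-2 * θ * w.2.1.1 * w.2.1.2) *
      (e (-2 * θ * w.2.2.1.1 * w.2.2.1.2) * e (-2 * θ * w.2.2.2 ^ 2))))),
    setIntegral_prod_mul (fun z : ℝ × ℝ => e (-θ * z.1 * z.2)) (fun w : (ℝ × ℝ) × (ℝ × ℝ) × ℝ =>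
      (e (-2 * θ * w.1.1 * w.1.2) *
      (e (-2 * θ * w.2.1.1 * w.2.1.2) * e (-2 * θ * w.2.2 ^ 2)))),
    setIntegral_prod_mul (fun z : ℝ × ℝ => e (-2 * θ * z.1 * z.2)) (fun w : (ℝ × ℝ) × ℝ =>
      (e (-2 * θ * w.1.1 * w.1.2) * e (-2 * θ * w.2 ^ 2))),
    setIntegral_prod_mul (fun z : ℝ × ℝ => e (-2 * θ * z.1 * z.2)) (fun w : ℝ =>
      e (-2 * θ * w ^ 2)),
    integral_Icc_prod (hY 0) (hY 8) (f := fun x y => e (-θ * x * y)) (by fun_prop),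
    integral_Icc_prod (hY 4) (hY 6) (f := fun x y => e (-θ * x * y)) (by fun_prop),
    integral_Icc_prod (hY 1) (hY 7) (f := fun x y => e (-2 * θ * x * y)) (by fun_prop),
    integral_Icc_prod (hY 2) (hY 5) (f := fun x y => e (-2 * θ * x * y)) (by fun_prop),
    integral_Icc_eq_integral_Ioc, ← intervalIntegral.integral_of_le (by linarith [hY 3])]
  unfold pairIntegral squareIntegral
  ring

theorem isCompact_box (Y : V ℝ) : IsCompact (box Y) := by
  have : box Y = Set.univ.pi fun i => Set.Icc (-Y i) (Y i) := by
    ext B; simp only [box, abs_le, Set.mem_pi, Set.mem_ofPred_eq, Set.mem_univ, Set.mem_Icc,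
      true_imp_iff]
  rw [this]
  exact isCompact_univ_pi fun i => isCompact_Icc

theorem continuous_q : Continuous (q : V ℝ → ℝ) := by unfold q; fun_prop

theorem continuous_boxIntegral (Y : V ℝ) : Continuous (boxIntegral Y) := by
  refine continuous_parametric_integral_of_continuous (f := fun θ (B : V ℝ) => e (θ * q B)) ?_
    (isCompact_box Y)
  exact continuous_e.comp (continuous_fst.mul (continuous_q.comp continuous_snd))

theorem conj_boxIntegral (Y : V ℝ) (θ : ℝ) :
    (starRingEnd ℂ) (boxIntegral Y θ) = boxIntegral Y (-θ) := by
  unfold boxIntegral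
  rw [← integral_conj]
  simp only [conj_e, neg_mul]

/-! ### The singular integral -/

theorem norm_pairIntegral_le {A U W φ : ℝ} (hU : 0 < U) (hW : 0 < W) (hA : U * W = A) :
    ‖pairIntegral U W φ‖ ≤ 4 * A := by
  have hA0 : 0 < A := hA ▸ mul_pos hU hW
  rw [pairIntegral_scale hU hW, hA, norm_mul, Complex.norm_real, Real.norm_eq_abs, abs_of_pos hA0]
  nlinarith [norm_pairIntegral_one_le (A * φ)]

theorem norm_pairIntegral_le_rpow {A U W φ : ℝ} (hU : 0 < U) (hW : 0 < W) (hA : U * W = A)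
    (hφ : φ ≠ 0) : ‖pairIntegral U W φ‖ ≤ 16 * A * (A * |φ|) ^ (-(3 / 4) : ℝ) := by
  have hA0 : 0 < A := hA ▸ mul_pos hU hW
  rw [pairIntegral_scale hU hW, hA, norm_mul, Complex.norm_real, Real.norm_eq_abs, abs_of_pos hA0]
  have := norm_pairIntegral_one_le_rpow (φ := A * φ) (mul_ne_zero hA0.ne' hφ)
  rw [abs_mul, abs_of_pos hA0] at this
  nlinarith

theorem norm_squareIntegral_le {U φ : ℝ} (hU : 0 < U) : ‖squareIntegral U φ‖ ≤ 2 * U :=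
  norm_integral_e_le_two hU.le _

/-- The boxes of the theorem: positive sides, with the four products of coupled sides equal. -/
structure IsBalanced (Y : V ℝ) (A : ℝ) : Prop where
  pos : ∀ i, 0 < Y i
  h08 : Y 0 * Y 8 = A
  h46 : Y 4 * Y 6 = A
  h17 : Y 1 * Y 7 = A
  h25 : Y 2 * Y 5 = A

theorem IsBalanced.A_pos {Y : V ℝ} {A : ℝ} (h : IsBalanced Y A) : 0 < A :=
  h.h08 ▸ mul_pos (h.pos 0) (h.pos 8)

theorem norm_boxIntegral_le {Y : V ℝ} {A : ℝ} (h : IsBalanced Y A) (θ : ℝ) :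
    ‖boxIntegral Y θ‖ ≤ 512 * A ^ 4 * Y 3 := by
  have hA := h.A_pos
  rw [boxIntegral_eq fun i => (h.pos i).le]
  simp only [norm_mul]
  calc _ ≤ 4 * A * (4 * A) * (4 * A) * (4 * A) * (2 * Y 3) := by
        gcongr
        · exact norm_pairIntegral_le (h.pos 0) (h.pos 8) h.h08
        · exact norm_pairIntegral_le (h.pos 4) (h.pos 6) h.h46
        · exact norm_pairIntegral_le (h.pos 1) (h.pos 7) h.h17
        · exact norm_pairIntegral_le (h.pos 2) (h.pos 5) h.h25
        · exact norm_squareIntegral_le (h.pos 3)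
    _ = _ := by ring

/-- Each plane decays like `(A |θ|) ^ (-3/4)` and the square is bounded trivially. The constant is
`16 ^ 4 * 2`. -/
theorem norm_boxIntegral_le_cube {Y : V ℝ} {A : ℝ} (h : IsBalanced Y A) {θ : ℝ} (hθ : θ ≠ 0) :
    ‖boxIntegral Y θ‖ ≤ 131072 * A * Y 3 / |θ| ^ 3 := by
  have hA := h.A_pos
  have hθ' : 0 < |θ| := abs_pos.2 hθ
  rw [boxIntegral_eq fun i => (h.pos i).le]
  simp only [norm_mul]
  set t := (A * |θ|) ^ (-(3 / 4) : ℝ) with ht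
  have ht0 : 0 < t := by positivity
  have ht4 : t ^ 4 = 1 / (A * |θ|) ^ 3 := by
    rw [ht, ← Real.rpow_natCast, ← Real.rpow_mul (by positivity)]
    norm_num
  have h2 : (A * |-2 * θ|) ^ (-(3 / 4) : ℝ) ≤ t := by
    apply Real.rpow_le_rpow_of_nonpos (by positivity) _ (by norm_num)
    rw [abs_mul]; norm_num
    nlinarith
  have h0 : -2 * θ ≠ 0 := mul_ne_zero (by norm_num) hθ
  have h1 : (A * |-θ|) ^ (-(3 / 4) : ℝ) = t := by rw [abs_neg]
  calc _ ≤ 16 * A * t * (16 * A * t) * (16 * A * t) * (16 * A * t) * (2 * Y 3) := by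
        gcongr
        · exact h1 ▸ norm_pairIntegral_le_rpow (h.pos 0) (h.pos 8) h.h08 (neg_ne_zero.2 hθ)
        · exact h1 ▸ norm_pairIntegral_le_rpow (h.pos 4) (h.pos 6) h.h46 (neg_ne_zero.2 hθ)
        · exact (norm_pairIntegral_le_rpow (h.pos 1) (h.pos 7) h.h17 h0).trans (by gcongr)
        · exact (norm_pairIntegral_le_rpow (h.pos 2) (h.pos 5) h.h25 h0).trans (by gcongr)
        · exact norm_squareIntegral_le (h.pos 3)
    _ = 131072 * A ^ 4 * Y 3 * t ^ 4 := by ring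
    _ = _ := by rw [ht4]; field_simp

theorem norm_boxIntegral_le_inv {Y : V ℝ} {A : ℝ} (h : IsBalanced Y A) (θ : ℝ) :
    ‖boxIntegral Y θ‖ ≤ 262144 * A ^ 4 * Y 3 * (1 + (A * θ) ^ 2)⁻¹ := by
  have hA := h.A_pos
  have hV := h.pos 3
  rw [← div_eq_mul_inv]
  rcases le_or_gt (A * |θ|) 1 with h1 | h1
  · refine (norm_boxIntegral_le h θ).trans ?_
    rw [le_div_iff₀ (by positivity)]
    have h2 : (A * θ) ^ 2 ≤ 1 := by
      rw [← sq_abs, abs_mul, abs_of_pos hA]; exact pow_le_one₀ (by positivity) h1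
    have h3 : 0 < A ^ 4 * Y 3 := by positivity
    nlinarith
  · have hθ : θ ≠ 0 := by rintro rfl; simp at h1; linarith
    have hθ' : 0 < |θ| := abs_pos.2 hθ
    refine (norm_boxIntegral_le_cube h hθ).trans ?_
    rw [div_le_div_iff₀ (by positivity) (by positivity)]
    have h2 : (A * θ) ^ 2 = (A * |θ|) ^ 2 := by rw [mul_pow, mul_pow, sq_abs]
    rw [h2]
    set s := A * |θ| with hs
    have h3 : 262144 * A ^ 4 * Y 3 * |θ| ^ 3 = 131072 * A * Y 3 * (2 * s ^ 3) := by rw [hs]; ring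
    rw [h3]
    have h4 : 1 + s ^ 2 ≤ 2 * s ^ 3 := by nlinarith [mul_pos (sub_pos.2 h1) (sub_pos.2 h1)]
    gcongr

theorem integrable_inv_one_add_mul_sq {A : ℝ} (hA : A ≠ 0) :
    Integrable fun θ : ℝ => (1 + (A * θ) ^ 2)⁻¹ :=
  integrable_inv_one_add_sq.comp_mul_left' hA

theorem integrable_boxIntegral {Y : V ℝ} {A : ℝ} (h : IsBalanced Y A) :
    Integrable (boxIntegral Y) :=
  ((integrable_inv_one_add_mul_sq h.A_pos.ne').const_mul (262144 * A ^ 4 * Y 3)).mono'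
    (continuous_boxIntegral Y).aestronglyMeasurable
    (Filter.Eventually.of_forall fun θ => norm_boxIntegral_le_inv h θ)

theorem norm_singularIntegral_le {Y : V ℝ} {A : ℝ} (h : IsBalanced Y A) :
    ‖singularIntegral Y‖ ≤ 262144 * Real.pi * A ^ 3 * Y 3 := by
  have hA := h.A_pos
  unfold singularIntegral
  refine (norm_integral_le_of_norm_le
    ((integrable_inv_one_add_mul_sq hA.ne').const_mul (262144 * A ^ 4 * Y 3))
    (Filter.Eventually.of_forall fun θ => norm_boxIntegral_le_inv h θ)).trans (le_of_eq ?_)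
  rw [integral_const_mul, Measure.integral_comp_mul_left (fun x : ℝ => (1 + x ^ 2)⁻¹),
    integral_univ_inv_one_add_sq, abs_of_pos (inv_pos.2 hA), smul_eq_mul]
  field_simp

/-- The two planes with coefficient `1` have equal integrals, and so do the two with coefficient
`2`. All are real, so the factor in front of `squareIntegral` is a nonnegative real number. -/
theorem boxIntegral_eq_sq {Y : V ℝ} {A : ℝ} (h : IsBalanced Y A) (θ : ℝ) :
    boxIntegral Y θ = ((A ^ 4 * (pairIntegral 1 1 (A * -θ)).re ^ 2 *
      (pairIntegral 1 1 (A * (-2 * θ))).re ^ 2 : ℝ) : ℂ) * squareIntegral (Y 3) (-2 * θ) := by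
  rw [boxIntegral_eq fun i => (h.pos i).le, pairIntegral_scale (h.pos 0) (h.pos 8),
    pairIntegral_scale (h.pos 4) (h.pos 6), pairIntegral_scale (h.pos 1) (h.pos 7),
    pairIntegral_scale (h.pos 2) (h.pos 5), h.h08, h.h46, h.h17, h.h25,
    pairIntegral_eq_re 1 1 (A * -θ), pairIntegral_eq_re 1 1 (A * (-2 * θ))]
  push_cast
  simp only [Complex.ofReal_re]
  ring

/-- Conjugation amounts to `θ ↦ -θ`, so the value is real. The integrand has nonnegative real part
by `boxIntegral_eq_sq` and `squareIntegral_re_pos`, is continuous, and is nonzero at `θ = 0`. -/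
theorem singularIntegral_pos {Y : V ℝ} {A : ℝ} (h : IsBalanced Y A) :
    (singularIntegral Y).im = 0 ∧ 0 < (singularIntegral Y).re := by
  constructor
  · rw [← Complex.conj_eq_iff_im]
    unfold singularIntegral
    rw [← integral_conj]
    simp only [conj_boxIntegral]
    exact integral_neg_eq_self (boxIntegral Y) volume
  · have hre : (singularIntegral Y).re = ∫ θ, (boxIntegral Y θ).re :=
      (Complex.reCLM.integral_comp_comm (integrable_boxIntegral h)).symm
    have hnn : ∀ θ, 0 ≤ (boxIntegral Y θ).re := fun θ => by
      rw [boxIntegral_eq_sq h, Complex.re_ofReal_mul]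
      have := squareIntegral_re_pos (h.pos 3) (-2 * θ)
      have := h.A_pos
      positivity
    have hcont : Continuous fun θ => (boxIntegral Y θ).re :=
      Complex.continuous_re.comp (continuous_boxIntegral Y)
    rw [hre, integral_pos_iff_support_of_nonneg hnn (integrable_boxIntegral h).re]
    refine hcont.isOpen_support.measure_pos volume ⟨0, ?_⟩
    rw [Function.mem_support, boxIntegral_eq_sq h, Complex.re_ofReal_mul]
    have h1 := squareIntegral_re_pos (h.pos 3) (-2 * 0)
    have h2 := h.A_pos
    have h3 : pairIntegral 1 1 0 = 4 := by
      unfold pairIntegral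
      simp [e_zero]
      norm_num
    simp only [neg_zero, mul_zero, h3] at h1 ⊢
    norm_num
    exact ⟨h2.ne', h1.ne'⟩

theorem integral_Ioi_inv_cube {t : ℝ} (ht : 0 < t) :
    IntegrableOn (fun θ : ℝ => 1 / |θ| ^ 3) (Set.Ioi t) ∧
      ∫ θ in Set.Ioi t, 1 / |θ| ^ 3 = 1 / (2 * t ^ 2) := by
  have heq : Set.EqOn (fun θ : ℝ => θ ^ (-3 : ℝ)) (fun θ : ℝ => 1 / |θ| ^ 3) (Set.Ioi t) := by
    intro θ hθ
    have : 0 < θ := ht.trans hθ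
    simp only
    rw [abs_of_pos this, Real.rpow_neg this.le, one_div]
    norm_cast
  refine ⟨(integrableOn_Ioi_rpow_of_lt (by norm_num) ht).congr_fun heq measurableSet_Ioi, ?_⟩
  rw [← setIntegral_congr_fun measurableSet_Ioi heq, integral_Ioi_rpow_of_lt (by norm_num) ht]
  norm_num
  ring

theorem norm_singularIntegral_sub_le {Y : V ℝ} {A : ℝ} (h : IsBalanced Y A) {t : ℝ} (ht : 0 < t) :
    ‖singularIntegral Y - ∫ θ in (-t)..t, boxIntegral Y θ‖ ≤ 131072 * A * Y 3 / t ^ 2 := by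
  have hi := integrable_boxIntegral h
  have h1 : singularIntegral Y - ∫ θ in (-t)..t, boxIntegral Y θ =
      (∫ θ in Set.Ioi t, boxIntegral Y (-θ)) + ∫ θ in Set.Ioi t, boxIntegral Y θ := by
    rw [integral_comp_neg_Ioi, singularIntegral, intervalIntegral.integral_of_le (by linarith),
      ← integral_add_compl (measurableSet_Ioc (a := -t) (b := t)) hi, add_sub_cancel_left]
    rw [Set.compl_Ioc, setIntegral_union (Set.disjoint_left.2 fun x hx hx' => by
      simp at hx hx'; linarith) measurableSet_Ioi hi.integrableOn hi.integrableOn]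
  obtain ⟨h2, h3⟩ := integral_Ioi_inv_cube ht
  have hb : ∀ s : ℝ, |s| = 1 → ‖∫ θ in Set.Ioi t, boxIntegral Y (s * θ)‖ ≤
      131072 * A * Y 3 * (1 / (2 * t ^ 2)) := by
    intro s hs
    rw [← h3, ← integral_const_mul]
    refine norm_integral_le_of_norm_le (h2.const_mul _) ?_
    filter_upwards [ae_restrict_mem measurableSet_Ioi] with θ hθ
    have hs0 : s ≠ 0 := by intro h; simp [h] at hs
    have hθ0 : θ ≠ 0 := (ht.trans hθ).ne'
    refine (norm_boxIntegral_le_cube h (mul_ne_zero hs0 hθ0)).trans (le_of_eq ?_)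
    rw [abs_mul, hs, one_mul]; ring
  have h4 := hb (-1) (by simp)
  have h5 := hb 1 (by simp)
  simp only [neg_one_mul, one_mul] at h4 h5
  rw [h1]
  refine (norm_add_le _ _).trans ((add_le_add h4 h5).trans (le_of_eq ?_))
  field_simp
  ring

/-! ### The divisor bound -/

theorem add_one_le_mul_rpow {ε : ℝ} (hε : 0 < ε) (v : ℕ) {x : ℝ} (hx : 2 ≤ x) :
    (v : ℝ) + 1 ≤ (1 + 1 / (ε * Real.log 2)) * (x ^ v) ^ ε := by
  have hl : 0 < Real.log 2 := Real.log_pos one_lt_two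
  have h1 : 1 + v * (ε * Real.log 2) ≤ (x ^ v) ^ ε := by
    have h2 : ((2 : ℝ) ^ v) ^ ε ≤ (x ^ v) ^ ε := by gcongr
    refine le_trans ?_ h2
    rw [Real.rpow_def_of_pos (by positivity), Real.log_pow]
    have := Real.add_one_le_exp ((v : ℝ) * Real.log 2 * ε)
    linarith
  have h3 : (v : ℝ) + 1 ≤ (1 + 1 / (ε * Real.log 2)) * (1 + v * (ε * Real.log 2)) := by
    have : (1 + 1 / (ε * Real.log 2)) * (1 + v * (ε * Real.log 2)) =
      1 + v * (ε * Real.log 2) + 1 / (ε * Real.log 2) + v := by field_simp; ring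
    rw [this]
    have : 0 ≤ v * (ε * Real.log 2) + 1 / (ε * Real.log 2) := by positivity
    linarith
  exact h3.trans (by gcongr)

/-- In the product of the factors `v + 1` over `p ^ v` exactly dividing `n`, a prime with `p ^ ε ≥
2` costs no constant, because `v + 1 ≤ 2 ^ v`. Each of the fewer than `N` smaller primes costs at
most `B`. -/
theorem exists_card_divisors_le {ε : ℝ} (hε : 0 < ε) :
    ∃ K : ℝ, 0 < K ∧ ∀ n : ℕ, n ≠ 0 → (n.divisors.card : ℝ) ≤ K * (n : ℝ) ^ ε := by
  set B : ℝ := 1 + 1 / (ε * Real.log 2) with hB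
  have hl : 0 < Real.log 2 := Real.log_pos one_lt_two
  have hB1 : 1 ≤ B := by rw [hB]; have : 0 ≤ 1 / (ε * Real.log 2) := by positivity
                         linarith
  set N : ℕ := ⌈(2 : ℝ) ^ (1 / ε)⌉₊ with hN
  refine ⟨B ^ N, by positivity, fun n hn => ?_⟩
  have hn' : (n : ℝ) ^ ε = ∏ p ∈ n.primeFactors, ((p : ℝ) ^ n.factorization p) ^ ε := by
    have h : (n : ℝ) = ∏ p ∈ n.primeFactors, (p : ℝ) ^ n.factorization p := by
      exact_mod_cast (Nat.prod_factorization_pow_eq_self hn).symm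
    conv_lhs => rw [h]
    rw [← Real.finsetProd_rpow _ _ fun p _ => by positivity]
  rw [Nat.card_divisors hn, hn']
  push_cast
  have h1 : ∀ p ∈ n.primeFactors, ((n.factorization p : ℝ) + 1) ≤
      (if p < N then B else 1) * ((p : ℝ) ^ n.factorization p) ^ ε := by
    intro p hp
    have hp2 : (2 : ℝ) ≤ p := by exact_mod_cast (Nat.prime_of_mem_primeFactors hp).two_le
    split_ifs with h
    · exact add_one_le_mul_rpow hε _ hp2
    · have h2 : (2 : ℝ) ^ (1 / ε) ≤ p := (Nat.le_ceil _).trans (by exact_mod_cast not_lt.1 h)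
      have h3 : (2 : ℝ) ≤ (p : ℝ) ^ ε := by
        calc (2 : ℝ) = ((2 : ℝ) ^ (1 / ε)) ^ ε := by
              rw [← Real.rpow_mul (by norm_num), one_div_mul_cancel hε.ne', Real.rpow_one]
          _ ≤ _ := by gcongr
      rw [one_mul, ← Real.rpow_natCast, ← Real.rpow_mul (by positivity), mul_comm,
        Real.rpow_mul (by positivity), Real.rpow_natCast]
      refine le_trans ?_ (pow_le_pow_left₀ (by norm_num) h3 _)
      exact_mod_cast Nat.lt_two_pow_self
  refine (prod_le_prod (fun p _ => by positivity) h1).trans ?_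
  rw [prod_mul_distrib]
  gcongr
  rw [prod_ite, prod_const, prod_const_one, mul_one]
  refine pow_le_pow_right₀ hB1 ?_
  calc _ ≤ (range N).card := card_le_card fun p hp => by simpa using (mem_filter.1 hp).2
    _ = N := card_range N

/-! ### Arithmetic progressions in an interval -/

/-- The integers of `[-U, U]` congruent to `c` modulo `M`. -/
noncomputable def prog (U : ℝ) (M : ℕ) (c : ℤ) : Finset ℤ :=
  (Icc (-⌊U⌋) ⌊U⌋).filter fun x => x ≡ c [ZMOD M]

theorem mem_prog {U : ℝ} {M : ℕ} {c x : ℤ} : x ∈ prog U M c ↔ |(x : ℝ)| ≤ U ∧ x ≡ c [ZMOD M] := by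
  rw [prog, mem_filter, mem_Icc, abs_le, neg_le, Int.le_floor, Int.le_floor]
  push_cast
  rw [neg_le]

theorem sum_prog {E : Type*} [AddCommMonoid E] (U : ℝ) {M : ℕ} (hM : 0 < M) (c : ℤ) (F : ℤ → E) :
    ∑ x ∈ prog U M c, F x = ∑ j ∈ Icc ⌈(-U - c) / M⌉ ⌊(U - c) / M⌋, F (c + M * j) := by
  have hM' : (0 : ℝ) < M := by exact_mod_cast hM
  symm
  refine sum_bij (fun j _ => c + M * j) ?_ ?_ ?_ (fun _ _ => rfl)
  · intro j hj
    rw [mem_Icc, Int.ceil_le, Int.le_floor, div_le_iff₀ hM', le_div_iff₀ hM'] at hj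
    rw [mem_prog, abs_le]
    push_cast
    refine ⟨⟨by linarith [hj.1], by linarith [hj.2]⟩, ?_⟩
    simp [Int.ModEq]
  · intro j _ j' _ h
    have : (M : ℤ) * j = M * j' := by linarith
    exact mul_left_cancel₀ (by exact_mod_cast hM.ne') this
  · intro x hx
    rw [mem_prog, abs_le] at hx
    obtain ⟨j, hj⟩ := (Int.modEq_iff_dvd.1 hx.2.symm)
    have hxj : x = c + M * j := by linarith
    refine ⟨j, ?_, hxj.symm⟩
    rw [mem_Icc, Int.ceil_le, Int.le_floor, div_le_iff₀ hM', le_div_iff₀ hM']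
    have : (x : ℝ) = c + M * j := by exact_mod_cast hxj
    constructor <;> linarith [hx.1.1, hx.1.2]

theorem card_Icc_ceil_floor_le {u v : ℝ} (h : u ≤ v) : ((Icc ⌈u⌉ ⌊v⌋).card : ℝ) ≤ v - u + 1 := by
  rw [Int.card_Icc]
  have h1 := Int.le_ceil u
  have h2 := Int.floor_le v
  rcases le_total 0 (⌊v⌋ + 1 - ⌈u⌉) with h3 | h3
  · have : (((⌊v⌋ + 1 - ⌈u⌉).toNat : ℤ) : ℝ) = ((⌊v⌋ + 1 - ⌈u⌉ : ℤ) : ℝ) := by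
      rw [Int.toNat_of_nonneg h3]
    rw [Int.cast_natCast] at this
    rw [this]; push_cast; linarith
  · rw [Int.toNat_of_nonpos h3]; simp; linarith

theorem card_prog_le {U : ℝ} (hU : 0 ≤ U) {M : ℕ} (hM : 0 < M) (c : ℤ) :
    ((prog U M c).card : ℝ) ≤ 2 * U / M + 1 := by
  have h := sum_prog U hM c fun _ => 1
  simp only [sum_const, smul_eq_mul, mul_one] at h
  have hM' : (0 : ℝ) < M := by exact_mod_cast hM
  rw [h]
  refine (card_Icc_ceil_floor_le ?_).trans (le_of_eq ?_)
  · gcongr; linarith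
  · ring

/-! ### Geometric sums -/

theorem sum_Icc_telescope {E : Type*} [AddCommGroup E] (f : ℤ → E) {u v : ℤ} (h : u ≤ v + 1) :
    ∑ j ∈ Icc u v, (f (j + 1) - f j) = f (v + 1) - f u := by
  obtain ⟨n, hn⟩ := Int.eq_ofNat_of_zero_le (sub_nonneg.2 h)
  induction n generalizing v with
  | zero =>
    have : v + 1 = u := by simp at hn; omega
    rw [Icc_eq_empty (by omega), sum_empty, this, sub_self]
  | succ n ih =>
    have h1 : Icc u v = insert v (Icc u (v - 1)) := by
      ext x; simp only [mem_insert, mem_Icc]; push_cast at hn; omega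
    rw [h1, sum_insert (by simp), ih (by push_cast at hn; omega) (by push_cast at hn ⊢; omega)]
    rw [sub_add_cancel]; abel

/-- The geometric series bound, multiplied out so that integral `ξ` needs no exception. -/
theorem norm_sum_e_mul_le (ξ : ℝ) (u v : ℤ) :
    ‖∑ j ∈ Icc u v, e (ξ * j)‖ * (2 * |ξ - round ξ|) ≤ 1 := by
  rcases lt_or_ge (v + 1) u with h | h
  · rw [Icc_eq_empty (by omega)]; simp
  · have h1 : (e ξ - 1) * ∑ j ∈ Icc u v, e (ξ * j) = e (ξ * (v + 1 : ℤ)) - e (ξ * u) := by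
      rw [← sum_Icc_telescope (fun j : ℤ => e (ξ * j)) h, mul_sum]
      refine sum_congr rfl fun j _ => ?_
      push_cast
      rw [mul_add, mul_one, e_add]; ring
    have h2 : ‖e ξ - 1‖ * ‖∑ j ∈ Icc u v, e (ξ * j)‖ ≤ 2 := by
      rw [← norm_mul, h1]
      refine (norm_sub_le _ _).trans ?_
      rw [norm_e, norm_e]; norm_num
    have h3 : 4 * |ξ - round ξ| ≤ ‖e ξ - 1‖ := by
      have := norm_e_sub_one_ge (abs_sub_round ξ)
      rwa [← e_add_int _ (round ξ), sub_add_cancel] at this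
    nlinarith [norm_nonneg (∑ j ∈ Icc u v, e (ξ * j))]

/-! ### Sums of reciprocals of distances to the nearest integer -/

theorem sum_range_weight_le (H : ℝ) {r : ℕ} (hr : 0 < r) :
    ∑ i ∈ range (r + 1), (if i = 0 then H else (r : ℝ) / i) ≤ H + r * (1 + Real.log r) := by
  rw [sum_range_succ']
  simp only [Nat.add_eq_zero_iff, one_ne_zero, and_false, if_false, if_true]
  have h1 : ∑ i ∈ range r, (r : ℝ) / ((i + 1 : ℕ) : ℝ) = r * (harmonic r : ℝ) := by
    rw [harmonic, Rat.cast_sum, mul_sum]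
    refine sum_congr rfl fun i _ => ?_
    push_cast; rw [div_eq_mul_inv]
  have h2 := harmonic_le_one_add_log r
  have hr' : (0 : ℝ) < r := by exact_mod_cast hr
  rw [h1]
  nlinarith

/-- For `d = n - n'` with `0 < |d| < K ≤ r / 2`, the difference is a nonzero integer over `r`,
because `r` does not divide `a d`, plus an error of at most `|d| / r² ≤ 1 / (2r)`. -/
theorem abs_sub_round_separated {α γ : ℝ} {a : ℤ} {r K : ℕ} (hr : 0 < r) (hK : 2 * K ≤ r)
    (hcop : IsCoprime a (r : ℤ)) (hα : |α - a / r| ≤ 1 / (r : ℝ) ^ 2) {n n' : ℤ} (hne : n ≠ n')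
    (hd : |n - n'| < K) :
    1 / (2 * (r : ℝ)) ≤ |(α * n + γ - round (α * n + γ)) - (α * n' + γ - round (α * n' + γ))| := by
  have hr' : (0 : ℝ) < r := by exact_mod_cast hr
  set N : ℤ := round (α * n + γ) - round (α * n' + γ) with hN
  set d : ℤ := n - n' with hdd
  have h1 : (α * n + γ - round (α * n + γ)) - (α * n' + γ - round (α * n' + γ)) =
      (a * d - N * r : ℤ) / (r : ℝ) + (α - a / r) * d := by
    rw [hN, hdd]; push_cast; field_simp; ring
  have h2 : a * d - N * r ≠ 0 := by
    intro h0
    have h3 : (r : ℤ) ∣ a * d := ⟨N, by linarith⟩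
    have h4 : (r : ℤ) ∣ d := hcop.symm.dvd_of_dvd_mul_left h3
    have h5 := Int.le_of_dvd (abs_pos.2 (sub_ne_zero.2 hne)) ((dvd_abs _ _).2 h4)
    have : (2 : ℤ) * K ≤ r := by exact_mod_cast hK
    have h6 : |d| < K := hd
    change (r : ℤ) ≤ |d| at h5
    omega
  have h3 : (1 : ℝ) ≤ |((a * d - N * r : ℤ) : ℝ)| := by exact_mod_cast Int.one_le_abs h2
  have h4 : |(d : ℝ)| ≤ r / 2 := by
    have h5 : |(d : ℝ)| ≤ K := by exact_mod_cast hd.le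
    have : (2 : ℝ) * K ≤ r := by exact_mod_cast hK
    linarith
  rw [h1]
  have h5 : 1 / (r : ℝ) ≤ |(a * d - N * r : ℤ) / (r : ℝ)| := by
    rw [abs_div, abs_of_pos hr']; gcongr
  have h6 : |(α - a / r) * d| ≤ 1 / (2 * (r : ℝ)) := by
    rw [abs_mul]
    calc _ ≤ 1 / (r : ℝ) ^ 2 * (r / 2) := by gcongr
      _ = _ := by field_simp
  have h7 := abs_sub_abs_le_abs_add ((a * d - N * r : ℤ) / (r : ℝ)) ((α - a / r) * d)
  have h8 : 1 / (r : ℝ) = 1 / (2 * (r : ℝ)) + 1 / (2 * (r : ℝ)) := by field_simp; norm_num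
  linarith

/-- Cut the range into blocks of length `K`. Within a block, the numbers `2 r |φ n|` with `φ n` of a
given sign are `1`-separated, so their integer parts `i ≤ r` are distinct. Index `0` costs `H` and
index `i > 0` costs `r / i`, whence the harmonic sum; the factor `2` counts the signs. -/
theorem sum_le_of_round_bound {α γ : ℝ} {a : ℤ} {r : ℕ} (hr : 2 ≤ r) (hcop : IsCoprime a (r : ℤ))
    (hα : |α - a / r| ≤ 1 / (r : ℝ) ^ 2) {H : ℝ} (hH : 0 ≤ H) (w : ℤ → ℝ) (hw : ∀ n, w n ≤ H)
    (hw' : ∀ n, w n * (2 * |α * n + γ - round (α * n + γ)|) ≤ 1) {u v : ℤ} {L : ℝ} (hL : 0 ≤ L)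
    (huv : (v : ℝ) - u ≤ L) :
    ∑ n ∈ Icc u v, w n ≤ (3 * L / r + 2) * (2 * (H + r * (1 + Real.log r))) := by
  set φ : ℤ → ℝ := fun n => α * n + γ - round (α * n + γ) with hφ
  have hr0 : 0 < r := by omega
  have hr' : (0 : ℝ) < r := by exact_mod_cast hr0
  set K : ℕ := r / 2 with hK
  have hK0 : 0 < K := by omega
  have hKr : 2 * K ≤ r := by omega
  -- This is where `r ≥ 2` enters; it turns the number of blocks, at most `L / K + 2`, into `3 L / r
  -- + 2`.
  have hK3 : r ≤ 3 * K := by omega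
  set W : ℕ → ℝ := fun i => if i = 0 then H else (r : ℝ) / i with hW
  have hW0 : ∀ i, 0 ≤ W i := fun i => by simp only [hW]; split_ifs <;> positivity
  set idx : ℤ → ℕ := fun n => ⌊2 * r * |φ n|⌋₊ with hidx
  set f : ℤ → ℤ × Bool × ℕ := fun n => (n / K, decide (0 ≤ φ n), idx n) with hf
  have hwW : ∀ n, w n ≤ W (idx n) := by
    intro n
    simp only [hW]
    split_ifs with h
    · exact hw n
    · have h1 : ((idx n : ℕ) : ℝ) ≤ 2 * r * |φ n| := Nat.floor_le (by positivity)
      have h2 : (0 : ℝ) < idx n := by exact_mod_cast Nat.pos_of_ne_zero h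
      have h3 := hw' n
      rw [le_div_iff₀ h2]
      rcases le_or_gt (w n) 0 with h4 | h4
      · nlinarith
      · have : w n * idx n ≤ w n * (2 * r * |φ n|) := by gcongr
        have h5 : w n * (2 * r * |φ n|) = r * (w n * (2 * |φ n|)) := by ring
        nlinarith
  have hinj : Set.InjOn f (Icc u v : Finset ℤ) := by
    intro n _ n' _ h
    by_contra hne
    simp only [hf, Prod.mk.injEq] at h
    obtain ⟨h1, h2, h3⟩ := h
    have hd : |n - n'| < K := by
      have e1 := Int.emod_add_mul_ediv n K
      have e2 := Int.emod_add_mul_ediv n' K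
      have hKz : (0 : ℤ) < K := by exact_mod_cast hK0
      have := Int.emod_nonneg n hKz.ne'
      have := Int.emod_nonneg n' hKz.ne'
      have := Int.emod_lt_of_pos n hKz
      have := Int.emod_lt_of_pos n' hKz
      rw [h1] at e1
      rw [abs_lt]
      constructor <;> linarith
    have hsep := abs_sub_round_separated (γ := γ) hr0 hKr hcop hα hne hd
    change _ ≤ |φ n - φ n'| at hsep
    have h4 : abs (2 * r * |φ n| - 2 * r * |φ n'|) < 1 := by
      have a1 := Nat.floor_le (a := 2 * r * |φ n|) (by positivity)
      have a2 := Nat.floor_le (a := 2 * r * |φ n'|) (by positivity)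
      have a3 := Nat.lt_floor_add_one (2 * r * |φ n|)
      have a4 := Nat.lt_floor_add_one (2 * r * |φ n'|)
      have h3' : ((⌊2 * r * |φ n|⌋₊ : ℕ) : ℝ) = ⌊2 * r * |φ n'|⌋₊ :=
        congrArg (fun t : ℕ => (t : ℝ)) h3
      rw [abs_lt]; constructor <;> linarith
    have h5 : |φ n - φ n'| = abs (|φ n| - |φ n'|) := by
      have h2' := decide_eq_decide.1 h2
      rcases le_or_gt 0 (φ n) with hp | hp
      · rw [abs_of_nonneg hp, abs_of_nonneg (h2'.1 hp)]
      · have hp' : φ n' < 0 := by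
          by_contra hc; exact absurd (h2'.2 (not_lt.1 hc)) (not_le.2 hp)
        rw [abs_of_neg hp, abs_of_neg hp', ← abs_neg]; congr 1; ring
    rw [← mul_sub, abs_mul, ← h5, abs_of_pos (by positivity : (0 : ℝ) < 2 * r)] at h4
    rw [div_le_iff₀ (by positivity)] at hsep
    linarith
  have hmem : ∀ n ∈ Icc u v, f n ∈ Icc (u / K) (v / K) ×ˢ (univ : Finset Bool) ×ˢ range (r + 1) := by
    intro n hn
    rw [mem_Icc] at hn
    have hKz : (0 : ℤ) < K := by exact_mod_cast hK0
    simp only [hf, mem_product, mem_Icc, mem_univ, true_and, mem_range]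
    refine ⟨⟨Int.ediv_le_ediv hKz hn.1, Int.ediv_le_ediv hKz hn.2⟩, ?_⟩
    rw [Nat.lt_succ_iff]
    refine Nat.floor_le_of_le ?_
    have := abs_sub_round (α * n + γ)
    simp only [hφ]
    nlinarith
  have hcard : ((Icc (u / K : ℤ) (v / K)).card : ℝ) ≤ 3 * L / r + 2 := by
    rw [Int.card_Icc]
    have hKz : (0 : ℤ) < K := by exact_mod_cast hK0
    have hKr0 : (0 : ℝ) < K := by exact_mod_cast hK0
    have hLK : L / K ≤ 3 * L / r := by
      rw [div_le_div_iff₀ hKr0 hr']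
      have : (r : ℝ) ≤ 3 * K := by exact_mod_cast hK3
      nlinarith
    rcases le_total 0 (v / K + 1 - u / K : ℤ) with h3 | h3
    · have h4 : (((v / K + 1 - u / K : ℤ).toNat : ℤ) : ℝ) = ((v / K + 1 - u / K : ℤ) : ℝ) := by
        rw [Int.toNat_of_nonneg h3]
      rw [Int.cast_natCast] at h4
      rw [h4]
      have e1 : (K : ℝ) * ((v / K : ℤ) : ℝ) ≤ v := by exact_mod_cast Int.mul_ediv_self_le hKz.ne'
      have e2 : (u : ℝ) ≤ K * ((u / K : ℤ) : ℝ) + K := by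
        exact_mod_cast (Int.lt_mul_ediv_self_add (x := u) hKz).le
      have e3 : ((v / K : ℤ) : ℝ) - ((u / K : ℤ) : ℝ) ≤ L / K + 1 := by
        rw [← sub_le_iff_le_add, le_div_iff₀ hKr0]; linarith
      push_cast at e3 ⊢
      linarith
    · rw [Int.toNat_of_nonpos h3]; push_cast; positivity
  calc ∑ n ∈ Icc u v, w n ≤ ∑ n ∈ Icc u v, W (f n).2.2 := sum_le_sum fun n _ => hwW n
    _ = ∑ z ∈ (Icc u v).image f, W z.2.2 := (sum_image (f := fun z : ℤ × Bool × ℕ => W z.2.2) hinj).symm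
    _ ≤ ∑ z ∈ Icc (u / K : ℤ) (v / K) ×ˢ (univ : Finset Bool) ×ˢ range (r + 1), W z.2.2 :=
        sum_le_sum_of_subset_of_nonneg (image_subset_iff.2 hmem) fun z _ _ => hW0 _
    _ = ((Icc (u / K : ℤ) (v / K)).card : ℝ) * (2 * ∑ i ∈ range (r + 1), W i) := by
        rw [sum_product]
        simp only [sum_product, sum_const, nsmul_eq_mul, card_univ, Fintype.card_bool]
        norm_num
    _ ≤ _ := by
        have h1 := sum_range_weight_le H hr0
        have h2 : 0 ≤ ∑ i ∈ range (r + 1), W i := sum_nonneg fun i _ => hW0 i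
        gcongr

/-! ### The exponential sums over the box -/

/-- The exponential sum of a hyperbolic plane over residue classes modulo `m`. -/
noncomputable def pairSum (k : ℤ) (m : ℕ) (U W : ℝ) (x₀ y₀ : ℤ) (β : ℝ) : ℂ :=
  ∑ x ∈ prog U m x₀, ∑ y ∈ prog W m y₀, e (k * β * x * y / m)

/-- The exponential sum of a square over a residue class modulo `m`. -/
noncomputable def squareSum (k : ℤ) (m : ℕ) (U : ℝ) (z₀ : ℤ) (β : ℝ) : ℂ :=
  ∑ z ∈ prog U m z₀, e (k * β * z ^ 2 / m)

/-- The exponential sum `∑ e(β q(B) / m)` over the points `B ≡ B₀ (mod m)` of the box. -/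
noncomputable def boxSum (Y : V ℝ) (m : ℕ) (B₀ : V ℤ) (β : ℝ) : ℂ :=
  ∑ B ∈ Fintype.piFinset fun i => prog (Y i) m (B₀ i), e (β * (q B : ℤ) / m)

theorem boxSum_eq (Y : V ℝ) (m : ℕ) (B₀ : V ℤ) (β : ℝ) :
    boxSum Y m B₀ β = pairSum (-1) m (Y 0) (Y 8) (B₀ 0) (B₀ 8) β *
      pairSum (-1) m (Y 4) (Y 6) (B₀ 4) (B₀ 6) β * pairSum (-2) m (Y 1) (Y 7) (B₀ 1) (B₀ 7) β *
      pairSum (-2) m (Y 2) (Y 5) (B₀ 2) (B₀ 5) β * squareSum (-2) m (Y 3) (B₀ 3) β := by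
  unfold pairSum squareSum
  rw [← sum_piFinset_split (fun i => prog (Y i) m (B₀ i))]
  refine sum_congr rfl fun B _ => ?_
  simp only [← e_add]
  congr 1
  unfold q; push_cast; ring

theorem continuous_pairSum (k : ℤ) (m : ℕ) (U W : ℝ) (x₀ y₀ : ℤ) :
    Continuous (pairSum k m U W x₀ y₀) := by
  unfold pairSum; fun_prop

theorem continuous_boxSum (Y : V ℝ) (m : ℕ) (B₀ : V ℤ) : Continuous (boxSum Y m B₀) := by
  unfold boxSum; fun_prop

theorem dvd_q_of_modEq {m : ℕ} {B B₀ : V ℤ} (h : ∀ i, B i ≡ B₀ i [ZMOD (m : ℤ)])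
    (h₀ : (m : ℤ) ∣ q B₀) : (m : ℤ) ∣ q B := by
  have h1 : q B ≡ q B₀ [ZMOD (m : ℤ)] := by
    unfold q
    have h2 := fun i j => (h i).mul (h j)
    refine Int.ModEq.sub (Int.ModEq.sub (Int.ModEq.sub (Int.ModEq.sub (h2 0 8).neg (h2 4 6)) ?_) ?_) ?_
    · exact (h2 1 7).mul_left 2
    · exact (h2 2 5).mul_left 2
    · exact ((h 3).pow 2).mul_left 2
  exact (Int.modEq_zero_iff_dvd.1 (h1.trans (Int.modEq_zero_iff_dvd.2 h₀)))

theorem count_eq_integral (Y : V ℝ) {m : ℕ} (hm : 0 < m) {B₀ : V ℤ} (h₀ : (m : ℤ) ∣ q B₀) (κ : ℝ) :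
    (count Y m B₀ : ℂ) = ∫ β in κ..(κ + 1), boxSum Y m B₀ β := by
  have hm' : (m : ℝ) ≠ 0 := by exact_mod_cast hm.ne'
  unfold boxSum
  rw [intervalIntegral.integral_finsetSum fun B _ => Continuous.intervalIntegrable (by fun_prop) _ _]
  have h1 : ∀ B ∈ Fintype.piFinset fun i => prog (Y i) m (B₀ i),
      ∫ β in κ..(κ + 1), e (β * (q B : ℤ) / m) = if q B = 0 then 1 else 0 := by
    intro B hB
    rw [Fintype.mem_piFinset] at hB
    obtain ⟨n, hn⟩ := dvd_q_of_modEq (fun i => (mem_prog.1 (hB i)).2) h₀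
    have h2 : ∀ β : ℝ, β * (q B : ℤ) / m = β * n := fun β => by
      rw [hn]; push_cast; field_simp
    simp_rw [h2]
    rw [integral_e_int, hn]
    simp [hm.ne']
  rw [sum_congr rfl h1, ← sum_filter, sum_const, nsmul_eq_mul, mul_one, count]
  congr 1
  rw [← Set.ncard_coe_finset]
  congr 1
  ext B
  simp only [box, Set.mem_ofPred_eq, coe_filter, Fintype.mem_piFinset, mem_prog]
  constructor
  · rintro ⟨h1, h2, h3⟩; exact ⟨fun i => ⟨h1 i, h2 i⟩, h3⟩
  · rintro ⟨h1, h3⟩; exact ⟨fun i => (h1 i).1, fun i => (h1 i).2, h3⟩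

theorem norm_sum_e_le_card {ι : Type*} (s : Finset ι) (f : ι → ℝ) :
    ‖∑ i ∈ s, e (f i)‖ ≤ s.card := by
  refine (norm_sum_le _ _).trans ?_
  simp [norm_e]

theorem norm_squareSum_le (k : ℤ) {m : ℕ} (hm : 0 < m) {U : ℝ} (hU : 0 ≤ U) (z₀ : ℤ) (β : ℝ) :
    ‖squareSum k m U z₀ β‖ ≤ 2 * U / m + 1 :=
  (norm_sum_e_le_card _ _).trans (card_prog_le hU hm _)

theorem norm_pairSum_le (k : ℤ) {m : ℕ} (hm : 0 < m) {U W : ℝ} (hU : 0 ≤ U) (hW : 0 ≤ W)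
    (x₀ y₀ : ℤ) (β : ℝ) :
    ‖pairSum k m U W x₀ y₀ β‖ ≤ (2 * U / m + 1) * (2 * W / m + 1) := by
  refine (norm_sum_le _ _).trans ?_
  calc _ ≤ ∑ x ∈ prog U m x₀, (2 * W / m + 1) := by
        refine sum_le_sum fun x _ => (norm_sum_e_le_card _ _).trans (card_prog_le hW hm _)
    _ = (prog U m x₀).card * (2 * W / m + 1) := by rw [sum_const, nsmul_eq_mul]
    _ ≤ _ := by gcongr; exact card_prog_le hU hm _

/-- With `x = x₀ + m i` and `y = y₀ + m j`, the coefficient of `i j` in `k β x y / m` is `k β m`. So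
the inner sum is geometric with frequency `k β m i + k β x₀`, and it is `k β m`, not `β`, that must
be approximated. -/
theorem norm_pairSum_le_of_approx (k : ℤ) {m : ℕ} (hm : 0 < m) {U W : ℝ} (hU : 0 ≤ U) (hW : 0 ≤ W)
    (x₀ y₀ : ℤ) {β : ℝ} {a : ℤ} {r : ℕ} (hr : 2 ≤ r) (hcop : IsCoprime a (r : ℤ))
    (hα : |k * β * m - a / r| ≤ 1 / (r : ℝ) ^ 2) :
    ‖pairSum k m U W x₀ y₀ β‖ ≤
      (3 * (2 * U / m) / r + 2) * (2 * (2 * W / m + 1 + r * (1 + Real.log r))) := by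
  have hm' : (0 : ℝ) < m := by exact_mod_cast hm
  unfold pairSum
  rw [sum_prog U hm]
  refine (norm_sum_le _ _).trans ?_
  refine sum_le_of_round_bound (γ := k * β * x₀) hr hcop hα (by positivity)
    (fun i => ‖∑ y ∈ prog W m y₀, e (k * β * (x₀ + m * i : ℤ) * y / m)‖)
    (fun i => (norm_sum_e_le_card _ _).trans (card_prog_le hW hm _)) (fun i => ?_) (by positivity) ?_
  · rw [sum_prog W hm]
    have h1 : ∀ j : ℤ, e (k * β * (x₀ + m * i : ℤ) * (y₀ + m * j : ℤ) / m) =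
        e (k * β * (x₀ + m * i : ℤ) * y₀ / m) * e ((k * β * m * i + k * β * x₀) * j) := by
      intro j
      rw [← e_add]; congr 1
      push_cast; field_simp
      ring
    simp_rw [h1]
    rw [← mul_sum, norm_mul, norm_e, one_mul]
    exact norm_sum_e_mul_le _ _ _
  · have h1 := Int.floor_le ((U - x₀) / m)
    have h2 := Int.le_ceil ((-U - x₀) / m)
    have h3 : (U - x₀) / m - (-U - x₀) / m = 2 * U / m := by ring
    linarith

/-! ### The mean square -/

theorem card_filter_mul_eq_le (s t : Finset ℤ) {n : ℤ} (hn : n ≠ 0) :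
    ((s ×ˢ t).filter fun z => z.1 * z.2 = n).card ≤ 2 * n.natAbs.divisors.card := by
  have h1 : ((s ×ˢ t).filter fun z => z.1 * z.2 = n).card ≤
      (n.natAbs.divisors ×ˢ (univ : Finset Bool)).card := by
    refine card_le_card_of_injOn (fun z => (z.1.natAbs, decide (0 ≤ z.1))) ?_ ?_
    · intro z hz
      rw [mem_coe, mem_filter] at hz
      simp only [coe_product, Set.mem_prod, mem_coe, Nat.mem_divisors, mem_univ, and_true]
      exact ⟨Int.natAbs_dvd_natAbs.2 ⟨z.2, hz.2.symm⟩, by simpa using hn⟩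
    · intro z hz z' hz' h
      rw [mem_coe, mem_filter] at hz hz'
      simp only [Prod.mk.injEq, decide_eq_decide] at h
      have h2 : z.1 = z'.1 := by omega
      have h3 : z.1 ≠ 0 := by
        intro h0; apply hn; rw [← hz.2, h0, zero_mul]
      refine Prod.ext h2 (mul_left_cancel₀ h3 ?_)
      rw [hz.2, h2, hz'.2]
  rw [card_product, card_univ, Fintype.card_bool, mul_comm] at h1
  exact h1

theorem card_filter_mul_eq_zero_le (s t : Finset ℤ) :
    ((s ×ˢ t).filter fun z => z.1 * z.2 = 0).card ≤ s.card + t.card := by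
  have : ((s ×ˢ t).filter fun z => z.1 * z.2 = 0) ⊆ (s ×ˢ {0}) ∪ ({0} ×ˢ t) := by
    intro z hz
    simp only [mem_filter, mem_product, mul_eq_zero, mem_union, mem_singleton] at hz ⊢
    tauto
  refine (card_le_card this).trans ((card_union_le _ _).trans ?_)
  simp

/-- Parseval: the mean square counts the solutions of `x y = x' y'`. All products lie in one class
modulo `m`, so the frequencies differ by integers although they carry the denominator `m`. -/
theorem integral_norm_pairSum_sq {k : ℤ} (hk : k ≠ 0) {m : ℕ} (hm : 0 < m) (U W : ℝ) (x₀ y₀ : ℤ)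
    (κ : ℝ) :
    ∫ β in κ..(κ + 1), ‖pairSum k m U W x₀ y₀ β‖ ^ 2 =
      ∑ z ∈ prog U m x₀ ×ˢ prog W m y₀,
        (((prog U m x₀ ×ˢ prog W m y₀).filter fun z' => z'.1 * z'.2 = z.1 * z.2).card : ℝ) := by
  have hm' : (m : ℝ) ≠ 0 := by exact_mod_cast hm.ne'
  set S := prog U m x₀ ×ˢ prog W m y₀ with hS
  have h1 : ∀ β, ((‖pairSum k m U W x₀ y₀ β‖ ^ 2 : ℝ) : ℂ) =
      ∑ z ∈ S, ∑ z' ∈ S, e (k * β * z.1 * z.2 / m - k * β * z'.1 * z'.2 / m) := by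
    intro β
    have h2 : pairSum k m U W x₀ y₀ β = ∑ z ∈ S, e (k * β * z.1 * z.2 / m) := by
      rw [hS, sum_product]; rfl
    push_cast
    rw [← Complex.mul_conj', h2, map_sum, sum_mul_sum]
    refine sum_congr rfl fun z _ => sum_congr rfl fun z' _ => ?_
    rw [conj_e, ← e_add, sub_eq_add_neg]
  have h3 : ((∫ β in κ..(κ + 1), ‖pairSum k m U W x₀ y₀ β‖ ^ 2 : ℝ) : ℂ) =
      ∑ z ∈ S, ∑ z' ∈ S, ∫ β in κ..(κ + 1), e (k * β * z.1 * z.2 / m - k * β * z'.1 * z'.2 / m) := by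
    rw [← intervalIntegral.integral_ofReal]
    simp_rw [h1]
    rw [intervalIntegral.integral_finsetSum fun z _ => Continuous.intervalIntegrable (by fun_prop) _ _]
    refine sum_congr rfl fun z _ => ?_
    rw [intervalIntegral.integral_finsetSum fun z _ => Continuous.intervalIntegrable (by fun_prop) _ _]
  have h4 : ∀ z ∈ S, ∀ z' ∈ S,
      ∫ β in κ..(κ + 1), e (k * β * z.1 * z.2 / m - k * β * z'.1 * z'.2 / m) =
        if z'.1 * z'.2 = z.1 * z.2 then 1 else 0 := by
    intro z hz z' hz'
    rw [hS, mem_product, mem_prog, mem_prog] at hz hz'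
    have h5 : z'.1 * z'.2 ≡ z.1 * z.2 [ZMOD m] :=
      (hz'.1.2.mul hz'.2.2).trans (hz.1.2.mul hz.2.2).symm
    obtain ⟨n, hn⟩ := h5.dvd
    have hn' : (z.1 : ℝ) * z.2 - z'.1 * z'.2 = m * n := by exact_mod_cast hn
    have h6 : ∀ β : ℝ, k * β * z.1 * z.2 / m - k * β * z'.1 * z'.2 / m = β * (k * n : ℤ) := by
      intro β
      push_cast
      field_simp
      linear_combination β * hn'
    simp_rw [h6]
    rw [integral_e_int]
    have h7 : k * n = 0 ↔ z'.1 * z'.2 = z.1 * z.2 := by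
      have hmz : (m : ℤ) ≠ 0 := by exact_mod_cast hm.ne'
      constructor
      · intro h
        rw [(mul_eq_zero.1 h).resolve_left hk, mul_zero] at hn
        linarith
      · intro h
        rw [h, sub_self] at hn
        rw [(mul_eq_zero.1 hn.symm).resolve_left hmz, mul_zero]
    simp only [h7]
  have h8 : ((∫ β in κ..(κ + 1), ‖pairSum k m U W x₀ y₀ β‖ ^ 2 : ℝ) : ℂ) = ((∑ z ∈ S,
      ((S.filter fun z' => z'.1 * z'.2 = z.1 * z.2).card : ℝ) : ℝ) : ℂ) := by
    rw [h3]
    push_cast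
    refine sum_congr rfl fun z hz => ?_
    rw [sum_congr rfl (h4 z hz), ← sum_filter, sum_const, nsmul_eq_mul, mul_one]
  exact_mod_cast h8

/-- A nonzero product has at most `2 D` factorizations. The pairs with product `0` lie on the two
axes and contribute the square of their number. -/
theorem integral_norm_pairSum_sq_le {k : ℤ} (hk : k ≠ 0) {m : ℕ} (hm : 0 < m) {U W : ℝ} (hU : 0 ≤ U)
    (hW : 0 ≤ W) (x₀ y₀ : ℤ) (κ : ℝ) {D : ℝ}
    (hD : ∀ n : ℕ, n ≠ 0 → (n : ℝ) ≤ U * W → (n.divisors.card : ℝ) ≤ D) (hD0 : 0 ≤ D) :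
    ∫ β in κ..(κ + 1), ‖pairSum k m U W x₀ y₀ β‖ ^ 2 ≤
      (2 * U / m + 1) * (2 * W / m + 1) * (2 * D) + (2 * U / m + 1 + (2 * W / m + 1)) ^ 2 := by
  rw [integral_norm_pairSum_sq hk hm]
  set S := prog U m x₀ ×ˢ prog W m y₀ with hS
  have hcU := card_prog_le hU hm x₀
  have hcW := card_prog_le hW hm y₀
  have hz : ((S.filter fun z => z.1 * z.2 = 0).card : ℝ) ≤ 2 * U / m + 1 + (2 * W / m + 1) := by
    have : ((S.filter fun z => z.1 * z.2 = 0).card : ℝ) ≤ (prog U m x₀).card + (prog W m y₀).card := by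
      exact_mod_cast card_filter_mul_eq_zero_le _ _
    linarith
  rw [← sum_filter_add_sum_filter_not S fun z => z.1 * z.2 = 0, add_comm]
  refine add_le_add ?_ ?_
  · calc _ ≤ ∑ z ∈ S.filter fun z => ¬ z.1 * z.2 = 0, 2 * D := by
          refine sum_le_sum fun z hz => ?_
          rw [mem_filter, hS, mem_product, mem_prog, mem_prog] at hz
          have h1 : (((S.filter fun z' => z'.1 * z'.2 = z.1 * z.2).card : ℕ) : ℝ) ≤
              2 * ((z.1 * z.2).natAbs.divisors.card : ℝ) := by
            exact_mod_cast card_filter_mul_eq_le _ _ hz.2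
          have h2 : ((z.1 * z.2).natAbs : ℝ) ≤ U * W := by
            rw [Nat.cast_natAbs, Int.cast_abs, Int.cast_mul, abs_mul]
            exact mul_le_mul hz.1.1.1 hz.1.2.1 (abs_nonneg _) hU
          have := hD _ (by simpa using hz.2) h2
          linarith
      _ = ((S.filter fun z => ¬ z.1 * z.2 = 0).card : ℝ) * (2 * D) := by
          rw [sum_const, nsmul_eq_mul]
      _ ≤ (S.card : ℝ) * (2 * D) := by gcongr; exact filter_subset _ _
      _ ≤ _ := by rw [hS, card_product]; push_cast; gcongr
  · calc _ = ∑ z ∈ S.filter fun z => z.1 * z.2 = 0, ((S.filter fun z => z.1 * z.2 = 0).card : ℝ) := by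
          refine sum_congr rfl fun z hz => ?_
          rw [(mem_filter.1 hz).2]
      _ = ((S.filter fun z => z.1 * z.2 = 0).card : ℝ) ^ 2 := by
          rw [sum_const, nsmul_eq_mul, sq]
      _ ≤ _ := by gcongr

/-! ### Comparison of sums with integrals -/

/-- Each complete unit interval costs at most `D`. The `3` accounts for the last term of the sum and
the two incomplete intervals at the ends. -/
theorem norm_sum_sub_integral_le {h : ℝ → ℂ} (hc : Continuous h) {u v D : ℝ} (huv : u ≤ v)
    (hD : 0 ≤ D) (h1 : ∀ x ∈ Set.Icc u v, ‖h x‖ ≤ 1)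
    (hL : ∀ x ∈ Set.Icc u v, ∀ y ∈ Set.Icc u v, ‖h x - h y‖ ≤ D * |x - y|) :
    ‖∑ j ∈ Icc ⌈u⌉ ⌊v⌋, h j - ∫ x in u..v, h x‖ ≤ 3 + D * (v - u) := by
  have hint : ∀ a b, IntervalIntegrable h volume a b := fun a b => hc.intervalIntegrable a b
  have hbd : ∀ a b, a ∈ Set.Icc u v → b ∈ Set.Icc u v → a ≤ b → b ≤ a + 1 →
      ‖∫ x in a..b, h x‖ ≤ 1 := by
    intro a b ha hb hab hb1
    have := intervalIntegral.norm_integral_le_of_norm_le_const (a := a) (b := b) (f := h) (C := 1)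
      fun x hx => by
        rw [Set.uIoc_of_le hab] at hx
        exact h1 x ⟨ha.1.trans hx.1.le, hx.2.trans hb.2⟩
    rw [abs_of_nonneg (by linarith)] at this
    linarith
  have hu := Int.le_ceil u
  have hu' := Int.ceil_lt_add_one u
  have hv := Int.floor_le v
  have hv' := Int.lt_floor_add_one v
  rcases lt_or_ge ⌊v⌋ ⌈u⌉ with hlt | hle
  · rw [Icc_eq_empty (by omega), sum_empty, zero_sub, norm_neg]
    have h3 : (⌊v⌋ : ℝ) + 1 ≤ ⌈u⌉ := by exact_mod_cast hlt
    have := hbd u v ⟨le_rfl, huv⟩ ⟨huv, le_rfl⟩ huv (by linarith)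
    have : 0 ≤ D * (v - u) := mul_nonneg hD (by linarith)
    linarith
  · have hle' : (⌈u⌉ : ℝ) ≤ ⌊v⌋ := by exact_mod_cast hle
    have hmu : (⌈u⌉ : ℝ) ∈ Set.Icc u v := ⟨hu, by linarith⟩
    have hmv : (⌊v⌋ : ℝ) ∈ Set.Icc u v := ⟨by linarith, hv⟩
    have hsplit : Icc ⌈u⌉ ⌊v⌋ = insert ⌊v⌋ (Icc ⌈u⌉ (⌊v⌋ - 1)) := by
      ext x; simp only [mem_insert, mem_Icc]; omega
    have htel := sum_Icc_telescope (fun j : ℤ => ∫ x in (⌈u⌉ : ℝ)..j, h x) (u := ⌈u⌉) (v := ⌊v⌋ - 1)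
      (by omega)
    simp only [intervalIntegral.integral_same, sub_zero, sub_add_cancel,
      intervalIntegral.integral_interval_sub_left (hint _ _) (hint _ _)] at htel
    have hI : ∫ x in u..v, h x = (∫ x in u..(⌈u⌉ : ℝ), h x) + (∫ x in (⌈u⌉ : ℝ)..(⌊v⌋ : ℝ), h x) +
        ∫ x in (⌊v⌋ : ℝ)..v, h x := by
      rw [intervalIntegral.integral_add_adjacent_intervals (hint _ _) (hint _ _),
        intervalIntegral.integral_add_adjacent_intervals (hint _ _) (hint _ _)]
    have heq : ∑ j ∈ Icc ⌈u⌉ ⌊v⌋, h j - ∫ x in u..v, h x = h ⌊v⌋ +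
        ∑ j ∈ Icc ⌈u⌉ (⌊v⌋ - 1), (h j - ∫ x in (j : ℝ)..((j + 1 : ℤ) : ℝ), h x) -
        (∫ x in u..(⌈u⌉ : ℝ), h x) - ∫ x in (⌊v⌋ : ℝ)..v, h x := by
      rw [hI, hsplit, sum_insert (by simp), sum_sub_distrib, htel]
      ring
    have hterm : ∀ j ∈ Icc ⌈u⌉ (⌊v⌋ - 1), ‖h j - ∫ x in (j : ℝ)..((j + 1 : ℤ) : ℝ), h x‖ ≤ D := by
      intro j hj
      rw [mem_Icc] at hj
      have hj1 : (⌈u⌉ : ℝ) ≤ j := by exact_mod_cast hj.1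
      have hj2 : (j : ℝ) + 1 ≤ ⌊v⌋ := by exact_mod_cast (by omega : j + 1 ≤ ⌊v⌋)
      push_cast
      have h3 : h j - ∫ x in (j : ℝ)..((j : ℝ) + 1), h x = ∫ x in (j : ℝ)..((j : ℝ) + 1), (h j - h x) := by
        rw [intervalIntegral.integral_sub (by simp) (hint _ _)]
        simp
      rw [h3]
      have := intervalIntegral.norm_integral_le_of_norm_le_const (a := (j : ℝ)) (b := (j : ℝ) + 1)
        (f := fun x => h j - h x) (C := D) fun x hx => by
          rw [Set.uIoc_of_le (by linarith)] at hx
          refine (hL j ⟨by linarith, by linarith⟩ x ⟨by linarith [hx.1], by linarith [hx.2]⟩).trans ?_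
          have : |(j : ℝ) - x| ≤ 1 := by
            rw [abs_le]; constructor <;> linarith [hx.1, hx.2]
          nlinarith
      simpa using this
    have hsum : ‖∑ j ∈ Icc ⌈u⌉ (⌊v⌋ - 1), (h j - ∫ x in (j : ℝ)..((j + 1 : ℤ) : ℝ), h x)‖ ≤
        D * (v - u) := by
      refine (norm_sum_le _ _).trans ((sum_le_sum hterm).trans ?_)
      rw [sum_const, nsmul_eq_mul, Int.card_Icc, mul_comm]
      gcongr
      have : (((⌊v⌋ - 1 + 1 - ⌈u⌉).toNat : ℤ) : ℝ) = ((⌊v⌋ - ⌈u⌉ : ℤ) : ℝ) := by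
        rw [Int.toNat_of_nonneg (by omega)]; congr 1; ring
      rw [Int.cast_natCast] at this
      rw [this]; push_cast; linarith
    rw [heq]
    have e1 := h1 _ hmv
    have e2 := hbd u ⌈u⌉ ⟨le_rfl, huv⟩ hmu hu (by linarith)
    have e3 := hbd ⌊v⌋ v hmv ⟨huv, le_rfl⟩ hv (by linarith)
    refine (norm_sub_le _ _).trans ?_
    have e4 := norm_sub_le (h ⌊v⌋ +
        ∑ j ∈ Icc ⌈u⌉ (⌊v⌋ - 1), (h j - ∫ x in (j : ℝ)..((j + 1 : ℤ) : ℝ), h x))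
        (∫ x in u..(⌈u⌉ : ℝ), h x)
    have e5 := norm_add_le (h ⌊v⌋)
        (∑ j ∈ Icc ⌈u⌉ (⌊v⌋ - 1), (h j - ∫ x in (j : ℝ)..((j + 1 : ℤ) : ℝ), h x))
    linarith

/-- The step `M` multiplies the Lipschitz constant and divides the length, so the error does not
depend on `M`. -/
theorem norm_sum_prog_sub_le {g : ℝ → ℂ} (hc : Continuous g) {U D : ℝ} (hU : 0 ≤ U) (hD : 0 ≤ D)
    {M : ℕ} (hM : 0 < M) (c : ℤ) (h1 : ∀ x ∈ Set.Icc (-U) U, ‖g x‖ ≤ 1)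
    (hL : ∀ x ∈ Set.Icc (-U) U, ∀ y ∈ Set.Icc (-U) U, ‖g x - g y‖ ≤ D * |x - y|) :
    ‖∑ x ∈ prog U M c, g x - 1 / (M : ℂ) * ∫ x in (-U)..U, g x‖ ≤ 3 + 2 * U * D := by
  have hM' : (0 : ℝ) < M := by exact_mod_cast hM
  have hmem : ∀ t ∈ Set.Icc ((-U - c) / M) ((U - c) / M), (c : ℝ) + M * t ∈ Set.Icc (-U) U := by
    intro t ht
    rw [Set.mem_Icc, div_le_iff₀ hM', le_div_iff₀ hM'] at ht
    constructor <;> linarith [ht.1, ht.2]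
  have := norm_sum_sub_integral_le (h := fun t => g (c + M * t)) (by fun_prop)
    (u := (-U - c) / M) (v := (U - c) / M) (D := D * M) (by gcongr; linarith) (by positivity)
    (fun t ht => h1 _ (hmem t ht)) (fun t ht s hs => by
      refine (hL _ (hmem t ht) _ (hmem s hs)).trans (le_of_eq ?_)
      rw [show (c : ℝ) + M * t - (c + M * s) = M * (t - s) by ring, abs_mul, abs_of_pos hM']
      ring)
  rw [sum_prog U hM]
  push_cast
  rw [intervalIntegral.integral_comp_add_mul g hM'.ne'] at this
  have e1 : (c : ℝ) + M * ((-U - c) / M) = -U := by field_simp; ring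
  have e2 : (c : ℝ) + M * ((U - c) / M) = U := by field_simp; ring
  have e3 : D * M * ((U - c) / M - (-U - c) / M) = 2 * U * D := by field_simp; ring
  rw [e1, e2, e3, Complex.real_smul] at this
  simpa using this

theorem norm_pairSum_prog_sub_le {U W : ℝ} (hU : 0 ≤ U) (hW : 0 < W) {M : ℕ} (hM : 0 < M) (c d : ℤ)
    (φ : ℝ) :
    ‖∑ x ∈ prog U M c, ∑ y ∈ prog W M d, e (φ * x * y) - 1 / (M : ℂ) ^ 2 * pairIntegral U W φ‖ ≤
      (3 + 4 * Real.pi * (U * W) * |φ|) * (2 * U / M + 1 + 2 * W / M) := by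
  have hM' : (0 : ℝ) < M := by exact_mod_cast hM
  have hpi := Real.pi_pos
  set E := 3 + 4 * Real.pi * (U * W) * |φ| with hE
  have hE0 : 0 ≤ E := by positivity
  set J : ℝ → ℂ := fun x => ∫ y in (-W)..W, e (φ * x * y) with hJ
  have hJc : Continuous J := continuous_inner_integral W φ
  have hin : ∀ x ∈ prog U M c, ‖∑ y ∈ prog W M d, e (φ * x * y) - 1 / (M : ℂ) * J x‖ ≤ E := by
    intro x hx
    have hx' := (mem_prog.1 hx).1
    refine (norm_sum_prog_sub_le (g := fun y => e (φ * x * y)) (by fun_prop) hW.le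
      (D := 2 * Real.pi * |φ| * U) (by positivity) hM d (fun y _ => (norm_e _).le)
      fun y _ y' _ => ?_).trans (le_of_eq ?_)
    · refine (norm_e_sub_e_le _ _).trans ?_
      rw [← mul_sub, abs_mul, abs_mul]
      calc _ ≤ 2 * Real.pi * (|φ| * U * |y - y'|) := by gcongr
        _ = _ := by ring
    · rw [hE]; ring
  have hJL : ∀ x x', ‖J x - J x'‖ ≤ 2 * W * (2 * Real.pi * |φ| * W * |x - x'|) := by
    intro x x'
    have h1 : J x - J x' = ∫ y in (-W)..W, (e (φ * x * y) - e (φ * x' * y)) := by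
      rw [intervalIntegral.integral_sub] <;> exact Continuous.intervalIntegrable (by fun_prop) _ _
    have := intervalIntegral.norm_integral_le_of_norm_le_const (a := -W) (b := W)
      (f := fun y => e (φ * x * y) - e (φ * x' * y)) (C := 2 * Real.pi * |φ| * W * |x - x'|)
      fun y hy => by
        rw [Set.uIoc_of_le (by linarith)] at hy
        refine (norm_e_sub_e_le _ _).trans ?_
        have hy' : |y| ≤ W := abs_le.2 ⟨hy.1.le, hy.2⟩
        rw [show φ * x * y - φ * x' * y = φ * y * (x - x') by ring, abs_mul, abs_mul]
        calc _ ≤ 2 * Real.pi * (|φ| * W * |x - x'|) := by gcongr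
          _ = _ := by ring
    rw [h1]
    refine this.trans (le_of_eq ?_)
    rw [sub_neg_eq_add, show |W + W| = 2 * W by rw [abs_of_pos (by linarith)]; ring]
    ring
  have hW2 : ‖((2 * W : ℝ) : ℂ)⁻¹‖ = (2 * W)⁻¹ := by
    rw [norm_inv, Complex.norm_real, Real.norm_eq_abs, abs_of_pos (by linarith)]
  have hW0 : ((2 * W : ℝ) : ℂ) ≠ 0 := by exact_mod_cast (by linarith : 2 * W ≠ 0)
  -- The inner integral is divided by `2 * W` to meet the sup-norm hypothesis `≤ 1`; the factor is
  -- restored afterwards.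
  have hout0 := norm_sum_prog_sub_le (g := fun x => ((2 * W : ℝ) : ℂ)⁻¹ * J x)
    (continuous_const.mul hJc) hU
    (D := 2 * Real.pi * |φ| * W) (by positivity) hM c (fun x _ => by
      rw [norm_mul, hW2]
      rw [inv_mul_le_iff₀ (by linarith), mul_one]
      exact norm_integral_e_le_two hW.le _) (fun x _ x' _ => by
      rw [← mul_sub, norm_mul, hW2, inv_mul_le_iff₀ (by linarith)]
      exact hJL x x')
  rw [← mul_sum, intervalIntegral.integral_const_mul, mul_left_comm, ← mul_sub, norm_mul, hW2,
    inv_mul_le_iff₀ (by linarith)] at hout0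
  have hout : ‖∑ x ∈ prog U M c, J x - 1 / (M : ℂ) * pairIntegral U W φ‖ ≤ 2 * W * E := by
    refine hout0.trans (le_of_eq ?_)
    rw [hE]; ring
  have heq : ∑ x ∈ prog U M c, ∑ y ∈ prog W M d, e (φ * x * y) - 1 / (M : ℂ) ^ 2 * pairIntegral U W φ =
      ∑ x ∈ prog U M c, (∑ y ∈ prog W M d, e (φ * x * y) - 1 / (M : ℂ) * J x) +
        1 / (M : ℂ) * (∑ x ∈ prog U M c, J x - 1 / (M : ℂ) * pairIntegral U W φ) := by
    rw [sum_sub_distrib, ← mul_sum]; ring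
  rw [heq]
  refine (norm_add_le _ _).trans ?_
  have h1 : ‖∑ x ∈ prog U M c, (∑ y ∈ prog W M d, e (φ * x * y) - 1 / (M : ℂ) * J x)‖ ≤
      (2 * U / M + 1) * E := by
    refine (norm_sum_le _ _).trans ((sum_le_sum hin).trans ?_)
    rw [sum_const, nsmul_eq_mul]
    gcongr
    exact card_prog_le hU hM c
  have h2 : ‖1 / (M : ℂ) * (∑ x ∈ prog U M c, J x - 1 / (M : ℂ) * pairIntegral U W φ)‖ ≤
      1 / M * (2 * W * E) := by
    rw [norm_mul, norm_div, norm_one, Complex.norm_natCast]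
    gcongr
  calc _ ≤ (2 * U / M + 1) * E + 1 / M * (2 * W * E) := add_le_add h1 h2
    _ = _ := by ring

theorem norm_squareSum_prog_sub_le {U : ℝ} (hU : 0 ≤ U) {M : ℕ} (hM : 0 < M) (c : ℤ) (φ : ℝ) :
    ‖∑ z ∈ prog U M c, e (φ * z ^ 2) - 1 / (M : ℂ) * squareIntegral U φ‖ ≤
      3 + 8 * Real.pi * U ^ 2 * |φ| := by
  have hpi := Real.pi_pos
  refine (norm_sum_prog_sub_le (g := fun z => e (φ * z ^ 2)) (by fun_prop) hU
    (D := 4 * Real.pi * |φ| * U) (by positivity) hM c (fun _ _ => (norm_e _).le)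
    fun z hz z' hz' => ?_).trans (le_of_eq (by ring))
  refine (norm_e_sub_e_le _ _).trans ?_
  rw [show φ * z ^ 2 - φ * z' ^ 2 = φ * (z + z') * (z - z') by ring, abs_mul, abs_mul]
  have h : |z + z'| ≤ 2 * U := abs_le.2 ⟨by linarith [hz.1, hz'.1], by linarith [hz.2, hz'.2]⟩
  calc _ ≤ 2 * Real.pi * (|φ| * (2 * U) * |z - z'|) := by gcongr
    _ = _ := by ring

/-! ### Approximation near a rational point -/

theorem sum_prog_split {E : Type*} [AddCommMonoid E] (U : ℝ) {m r : ℕ} (hm : 0 < m) (hr : 0 < r)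
    (c : ℤ) (F : ℤ → E) :
    ∑ x ∈ prog U m c, F x = ∑ s ∈ Ico (0 : ℤ) r, ∑ x ∈ prog U (r * m) (c + m * s), F x := by
  have hmz : (m : ℤ) ≠ 0 := by exact_mod_cast hm.ne'
  have hrz : (0 : ℤ) < r := by exact_mod_cast hr
  rw [← sum_fiberwise_of_maps_to (g := fun x => ((x - c) / m) % r) (t := Ico (0 : ℤ) r)
    fun x _ => mem_Ico.2 ⟨Int.emod_nonneg _ hrz.ne', Int.emod_lt_of_pos _ hrz⟩]
  refine sum_congr rfl fun s hs => sum_congr ?_ fun _ _ => rfl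
  rw [mem_Ico] at hs
  ext x
  simp only [mem_filter, mem_prog]
  constructor
  · rintro ⟨⟨h1, h2⟩, h3⟩
    refine ⟨h1, ?_⟩
    obtain ⟨j, hj⟩ := Int.modEq_iff_dvd.1 h2.symm
    rw [hj, Int.mul_ediv_cancel_left _ hmz] at h3
    refine (Int.modEq_iff_dvd.2 ⟨j / r, ?_⟩).symm
    have := Int.emod_add_mul_ediv j r
    push_cast
    linear_combination hj - (m : ℤ) * this + m * h3
  · rintro ⟨h1, h2⟩
    obtain ⟨j, hj⟩ := Int.modEq_iff_dvd.1 h2.symm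
    have hx : x - c = m * (s + r * j) := by push_cast at hj; linear_combination hj
    refine ⟨⟨h1, (Int.modEq_iff_dvd.2 ⟨s + r * j, hx⟩).symm⟩, ?_⟩
    rw [hx, Int.mul_ediv_cancel_left _ hmz, Int.add_mul_emod_self_left]
    exact Int.emod_eq_of_lt hs.1 hs.2

/-- The complete sum attached to a hyperbolic plane at the rational point `a / r`. -/
noncomputable def pairRes (k : ℤ) (m r a : ℕ) (x₀ y₀ : ℤ) : ℂ :=
  ∑ s ∈ Ico (0 : ℤ) r, ∑ t ∈ Ico (0 : ℤ) r,
    e (k * (a / r) * (x₀ + m * s : ℤ) * (y₀ + m * t : ℤ) / m)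

/-- The complete sum attached to a square at the rational point `a / r`. -/
noncomputable def squareRes (k : ℤ) (m r a : ℕ) (z₀ : ℤ) : ℂ :=
  ∑ s ∈ Ico (0 : ℤ) r, e (k * (a / r) * (z₀ + m * s : ℤ) ^ 2 / m)

theorem norm_pairRes_le (k : ℤ) (m r a : ℕ) (x₀ y₀ : ℤ) : ‖pairRes k m r a x₀ y₀‖ ≤ (r : ℝ) ^ 2 := by
  refine (norm_sum_le _ _).trans ((sum_le_sum fun s _ => norm_sum_e_le_card _ _).trans ?_)
  simp [sq]

theorem e_mul_mul_div_congr {m r : ℕ} (hm : 0 < m) (hr : 0 < r) (k : ℤ) (a : ℕ) {x y x' y' : ℤ}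
    (hx : x ≡ x' [ZMOD (r * m : ℕ)]) (hy : y ≡ y' [ZMOD (r * m : ℕ)]) :
    e (k * (a / r) * x * y / m) = e (k * (a / r) * x' * y' / m) := by
  obtain ⟨n, hn⟩ := (hx.mul hy).symm.dvd
  have hn' : (x : ℝ) * y - x' * y' = r * m * n := by exact_mod_cast hn
  rw [← e_add_int (k * (a / r) * x' * y' / m) (k * a * n)]
  have hm' : (m : ℝ) ≠ 0 := by exact_mod_cast hm.ne'
  have hr' : (r : ℝ) ≠ 0 := by exact_mod_cast hr.ne'
  congr 1
  push_cast
  field_simp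
  linear_combination (k : ℝ) * a * hn'

/-- Refine the classes modulo `m` to classes modulo `r m`. On each of the `r ^ 2` resulting pairs
the phase at `a / r` is constant, and the remaining sum in `θ` is compared with `pairIntegral`. -/
theorem norm_pairSum_sub_le (k : ℤ) {m r : ℕ} (hm : 0 < m) (hr : 0 < r) (a : ℕ) {U W : ℝ}
    (hU : 0 ≤ U) (hW : 0 < W) (x₀ y₀ : ℤ) (θ : ℝ) :
    ‖pairSum k m U W x₀ y₀ (a / r + θ) -
        1 / ((r * m : ℕ) : ℂ) ^ 2 * pairRes k m r a x₀ y₀ * pairIntegral U W (k * θ / m)‖ ≤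
      (r : ℝ) ^ 2 * ((3 + 4 * Real.pi * (U * W) * |k * θ / m|) *
        (2 * U / (r * m : ℕ) + 1 + 2 * W / (r * m : ℕ))) := by
  have h1 : pairSum k m U W x₀ y₀ (a / r + θ) = ∑ s ∈ Ico (0 : ℤ) r, ∑ t ∈ Ico (0 : ℤ) r,
      e (k * (a / r) * (x₀ + m * s : ℤ) * (y₀ + m * t : ℤ) / m) *
        ∑ x ∈ prog U (r * m) (x₀ + m * s), ∑ y ∈ prog W (r * m) (y₀ + m * t),
          e (k * θ / m * x * y) := by
    unfold pairSum
    rw [sum_prog_split U hm hr]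
    refine sum_congr rfl fun s _ => ?_
    simp_rw [sum_prog_split W hm hr]
    rw [sum_comm]
    refine sum_congr rfl fun t _ => ?_
    rw [mul_sum]
    refine sum_congr rfl fun x hx => ?_
    rw [mul_sum]
    refine sum_congr rfl fun y hy => ?_
    rw [← e_mul_mul_div_congr hm hr k a (mem_prog.1 hx).2 (mem_prog.1 hy).2, ← e_add]
    congr 1
    ring
  rw [h1, pairRes, mul_sum, sum_mul, ← sum_sub_distrib]
  simp_rw [mul_sum, sum_mul, ← sum_sub_distrib]
  refine (norm_sum_le _ _).trans ?_
  refine (sum_le_sum fun s _ => (norm_sum_le _ _).trans (sum_le_sum fun t _ => ?_) :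
    _ ≤ ∑ s ∈ Ico (0 : ℤ) r, ∑ t ∈ Ico (0 : ℤ) r, ((3 + 4 * Real.pi * (U * W) * |k * θ / m|) *
        (2 * U / (r * m : ℕ) + 1 + 2 * W / (r * m : ℕ)))).trans ?_
  · have h2 := norm_pairSum_prog_sub_le hU hW (Nat.mul_pos hr hm) (x₀ + m * s) (y₀ + m * t) (k * θ / m)
    simp_rw [← mul_sum]
    refine le_trans (le_of_eq ?_) h2
    rw [← one_mul ‖_ - 1 / _ ^ 2 * pairIntegral _ _ _‖,
      ← norm_e (k * (a / r) * (x₀ + m * s : ℤ) * (y₀ + m * t : ℤ) / m), ← norm_mul, mul_sub]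
    congr 1
    ring
  · simp only [sum_const, Int.card_Ico, sub_zero, Int.toNat_natCast, nsmul_eq_mul]
    apply le_of_eq; ring

theorem norm_squareSum_sub_le (k : ℤ) {m r : ℕ} (hm : 0 < m) (hr : 0 < r) (a : ℕ) {U : ℝ}
    (hU : 0 ≤ U) (z₀ : ℤ) (θ : ℝ) :
    ‖squareSum k m U z₀ (a / r + θ) -
        1 / ((r * m : ℕ) : ℂ) * squareRes k m r a z₀ * squareIntegral U (k * θ / m)‖ ≤
      r * (3 + 8 * Real.pi * U ^ 2 * |k * θ / m|) := by
  have h1 : squareSum k m U z₀ (a / r + θ) = ∑ s ∈ Ico (0 : ℤ) r,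
      e (k * (a / r) * (z₀ + m * s : ℤ) ^ 2 / m) *
        ∑ z ∈ prog U (r * m) (z₀ + m * s), e (k * θ / m * z ^ 2) := by
    unfold squareSum
    rw [sum_prog_split U hm hr]
    refine sum_congr rfl fun s _ => ?_
    rw [mul_sum]
    refine sum_congr rfl fun z hz => ?_
    have := e_mul_mul_div_congr hm hr k a (mem_prog.1 hz).2 (mem_prog.1 hz).2
    simp only [mul_assoc, ← sq] at this ⊢
    rw [← this, ← e_add]
    congr 1
    ring
  rw [h1, squareRes, mul_sum, sum_mul, ← sum_sub_distrib]
  refine (norm_sum_le _ _).trans ?_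
  refine (sum_le_sum fun s _ => ?_ :
    _ ≤ ∑ s ∈ Ico (0 : ℤ) r, (3 + 8 * Real.pi * U ^ 2 * |k * θ / m|)).trans ?_
  · have h2 := norm_squareSum_prog_sub_le hU (Nat.mul_pos hr hm) (z₀ + m * s) (k * θ / m)
    rw [← one_mul ‖_‖, ← norm_e (k * (a / r) * (z₀ + m * s : ℤ) ^ 2 / m), ← norm_mul, mul_sub] at h2
    refine le_trans (le_of_eq ?_) h2
    congr 1
    ring
  · simp only [sum_const, Int.card_Ico, sub_zero, Int.toNat_natCast, nsmul_eq_mul]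
    exact le_rfl

theorem norm_prod_sub_prod_le {T₁ T₂ T₃ T₄ G M₁ M₂ M₃ M₄ g : ℂ} {E N E' N' : ℝ}
    (h₁ : ‖T₁ - M₁‖ ≤ E) (h₂ : ‖T₂ - M₂‖ ≤ E) (h₃ : ‖T₃ - M₃‖ ≤ E) (h₄ : ‖T₄ - M₄‖ ≤ E)
    (h₅ : ‖G - g‖ ≤ E') (hT₂ : ‖T₂‖ ≤ N) (hT₃ : ‖T₃‖ ≤ N) (hT₄ : ‖T₄‖ ≤ N) (hG : ‖G‖ ≤ N')
    (hM₁ : ‖M₁‖ ≤ N) (hM₂ : ‖M₂‖ ≤ N) (hM₃ : ‖M₃‖ ≤ N) (hM₄ : ‖M₄‖ ≤ N) :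
    ‖T₁ * T₂ * T₃ * T₄ * G - M₁ * M₂ * M₃ * M₄ * g‖ ≤ 4 * (E * N ^ 3 * N') + N ^ 4 * E' := by
  have hE : 0 ≤ E := (norm_nonneg _).trans h₁
  have hN : 0 ≤ N := (norm_nonneg _).trans hT₂
  have hN' : 0 ≤ N' := (norm_nonneg _).trans hG
  have hE' : 0 ≤ E' := (norm_nonneg _).trans h₅
  have heq : T₁ * T₂ * T₃ * T₄ * G - M₁ * M₂ * M₃ * M₄ * g =
      (T₁ - M₁) * T₂ * T₃ * T₄ * G + M₁ * (T₂ - M₂) * T₃ * T₄ * G + M₁ * M₂ * (T₃ - M₃) * T₄ * G +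
        M₁ * M₂ * M₃ * (T₄ - M₄) * G + M₁ * M₂ * M₃ * M₄ * (G - g) := by ring
  have key : ∀ {a b c d f : ℂ} {A B C D F : ℝ}, ‖a‖ ≤ A → ‖b‖ ≤ B → ‖c‖ ≤ C → ‖d‖ ≤ D → ‖f‖ ≤ F →
      ‖a * b * c * d * f‖ ≤ A * B * C * D * F := by
    intro a b c d f A B C D F ha hb hc hd hf
    have := (norm_nonneg _).trans ha
    have := (norm_nonneg _).trans hb
    have := (norm_nonneg _).trans hc
    have := (norm_nonneg _).trans hd
    simp only [norm_mul]
    gcongr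
  rw [heq]
  refine (norm_add_le _ _).trans ?_
  refine (add_le_add (norm_add₄_le) (key hM₁ hM₂ hM₃ hM₄ h₅)).trans ?_
  have k1 := key h₁ hT₂ hT₃ hT₄ hG
  have k2 := key hM₁ h₂ hT₃ hT₄ hG
  have k3 := key hM₁ hM₂ h₃ hT₄ hG
  have k4 := key hM₁ hM₂ hM₃ h₄ hG
  have e1 : E * N * N * N * N' = E * N ^ 3 * N' := by ring
  have e2 : N * E * N * N * N' = E * N ^ 3 * N' := by ring
  have e3 : N * N * E * N * N' = E * N ^ 3 * N' := by ring
  have e4 : N * N * N * E * N' = E * N ^ 3 * N' := by ring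
  have e5 : N * N * N * N * E' = N ^ 4 * E' := by ring
  linarith

/-- The complete sum of `q` over the residue class `B₀` at the rational point `a / r`. -/
noncomputable def fullRes (m r a : ℕ) (B₀ : V ℤ) : ℂ :=
  ∑ B ∈ Fintype.piFinset (fun _ : Fin 9 => Ico (0 : ℤ) r),
    e ((a : ℝ) / r * ((q (fun i => B₀ i + m * B i) : ℤ) : ℝ) / m)

theorem fullRes_eq (m r a : ℕ) (B₀ : V ℤ) :
    fullRes m r a B₀ = pairRes (-1) m r a (B₀ 0) (B₀ 8) * pairRes (-1) m r a (B₀ 4) (B₀ 6) *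
      pairRes (-2) m r a (B₀ 1) (B₀ 7) * pairRes (-2) m r a (B₀ 2) (B₀ 5) *
        squareRes (-2) m r a (B₀ 3) := by
  unfold pairRes squareRes fullRes
  rw [← sum_piFinset_split (fun _ => Ico (0 : ℤ) r)
    (fun s t => e ((-1 : ℤ) * (a / r) * (B₀ 0 + m * s : ℤ) * (B₀ 8 + m * t : ℤ) / m))
    (fun s t => e ((-1 : ℤ) * (a / r) * (B₀ 4 + m * s : ℤ) * (B₀ 6 + m * t : ℤ) / m))
    (fun s t => e ((-2 : ℤ) * (a / r) * (B₀ 1 + m * s : ℤ) * (B₀ 7 + m * t : ℤ) / m))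
    (fun s t => e ((-2 : ℤ) * (a / r) * (B₀ 2 + m * s : ℤ) * (B₀ 5 + m * t : ℤ) / m))
    (fun s => e ((-2 : ℤ) * (a / r) * (B₀ 3 + m * s : ℤ) ^ 2 / m))]
  refine sum_congr rfl fun B _ => ?_
  simp only [← e_add]
  congr 1
  unfold q; push_cast; ring

/-! ### Error of the approximation on one major arc -/

section Major

variable {Y : V ℝ} {Z : ℝ} {m r : ℕ}

theorem one_le_div_of_mul_le {U : ℝ} (hm : 0 < m) (hr : 0 < r) (h : ((r * m : ℕ) : ℝ) ≤ U) :
    1 ≤ U / m := by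
  have hm' : (0 : ℝ) < m := by exact_mod_cast hm
  rw [le_div_iff₀ hm', one_mul]
  refine le_trans ?_ h
  exact_mod_cast Nat.le_mul_of_pos_left m hr

theorem pair_bounds {U W A : ℝ} (hA : U * W = A) (hU : 0 < U) (hW : 0 < W) (hUZ : U ≤ Z)
    (hWZ : W ≤ Z) (hm : 0 < m) (hr : 0 < r) (hU' : ((r * m : ℕ) : ℝ) ≤ U)
    (hW' : ((r * m : ℕ) : ℝ) ≤ W) {k : ℤ} (hk : |(k : ℝ)| ≤ 2) (a : ℕ) (x₀ y₀ : ℤ) (θ φ : ℝ)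
    (hφ : k * θ / m = φ) :
    ‖pairSum k m U W x₀ y₀ (a / r + θ)‖ ≤ 9 * A / (m : ℝ) ^ 2 ∧
    ‖1 / ((r * m : ℕ) : ℂ) ^ 2 * pairRes k m r a x₀ y₀ * pairIntegral U W φ‖ ≤
      9 * A / (m : ℝ) ^ 2 ∧
    ‖pairSum k m U W x₀ y₀ (a / r + θ) -
        1 / ((r * m : ℕ) : ℂ) ^ 2 * pairRes k m r a x₀ y₀ * pairIntegral U W φ‖ ≤
      130 * Z * (r * (1 + A * |θ| / m)) / m := by
  have hm' : (0 : ℝ) < m := by exact_mod_cast hm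
  have hr' : (0 : ℝ) < r := by exact_mod_cast hr
  have hA0 : 0 < A := hA ▸ mul_pos hU hW
  have h1 := one_le_div_of_mul_le hm hr hU'
  have h2 := one_le_div_of_mul_le hm hr hW'
  refine ⟨?_, ?_, ?_⟩
  · refine (norm_pairSum_le k hm hU.le hW.le _ _ _).trans ?_
    calc _ ≤ (3 * (U / m)) * (3 * (W / m)) := by
          gcongr
          · rw [mul_div_assoc]; linarith
          · rw [mul_div_assoc]; linarith
      _ = _ := by rw [← hA]; field_simp; norm_num
  · rw [norm_mul, norm_mul, norm_div, norm_one, norm_pow, Complex.norm_natCast]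
    calc _ ≤ 1 / ((r * m : ℕ) : ℝ) ^ 2 * (r : ℝ) ^ 2 * (4 * A) := by
          gcongr
          · exact norm_pairRes_le k m r a x₀ y₀
          · exact norm_pairIntegral_le hU hW hA
      _ = 4 * A / (m : ℝ) ^ 2 := by push_cast; field_simp
      _ ≤ _ := by gcongr; norm_num
  · refine (hφ ▸ norm_pairSum_sub_le k hm hr a hU.le hW x₀ y₀ θ).trans ?_
    rw [hA]
    have hrm : (0 : ℝ) < ((r * m : ℕ) : ℝ) := by exact_mod_cast Nat.mul_pos hr hm
    -- The middle `1` is absorbed because `r m ≤ U ≤ Z`, hence `5 = 2 + 1 + 2`.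
    have e1 : 2 * U / ((r * m : ℕ) : ℝ) + 1 + 2 * W / ((r * m : ℕ) : ℝ) ≤ 5 * Z / ((r * m : ℕ) : ℝ) := by
      rw [← sub_nonneg]
      have : 5 * Z / ((r * m : ℕ) : ℝ) - (2 * U / ((r * m : ℕ) : ℝ) + 1 + 2 * W / ((r * m : ℕ) : ℝ)) =
        (5 * Z - 2 * U - ((r * m : ℕ) : ℝ) - 2 * W) / ((r * m : ℕ) : ℝ) := by field_simp; ring
      rw [this]
      apply div_nonneg _ hrm.le
      linarith
    have e2 : |φ| ≤ 2 * |θ| / m := by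
      rw [← hφ, abs_div, abs_mul, abs_of_pos hm']; gcongr
    have e3 : 3 + 4 * Real.pi * A * |φ| ≤ 26 * (1 + A * |θ| / m) := by
      have hpi := Real.pi_lt_d2
      have h0 : 0 ≤ A * |θ| / m := by positivity
      calc 3 + 4 * Real.pi * A * |φ| ≤ 3 + 4 * 3.15 * A * (2 * |θ| / m) := by gcongr
        _ = 3 + 25.2 * (A * |θ| / m) := by ring
        _ ≤ _ := by linarith
    calc _ ≤ (r : ℝ) ^ 2 * (26 * (1 + A * |θ| / m) * (5 * Z / ((r * m : ℕ) : ℝ))) := by gcongr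
      _ = _ := by push_cast; field_simp; ring

theorem square_bounds {U : ℝ} (hU : 0 < U) (hm : 0 < m) (hr : 0 < r)
    (hU' : ((r * m : ℕ) : ℝ) ≤ U) {k : ℤ} (hk : |(k : ℝ)| ≤ 2) (a : ℕ) (z₀ : ℤ) (θ φ : ℝ)
    (hφ : k * θ / m = φ) :
    ‖squareSum k m U z₀ (a / r + θ)‖ ≤ 3 * U / m ∧
    ‖squareSum k m U z₀ (a / r + θ) -
        1 / ((r * m : ℕ) : ℂ) * squareRes k m r a z₀ * squareIntegral U φ‖ ≤
      51 * (r * (1 + U ^ 2 * |θ| / m)) := by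
  have hm' : (0 : ℝ) < m := by exact_mod_cast hm
  have hr' : (0 : ℝ) < r := by exact_mod_cast hr
  have h1 := one_le_div_of_mul_le hm hr hU'
  constructor
  · refine (norm_squareSum_le k hm hU.le _ _).trans ?_
    rw [mul_div_assoc, mul_div_assoc]; linarith
  · refine (hφ ▸ norm_squareSum_sub_le k hm hr a hU.le z₀ θ).trans ?_
    have e2 : |φ| ≤ 2 * |θ| / m := by
      rw [← hφ, abs_div, abs_mul, abs_of_pos hm']; gcongr
    have e3 : 3 + 8 * Real.pi * U ^ 2 * |φ| ≤ 51 * (1 + U ^ 2 * |θ| / m) := by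
      have hpi := Real.pi_lt_d2
      have h0 : 0 ≤ U ^ 2 * |θ| / m := by positivity
      calc 3 + 8 * Real.pi * U ^ 2 * |φ| ≤ 3 + 8 * 3.15 * U ^ 2 * (2 * |θ| / m) := by gcongr
        _ = 3 + 50.4 * (U ^ 2 * |θ| / m) := by ring
        _ ≤ _ := by linarith
    calc _ ≤ (r : ℝ) * (51 * (1 + U ^ 2 * |θ| / m)) := by gcongr
      _ = _ := by ring

/-- The factors are replaced one at a time. A plane may be very lopsided, so its error involves the
longest side `Z`; the error of the square, with `Y 3` for `Z`, is dominated. The constant rounds up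
`1137240 + 334611`. -/
theorem norm_boxSum_sub_le (h : IsBalanced Y (Y 3 ^ 2)) (hZ : ∀ i, Y i ≤ Z) (hm : 0 < m)
    (hr : 0 < r) (hrm : ∀ i, ((r * m : ℕ) : ℝ) ≤ Y i) (a : ℕ) (B₀ : V ℤ) (θ : ℝ) :
    ‖boxSum Y m B₀ (a / r + θ) -
        1 / ((r * m : ℕ) : ℂ) ^ 9 * fullRes m r a B₀ * boxIntegral Y (θ / m)‖ ≤
      1500000 * (r * (1 + Y 3 ^ 2 * |θ| / m)) * Z * Y 3 ^ 7 / (m : ℝ) ^ 8 := by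
  have hm' : (0 : ℝ) < m := by exact_mod_cast hm
  have hV := h.pos 3
  have hk1 : |((-1 : ℤ) : ℝ)| ≤ 2 := by norm_num
  have hk2 : |((-2 : ℤ) : ℝ)| ≤ 2 := by norm_num
  have f1 : ((-1 : ℤ) : ℝ) * θ / m = -(θ / m) := by push_cast; ring
  have f2 : ((-2 : ℤ) : ℝ) * θ / m = -2 * (θ / m) := by push_cast; ring
  obtain ⟨-, b1, c1⟩ := pair_bounds h.h08 (h.pos 0) (h.pos 8) (hZ 0) (hZ 8) hm hr (hrm 0) (hrm 8) hk1
    a (B₀ 0) (B₀ 8) θ _ f1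
  obtain ⟨a2, b2, c2⟩ := pair_bounds h.h46 (h.pos 4) (h.pos 6) (hZ 4) (hZ 6) hm hr (hrm 4) (hrm 6) hk1
    a (B₀ 4) (B₀ 6) θ _ f1
  obtain ⟨a3, b3, c3⟩ := pair_bounds h.h17 (h.pos 1) (h.pos 7) (hZ 1) (hZ 7) hm hr (hrm 1) (hrm 7) hk2
    a (B₀ 1) (B₀ 7) θ _ f2
  obtain ⟨a4, b4, c4⟩ := pair_bounds h.h25 (h.pos 2) (h.pos 5) (hZ 2) (hZ 5) hm hr (hrm 2) (hrm 5) hk2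
    a (B₀ 2) (B₀ 5) θ _ f2
  obtain ⟨a5, c5⟩ := square_bounds (h.pos 3) hm hr (hrm 3) hk2 a (B₀ 3) θ _ f2
  have key := norm_prod_sub_prod_le c1 c2 c3 c4 c5 a2 a3 a4 a5 b1 b2 b3 b4
  rw [boxSum_eq, boxIntegral_eq fun i => (h.pos i).le, fullRes_eq]
  refine le_trans (le_of_eq ?_) (key.trans ?_)
  · congr 1; ring
  · set ρ : ℝ := r * (1 + Y 3 ^ 2 * |θ| / m) with hρ
    have hρ0 : 0 ≤ ρ := by positivity
    have hVZ := hZ 3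
    have hZ0 : 0 < Z := hV.trans_le hVZ
    have e1 : 4 * (130 * Z * ρ / m * (9 * Y 3 ^ 2 / (m : ℝ) ^ 2) ^ 3 * (3 * Y 3 / m)) =
        1137240 * ρ * Z * Y 3 ^ 7 / (m : ℝ) ^ 8 := by field_simp; ring
    have e2 : (9 * Y 3 ^ 2 / (m : ℝ) ^ 2) ^ 4 * (51 * ρ) = 334611 * ρ * Y 3 * Y 3 ^ 7 / (m : ℝ) ^ 8 := by
      field_simp; ring
    rw [e1, e2]
    calc _ ≤ 1137240 * ρ * Z * Y 3 ^ 7 / (m : ℝ) ^ 8 + 334611 * ρ * Z * Y 3 ^ 7 / (m : ℝ) ^ 8 := by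
          gcongr
      _ = 1471851 * ρ * Z * Y 3 ^ 7 / (m : ℝ) ^ 8 := by ring
      _ ≤ _ := by gcongr; norm_num

end Major

/-! ### The dissection of the circle -/

/-- The centres `a / r` of the major arcs, `r ≤ R`, in lowest terms. -/
noncomputable def centres (R : ℝ) : Finset (Σ _ : ℕ, ℕ) :=
  (Icc 1 ⌊R⌋₊).sigma fun r => (range r).filter fun a => Nat.gcd a r = 1

/-- The major arc around `a / r`. -/
def arc (Q : ℝ) (c : Σ _ : ℕ, ℕ) : Set ℝ :=
  Set.Ioc ((c.2 : ℝ) / c.1 - 1 / (c.1 * Q)) ((c.2 : ℝ) / c.1 + 1 / (c.1 * Q))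

/-- The minor arcs. -/
def minor (Q R : ℝ) : Set ℝ := Set.Ioc (-(1 / Q)) (-(1 / Q) + 1) \ ⋃ c ∈ centres R, arc Q c

theorem mem_centres {R : ℝ} (hR : 0 ≤ R) {c : Σ _ : ℕ, ℕ} :
    c ∈ centres R ↔ 1 ≤ c.1 ∧ (c.1 : ℝ) ≤ R ∧ c.2 < c.1 ∧ Nat.gcd c.2 c.1 = 1 := by
  simp only [centres, mem_sigma, mem_Icc, mem_filter, mem_range, Nat.le_floor_iff hR, and_assoc]

/-- Cutting the circle at `-1 / Q` keeps the arc around `0 / 1` in one piece. At the other end `a /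
r ≤ 1 - 1 / r`, which leaves room for the arc since `r + 1 ≤ Q`. -/
theorem arc_subset {Q R : ℝ} (hQ : 2 * R + 1 ≤ Q) (hR : 1 ≤ R) {c : Σ _ : ℕ, ℕ}
    (hc : c ∈ centres R) : arc Q c ⊆ Set.Ioc (-(1 / Q)) (-(1 / Q) + 1) := by
  obtain ⟨h1, h2, h3, -⟩ := (mem_centres (by linarith)).1 hc
  have hQ0 : 0 < Q := by linarith
  have h1' : (1 : ℝ) ≤ c.1 := by exact_mod_cast h1
  have h3' : (c.2 : ℝ) + 1 ≤ c.1 := by exact_mod_cast h3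
  have hr0 : (0 : ℝ) < c.1 := by linarith
  refine Set.Ioc_subset_Ioc ?_ ?_
  · have e1 : 1 / (c.1 * Q) ≤ 1 / Q := by
      apply one_div_le_one_div_of_le hQ0; nlinarith
    have e2 : 0 ≤ (c.2 : ℝ) / c.1 := by positivity
    linarith
  · have e1 : (c.2 : ℝ) / c.1 ≤ 1 - 1 / c.1 := by
      rw [le_sub_iff_add_le, ← add_div, div_le_one hr0]; exact h3'
    have e2 : 1 / (c.1 * Q) + 1 / Q ≤ 1 / (c.1 : ℝ) := by
      rw [div_add_div _ _ (by positivity) hQ0.ne', div_le_div_iff₀ (by positivity) hr0]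
      nlinarith [mul_pos hr0 hQ0]
    linarith

/-- Distinct reduced fractions are at least `1 / (r r')` apart, whereas overlapping arcs would bring
them closer than `(r + r') / (r r' Q)`, and `r + r' < Q`. -/
theorem arc_disjoint {Q R : ℝ} (hQ : 2 * R + 1 ≤ Q) (hR : 1 ≤ R) :
    (centres R : Set (Σ _ : ℕ, ℕ)).PairwiseDisjoint (arc Q) := by
  intro c hc c' hc' hne
  obtain ⟨h1, h2, h3, h4⟩ := (mem_centres (by linarith)).1 hc
  obtain ⟨h1', h2', h3', h4'⟩ := (mem_centres (by linarith)).1 hc'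
  refine Set.disjoint_left.2 fun x hx hx' => ?_
  have hQ0 : 0 < Q := by linarith
  have hr : (0 : ℝ) < c.1 := by exact_mod_cast h1
  have hr' : (0 : ℝ) < c'.1 := by exact_mod_cast h1'
  have hx1 := hx.1
  have hx2 := hx.2
  have hx1' := hx'.1
  have hx2' := hx'.2
  have habs : |(c.2 : ℝ) / c.1 - c'.2 / c'.1| < 1 / (c.1 * Q) + 1 / (c'.1 * Q) := by
    rw [abs_lt]; constructor <;> linarith
  have e1 : (c.2 : ℝ) / c.1 - c'.2 / c'.1 =
      ((c.2 * c'.1 - c'.2 * c.1 : ℤ) : ℝ) / (c.1 * c'.1) := by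
    push_cast; field_simp
  have e2 : 1 / (c.1 * Q) + 1 / (c'.1 * Q) = ((c.1 + c'.1) / Q) / (c.1 * c'.1) := by
    field_simp; ring
  rw [e1, e2, abs_div, abs_of_pos (mul_pos hr hr'), div_lt_div_iff_of_pos_right (mul_pos hr hr')] at habs
  have e3 : ((c.1 : ℝ) + c'.1) / Q < 1 := by rw [div_lt_one hQ0]; linarith
  have e4 : |((c.2 * c'.1 - c'.2 * c.1 : ℤ) : ℝ)| < 1 := habs.trans e3
  have e5 : (c.2 * c'.1 - c'.2 * c.1 : ℤ) = 0 := by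
    have : |(c.2 * c'.1 - c'.2 * c.1 : ℤ)| < 1 := by exact_mod_cast e4
    exact Int.abs_lt_one_iff.1 this
  have e6 : c.2 * c'.1 = c'.2 * c.1 := by
    have : (c.2 * c'.1 : ℤ) = c'.2 * c.1 := by linarith
    exact_mod_cast this
  have e7 : c.1 = c'.1 := by
    apply Nat.dvd_antisymm
    · exact (Nat.Coprime.symm h4).dvd_of_dvd_mul_left ⟨c'.2, by rw [e6, mul_comm]⟩
    · exact (Nat.Coprime.symm h4').dvd_of_dvd_mul_left ⟨c.2, by rw [← e6, mul_comm]⟩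
  have e8 : c.2 = c'.2 := by
    rw [e7] at e6
    exact Nat.eq_of_mul_eq_mul_right h1' e6
  exact hne (Sigma.ext e7 (heq_of_eq e8))

theorem measurableSet_arc (Q : ℝ) (c : Σ _ : ℕ, ℕ) : MeasurableSet (arc Q c) := measurableSet_Ioc

theorem measurableSet_minor (Q R : ℝ) : MeasurableSet (minor Q R) :=
  measurableSet_Ioc.diff (Finset.measurableSet_biUnion _ fun c _ => measurableSet_arc Q c)

theorem minor_subset (Q R : ℝ) : minor Q R ⊆ Set.Ioc (-(1 / Q)) (-(1 / Q) + 1) := Set.sdiff_subset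

theorem integral_eq_major_add_minor {Q R : ℝ} (hQ : 2 * R + 1 ≤ Q) (hR : 1 ≤ R) {F : ℝ → ℂ}
    (hF : Continuous F) :
    ∫ β in (-(1 / Q))..(-(1 / Q) + 1), F β =
      ∑ r ∈ Icc 1 ⌊R⌋₊, ∑ a ∈ (range r).filter (fun a => Nat.gcd a r = 1),
        (∫ θ in (-(1 / (r * Q)))..(1 / (r * Q)), F (a / r + θ)) + ∫ β in minor Q R, F β := by
  have hint : ∀ s : Set ℝ, s ⊆ Set.Ioc (-(1 / Q)) (-(1 / Q) + 1) → IntegrableOn F s := fun s hs =>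
    (hF.integrableOn_Ioc).mono_set hs
  have hsub : (⋃ c ∈ centres R, arc Q c) ⊆ Set.Ioc (-(1 / Q)) (-(1 / Q) + 1) :=
    Set.iUnion₂_subset fun c hc => arc_subset hQ hR hc
  have hmeas : MeasurableSet (⋃ c ∈ centres R, arc Q c) :=
    Finset.measurableSet_biUnion _ fun c _ => measurableSet_arc Q c
  rw [intervalIntegral.integral_of_le (by linarith),
    ← Set.union_sdiff_cancel hsub, setIntegral_union Set.disjoint_sdiff_right
      (measurableSet_minor Q R) (hint _ hsub) (hint _ (minor_subset Q R)),
    integral_biUnion_finset _ (fun c _ => measurableSet_arc Q c) (arc_disjoint hQ hR)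
      fun c hc => hint _ (arc_subset hQ hR hc)]
  congr 1
  rw [centres, sum_sigma]
  refine sum_congr rfl fun r hr => sum_congr rfl fun a _ => ?_
  have hr1 : (0 : ℝ) < r := by exact_mod_cast (mem_Icc.1 hr).1
  have hpos : 0 < 1 / ((r : ℝ) * Q) := by
    have : 0 < Q := by linarith
    positivity
  rw [intervalIntegral.integral_comp_add_left F, arc, intervalIntegral.integral_of_le (by linarith),
    ← sub_eq_add_neg]

/-- Apply Dirichlet's theorem to `β m`. A denominator at most `P` would, after division by `m`, put
`β` in a major arc of denominator at most `m P`. This is why the major arcs extend to `m P`. -/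
theorem exists_approx_of_mem_minor {Q P : ℝ} {m : ℕ} (hm : 0 < m) (hP : 1 ≤ P)
    (hQ : 2 * (m * P) + 1 ≤ Q) {β : ℝ} (hβ : β ∈ minor Q (m * P)) :
    ∃ (a : ℤ) (r : ℕ), P < r ∧ (r : ℝ) ≤ Q ∧ IsCoprime a (r : ℤ) ∧
      |((-1 : ℤ) : ℝ) * β * m - a / r| ≤ 1 / (r : ℝ) ^ 2 := by
  have hm' : (0 : ℝ) < m := by exact_mod_cast hm
  have hm1 : (1 : ℝ) ≤ m := by exact_mod_cast hm
  have hR : 1 ≤ m * P := by nlinarith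
  have hQ0 : 0 < Q := by linarith
  have hn : 0 < ⌊Q⌋₊ := Nat.floor_pos.2 (by linarith)
  obtain ⟨ρ, h1, h2⟩ := Real.exists_rat_abs_sub_le_and_den_le (β * m) hn
  have hd : (0 : ℝ) < ρ.den := by exact_mod_cast ρ.pos
  have hnQ : Q < (⌊Q⌋₊ : ℝ) + 1 := Nat.lt_floor_add_one Q
  have hdQ : (ρ.den : ℝ) ≤ Q := (Nat.le_floor_iff hQ0.le).1 h2
  have hlt : |β * m - ρ| < 1 / (Q * ρ.den) := by
    refine h1.trans_lt ?_
    apply one_div_lt_one_div_of_lt (by positivity)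
    gcongr
  refine ⟨-ρ.num, ρ.den, ?_, hdQ, ?_, ?_⟩
  · by_contra hcon
    push Not at hcon
    -- The candidate centre `ρ / m`. Its reduced denominator divides `ρ.den * m`, so the
    -- approximation to `β` fits the width of its arc; since `β` lies in the chosen unit interval,
    -- the numerator lies in `[0, σ.den)`.
    set σ : ℚ := ρ * (m : ℚ)⁻¹ with hσ
    have hσden : σ.den ∣ ρ.den * m := by
      have := Rat.mul_den_dvd ρ (m : ℚ)⁻¹
      rwa [Rat.inv_natCast_den_of_pos hm] at this
    have hσd : (0 : ℝ) < σ.den := by exact_mod_cast σ.pos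
    have hσle : (σ.den : ℝ) ≤ ρ.den * m := by
      exact_mod_cast Nat.le_of_dvd (Nat.mul_pos ρ.pos hm) hσden
    have hσR : (σ.den : ℝ) ≤ m * P := by nlinarith
    have hclose : |β - σ| < 1 / (σ.den * Q) := by
      have e1 : β - σ = (β * m - ρ) / m := by
        rw [hσ]; push_cast; field_simp
      rw [e1, abs_div, abs_of_pos hm']
      calc |β * m - ρ| / m < 1 / (Q * ρ.den) / m := by gcongr
        _ = 1 / (ρ.den * m * Q) := by field_simp
        _ ≤ _ := by gcongr
    have hσeq : (σ : ℝ) = σ.num / σ.den := by exact_mod_cast (Rat.num_div_den σ).symm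
    rw [hσeq, abs_lt] at hclose
    have hI := hβ.1
    have h5 : (1 : ℝ) ≤ σ.den := by exact_mod_cast σ.pos
    have h6 : 1 / (σ.den * Q) ≤ 1 / Q := by
      apply one_div_le_one_div_of_le hQ0; nlinarith
    have h7 : 1 / (σ.den * Q) + 1 / Q ≤ 1 / (σ.den : ℝ) := by
      rw [div_add_div _ _ (by positivity) hQ0.ne', div_le_div_iff₀ (by positivity) hσd]
      nlinarith [mul_pos hσd hQ0]
    have hnum0 : 0 ≤ σ.num := by
      by_contra hneg
      have h3 : (σ.num : ℝ) ≤ -1 := by exact_mod_cast (by omega : σ.num ≤ -1)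
      have h4 : (σ.num : ℝ) / σ.den ≤ -(1 / σ.den) := by
        rw [← neg_div]; gcongr
      linarith [hI.1]
    have hnum1 : σ.num < σ.den := by
      by_contra hge
      have h3 : (σ.den : ℝ) ≤ σ.num := by exact_mod_cast not_lt.1 hge
      have h4 : 1 ≤ (σ.num : ℝ) / σ.den := by rwa [le_div_iff₀ hσd, one_mul]
      linarith [hI.2]
    obtain ⟨n, hn'⟩ := Int.eq_ofNat_of_zero_le hnum0
    have hnc : ((n : ℕ) : ℝ) = σ.num := by rw [hn']; simp
    refine hβ.2 (Set.mem_iUnion₂.2 ⟨⟨σ.den, n⟩, (mem_centres (by linarith)).2 ⟨σ.pos, hσR, ?_, ?_⟩, ?_⟩)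
    · have := hnum1; rw [hn'] at this; exact_mod_cast this
    · have := σ.reduced; rw [hn'] at this; simpa using this
    · refine ⟨?_, ?_⟩
      · change (n : ℝ) / σ.den - 1 / (σ.den * Q) < β
        rw [hnc]; linarith
      · change β ≤ (n : ℝ) / σ.den + 1 / (σ.den * Q)
        rw [hnc]; linarith
  · have := Int.isCoprime_iff_gcd_eq_one.2 (show Int.gcd ρ.num ρ.den = 1 by simpa [Int.gcd] using ρ.reduced)
    exact this.neg_left
  · have hρ : (ρ : ℝ) = ρ.num / ρ.den := by exact_mod_cast (Rat.num_div_den ρ).symm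
    have e1 : ((-1 : ℤ) : ℝ) * β * m - ((-ρ.num : ℤ) : ℝ) / ρ.den = -(β * m - ρ) := by
      rw [hρ]; push_cast; ring
    rw [e1, abs_neg]
    refine hlt.le.trans ?_
    apply one_div_le_one_div_of_le (by positivity)
    nlinarith

/-- The size conditions under which the circle method is run: `P` bounds the denominators of the
major arcs and `Q` the widths of the arcs. -/
structure IsAdmissible (Y : V ℝ) (Z P Q : ℝ) (m : ℕ) : Prop where
  balanced : IsBalanced Y (Y 3 ^ 2)
  le_Z : ∀ i, Y i ≤ Z
  m_pos : 0 < m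
  one_le_P : 1 ≤ P
  -- A plane sum whose approximation has denominator about `P` is of size `Y 3 ^ 2 / (m ^ 2 * P)`;
  -- `Q` is defined to equal this.
  Q_eq : Q * ((m : ℝ) ^ 2 * P) = Y 3 ^ 2
  le_Q : 2 * (m * P) + 1 ≤ Q
  -- Ensures `r m ≤ Y i` for every denominator `r ≤ m P`.
  sq_le : ∀ i, (m : ℝ) * (m * P) ≤ Y i
  -- Equivalent to `Z / m ≤ Q`: even the longest side, in steps of `m`, does not exceed `Q`.
  Z_le : Z * (m * P) ≤ Y 3 ^ 2

/-! ### Minor arcs, major arcs and completion of the main term -/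

section

variable {Y : V ℝ} {Z P Q : ℝ} {m : ℕ}

theorem IsAdmissible.m_le (h : IsAdmissible Y Z P Q m) (i : Fin 9) : (m : ℝ) ≤ Y i := by
  have h1 : (1 : ℝ) ≤ m := by exact_mod_cast h.m_pos
  have h2 : (1 : ℝ) ≤ m * P := by nlinarith [h.one_le_P]
  nlinarith [h.sq_le i]

theorem IsAdmissible.one_le_Q (h : IsAdmissible Y Z P Q m) : 1 ≤ Q := by
  have h1 : (1 : ℝ) ≤ m := by exact_mod_cast h.m_pos
  have h2 : (1 : ℝ) ≤ m * P := by nlinarith [h.one_le_P]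
  linarith [h.le_Q]

theorem IsAdmissible.Z_div_le (h : IsAdmissible Y Z P Q m) : Z / m ≤ Q := by
  have hm : (0 : ℝ) < m := by exact_mod_cast h.m_pos
  have hP : 0 < P := by linarith [h.one_le_P]
  rw [div_le_iff₀ hm]
  have h1 := h.Z_le
  rw [← h.Q_eq] at h1
  have h2 : Q * ((m : ℝ) ^ 2 * P) = Q * m * (m * P) := by ring
  rw [h2] at h1
  exact le_of_mul_le_mul_right h1 (by positivity)

/-- Writing `u = U / m` and `w = W / m`, so that `u w = P Q`, the four terms `u w / r`, `u`, `w` and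
`r` are all at most `Q` because `P < r ≤ Q`. The constant is `36 + 12 + 12 + 4`. Only planes with
coefficient `-1` are treated, the approximation being one of `-β m`. -/
theorem norm_pairSum_le_of_mem_minor (h : IsAdmissible Y Z P Q m) {U W : ℝ} (hU : 0 < U) (hW : 0 < W)
    (hUW : U * W = Y 3 ^ 2) (hmW : (m : ℝ) ≤ W) (hUZ : U ≤ Z) (hWZ : W ≤ Z) (x₀ y₀ : ℤ) {β : ℝ}
    (hβ : β ∈ minor Q (m * P)) :
    ‖pairSum (-1) m U W x₀ y₀ β‖ ≤ 64 * (1 + Real.log Q) * Q := by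
  have hm : (0 : ℝ) < m := by exact_mod_cast h.m_pos
  have hP : 0 < P := by linarith [h.one_le_P]
  obtain ⟨a, r, hPr, hrQ, hcop, hα⟩ := exists_approx_of_mem_minor h.m_pos h.one_le_P h.le_Q hβ
  have hr1 : (1 : ℝ) < r := h.one_le_P.trans_lt hPr
  have hr2 : 2 ≤ r := by exact_mod_cast hr1
  have hr0 : (0 : ℝ) < r := by linarith
  refine (norm_pairSum_le_of_approx (-1) h.m_pos hU.le hW.le x₀ y₀ hr2 hcop hα).trans ?_
  set ℓ := 1 + Real.log Q with hℓ
  have hlog : Real.log r ≤ Real.log Q := Real.log_le_log hr0 hrQ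
  have hℓ1 : 1 ≤ ℓ := by
    have := Real.log_nonneg h.one_le_Q
    linarith
  have hw1 : 1 ≤ W / m := by rwa [le_div_iff₀ hm, one_mul]
  have huw : U / m * (W / m) = Q * P := by
    have : U / m * (W / m) = U * W / (m : ℝ) ^ 2 := by field_simp
    rw [this, hUW, ← h.Q_eq]; field_simp
  have hu : U / m ≤ Q := (by gcongr : U / m ≤ Z / m).trans h.Z_div_le
  have hw : W / m ≤ Q := (by gcongr : W / m ≤ Z / m).trans h.Z_div_le
  have hu0 : 0 < U / m := by positivity
  have hQ1 := h.one_le_Q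
  rw [mul_div_assoc 2 U, mul_div_assoc 2 W]
  set u := U / m
  set w := W / m
  have e1 : u * w / r ≤ Q := by
    rw [div_le_iff₀ hr0, huw]; gcongr
  calc (3 * (2 * u) / r + 2) * (2 * (2 * w + 1 + r * (1 + Real.log r)))
      ≤ (3 * (2 * u) / r + 2) * (2 * (2 * w + w + r * ℓ)) := by
        gcongr
        linarith
    _ = 36 * (u * w / r) + 12 * u * ℓ + 12 * w + 4 * r * ℓ := by field_simp; ring
    _ ≤ 36 * (ℓ * Q) + 12 * Q * ℓ + 12 * (ℓ * Q) + 4 * Q * ℓ := by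
        have e2 : Q ≤ ℓ * Q := by nlinarith
        gcongr
        · exact e1.trans e2
        · exact hw.trans e2
    _ = _ := by ring

theorem mean_square_le (h : IsAdmissible Y Z P Q m) {U W : ℝ} (hU : 0 < U) (hW : 0 < W)
    (hUW : U * W = Y 3 ^ 2) (hmU : (m : ℝ) ≤ U) (hmW : (m : ℝ) ≤ W) (hUZ : U ≤ Z) (hWZ : W ≤ Z)
    (x₀ y₀ : ℤ) (κ : ℝ) {D : ℝ}
    (hD : ∀ n : ℕ, n ≠ 0 → (n : ℝ) ≤ Y 3 ^ 2 → (n.divisors.card : ℝ) ≤ D) (hD0 : 0 ≤ D) :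
    ∫ β in κ..(κ + 1), ‖pairSum (-2) m U W x₀ y₀ β‖ ^ 2 ≤
      36 * (Y 3 ^ 2 * D + Z ^ 2) / (m : ℝ) ^ 2 := by
  have hm : (0 : ℝ) < m := by exact_mod_cast h.m_pos
  refine (integral_norm_pairSum_sq_le (by norm_num) h.m_pos hU.le hW.le x₀ y₀ κ
    (fun n hn hle => hD n hn (hUW ▸ hle)) hD0).trans ?_
  have hu1 : 1 ≤ U / m := by rwa [le_div_iff₀ hm, one_mul]
  have hw1 : 1 ≤ W / m := by rwa [le_div_iff₀ hm, one_mul]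
  have huw : U / m * (W / m) = Y 3 ^ 2 / (m : ℝ) ^ 2 := by rw [← hUW]; field_simp
  have hu : U / m ≤ Z / m := by gcongr
  have hw : W / m ≤ Z / m := by gcongr
  rw [mul_div_assoc 2 U, mul_div_assoc 2 W]
  calc _ ≤ (3 * (U / m)) * (3 * (W / m)) * (2 * D) + (3 * (Z / m) + 3 * (Z / m)) ^ 2 := by
        gcongr <;> linarith
    _ = 18 * (U / m * (W / m)) * D + 36 * Z ^ 2 / (m : ℝ) ^ 2 := by ring
    _ = (18 * (Y 3 ^ 2 * D) + 36 * Z ^ 2) / (m : ℝ) ^ 2 := by rw [huw]; field_simp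
    _ ≤ _ := by
        gcongr
        have : 0 ≤ Y 3 ^ 2 * D := by positivity
        linarith

/-- Pointwise bounds for the two planes with coefficient `-1` and for the square; the product of the
other two is at most half the sum of their squares, whose integrals extend to the whole circle. -/
theorem norm_integral_minor_le (h : IsAdmissible Y Z P Q m) (B₀ : V ℤ) {D : ℝ}
    (hD : ∀ n : ℕ, n ≠ 0 → (n : ℝ) ≤ Y 3 ^ 2 → (n.divisors.card : ℝ) ≤ D) (hD0 : 0 ≤ D) :
    ‖∫ β in minor Q (m * P), boxSum Y m B₀ β‖ ≤
      (64 * (1 + Real.log Q) * Q) ^ 2 * (3 * Y 3 / m) *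
        (36 * (Y 3 ^ 2 * D + Z ^ 2) / (m : ℝ) ^ 2) := by
  have hb := h.balanced
  have hm : (0 : ℝ) < m := by exact_mod_cast h.m_pos
  have hlog := Real.log_nonneg h.one_le_Q
  have hQ := h.one_le_Q
  have hV := hb.pos 3
  set S := 64 * (1 + Real.log Q) * Q with hS
  set N := 3 * Y 3 / m with hN
  set M := 36 * (Y 3 ^ 2 * D + Z ^ 2) / (m : ℝ) ^ 2 with hM
  set T₃ := pairSum (-2) m (Y 1) (Y 7) (B₀ 1) (B₀ 7)
  set T₄ := pairSum (-2) m (Y 2) (Y 5) (B₀ 2) (B₀ 5)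
  have hc₃ : Continuous T₃ := continuous_pairSum _ _ _ _ _ _
  have hc₄ : Continuous T₄ := continuous_pairSum _ _ _ _ _ _
  have hN0 : 0 ≤ N := by positivity
  have hS0 : 0 ≤ S := by positivity
  have hG : ∀ β, ‖squareSum (-2) m (Y 3) (B₀ 3) β‖ ≤ N := fun β => by
    refine (norm_squareSum_le _ h.m_pos hV.le _ _).trans ?_
    have : 1 ≤ Y 3 / m := by rw [le_div_iff₀ hm, one_mul]; exact h.m_le 3
    rw [hN, mul_div_assoc, mul_div_assoc]; linarith
  have hpt : ∀ β ∈ minor Q (m * P), ‖boxSum Y m B₀ β‖ ≤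
      S ^ 2 * N / 2 * (‖T₃ β‖ ^ 2 + ‖T₄ β‖ ^ 2) := by
    intro β hβ
    have h1 := norm_pairSum_le_of_mem_minor h (hb.pos 0) (hb.pos 8) hb.h08 (h.m_le 8) (h.le_Z 0)
      (h.le_Z 8) (B₀ 0) (B₀ 8) hβ
    have h2 := norm_pairSum_le_of_mem_minor h (hb.pos 4) (hb.pos 6) hb.h46 (h.m_le 6) (h.le_Z 4)
      (h.le_Z 6) (B₀ 4) (B₀ 6) hβ
    rw [boxSum_eq]
    simp only [norm_mul]
    calc _ ≤ S * S * ‖T₃ β‖ * ‖T₄ β‖ * N := by gcongr; exact hG β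
      _ = S ^ 2 * N / 2 * (2 * ‖T₃ β‖ * ‖T₄ β‖) := by ring
      _ ≤ _ := by gcongr; exact two_mul_le_add_sq _ _
  have hcont : Continuous fun β => S ^ 2 * N / 2 * (‖T₃ β‖ ^ 2 + ‖T₄ β‖ ^ 2) := by fun_prop
  have hi : IntegrableOn (fun β => S ^ 2 * N / 2 * (‖T₃ β‖ ^ 2 + ‖T₄ β‖ ^ 2))
      (Set.Ioc (-(1 / Q)) (-(1 / Q) + 1)) := hcont.integrableOn_Ioc
  calc ‖∫ β in minor Q (m * P), boxSum Y m B₀ β‖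
      ≤ ∫ β in minor Q (m * P), S ^ 2 * N / 2 * (‖T₃ β‖ ^ 2 + ‖T₄ β‖ ^ 2) := by
        refine norm_integral_le_of_norm_le (hi.mono_set (minor_subset _ _)) ?_
        filter_upwards [ae_restrict_mem (measurableSet_minor _ _)] with β hβ using hpt β hβ
    _ ≤ ∫ β in Set.Ioc (-(1 / Q)) (-(1 / Q) + 1), S ^ 2 * N / 2 * (‖T₃ β‖ ^ 2 + ‖T₄ β‖ ^ 2) := by
        refine setIntegral_mono_set hi ?_ (Eventually.of_forall (minor_subset _ _))
        exact Eventually.of_forall fun β => by positivity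
    _ = S ^ 2 * N / 2 * ((∫ β in (-(1 / Q))..(-(1 / Q) + 1), ‖T₃ β‖ ^ 2) +
          ∫ β in (-(1 / Q))..(-(1 / Q) + 1), ‖T₄ β‖ ^ 2) := by
        rw [← intervalIntegral.integral_of_le (by linarith), intervalIntegral.integral_const_mul,
          intervalIntegral.integral_add] <;> exact Continuous.intervalIntegrable (by fun_prop) _ _
    _ ≤ S ^ 2 * N / 2 * (M + M) := by
        gcongr
        · exact mean_square_le h (hb.pos 1) (hb.pos 7) hb.h17 (h.m_le 1) (h.m_le 7) (h.le_Z 1)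
            (h.le_Z 7) _ _ _ hD hD0
        · exact mean_square_le h (hb.pos 2) (hb.pos 5) hb.h25 (h.m_le 2) (h.m_le 5) (h.le_Z 2)
            (h.le_Z 5) _ _ _ hD hD0
    _ = S ^ 2 * N * M := by ring

theorem norm_major_sub_le (h : IsAdmissible Y Z P Q m) (B₀ : V ℤ) :
    ‖∑ r ∈ Icc 1 ⌊(m : ℝ) * P⌋₊, ∑ a ∈ (range r).filter (fun a => Nat.gcd a r = 1),
        (∫ θ in (-(1 / (r * Q)))..(1 / (r * Q)), boxSum Y m B₀ (a / r + θ)) -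
      ∑ r ∈ Icc 1 ⌊(m : ℝ) * P⌋₊, ∑ a ∈ (range r).filter (fun a => Nat.gcd a r = 1),
        1 / ((r * m : ℕ) : ℂ) ^ 9 * fullRes m r a B₀ *
          ∫ θ in (-(1 / (r * Q)))..(1 / (r * Q)), boxIntegral Y (θ / m)‖ ≤
      6000000 * (m * P) ^ 2 * Z * Y 3 ^ 7 / (Q * (m : ℝ) ^ 8) := by
  have hb := h.balanced
  have hm : (0 : ℝ) < m := by exact_mod_cast h.m_pos
  have hP : 0 < P := by linarith [h.one_le_P]
  have hQ : 0 < Q := by linarith [h.one_le_Q]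
  have hV := hb.pos 3
  have hZ : 0 < Z := hV.trans_le (h.le_Z 3)
  set K := 3000000 * (m * P) * Z * Y 3 ^ 7 / (m : ℝ) ^ 8 with hK
  have hK0 : 0 ≤ K := by positivity
  have hterm : ∀ r ∈ Icc 1 ⌊(m : ℝ) * P⌋₊, ∀ a : ℕ,
      ‖(∫ θ in (-(1 / (r * Q)))..(1 / (r * Q)), boxSum Y m B₀ (a / r + θ)) -
        1 / ((r * m : ℕ) : ℂ) ^ 9 * fullRes m r a B₀ *
          ∫ θ in (-(1 / (r * Q)))..(1 / (r * Q)), boxIntegral Y (θ / m)‖ ≤ K * (2 / (r * Q)) := by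
    intro r hr a
    rw [mem_Icc, Nat.le_floor_iff (by positivity)] at hr
    have hr0 : 0 < r := hr.1
    have hr' : (0 : ℝ) < r := by exact_mod_cast hr0
    have hpos : 0 < 1 / ((r : ℝ) * Q) := by positivity
    have hrm : ∀ i, ((r * m : ℕ) : ℝ) ≤ Y i := fun i => by
      refine le_trans ?_ (h.sq_le i)
      push_cast
      rw [mul_comm (r : ℝ)]
      gcongr
      exact hr.2
    have hcB := continuous_boxSum Y m B₀
    have hcI := continuous_boxIntegral Y
    rw [← intervalIntegral.integral_const_mul, ← intervalIntegral.integral_sub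
      (Continuous.intervalIntegrable (by fun_prop) _ _)
      (Continuous.intervalIntegrable (by fun_prop) _ _)]
    refine (intervalIntegral.norm_integral_le_of_norm_le_const (C := K) fun θ hθ => ?_).trans
      (le_of_eq ?_)
    · rw [Set.uIoc_of_le (by linarith)] at hθ
      refine (norm_boxSum_sub_le hb h.le_Z h.m_pos hr0 hrm a B₀ θ).trans ?_
      have hθ' : |θ| ≤ 1 / (r * Q) := abs_le.2 ⟨hθ.1.le, hθ.2⟩
      -- At the edge of the arc `Y 3 ^ 2 |θ| r / m` equals `Y 3 ^ 2 / (Q m) = m P`, so the parameter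
      -- of the approximation is at most `r + m P ≤ 2 m P`.
      have hρ : (r : ℝ) * (1 + Y 3 ^ 2 * |θ| / m) ≤ 2 * (m * P) := by
        calc (r : ℝ) * (1 + Y 3 ^ 2 * |θ| / m) ≤ r * (1 + Y 3 ^ 2 * (1 / (r * Q)) / m) := by gcongr
          _ = r + m * P := by rw [← h.Q_eq]; field_simp
          _ ≤ _ := by linarith [hr.2]
      calc _ ≤ 1500000 * (2 * (m * P)) * Z * Y 3 ^ 7 / (m : ℝ) ^ 8 := by gcongr
        _ = K := by rw [hK]; ring
    · rw [sub_neg_eq_add, abs_of_pos (by linarith)]; ring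
  rw [← sum_sub_distrib]
  simp_rw [← sum_sub_distrib]
  calc _ ≤ ∑ r ∈ Icc 1 ⌊(m : ℝ) * P⌋₊, ∑ a ∈ (range r).filter (fun a => Nat.gcd a r = 1),
        K * (2 / (r * Q)) := by
        refine (norm_sum_le _ _).trans (sum_le_sum fun r hr => ?_)
        exact (norm_sum_le _ _).trans (sum_le_sum fun a _ => hterm r hr a)
    _ ≤ ∑ r ∈ Icc 1 ⌊(m : ℝ) * P⌋₊, K * (2 / Q) := by
        refine sum_le_sum fun r hr => ?_
        have hr' : (0 : ℝ) < r := by exact_mod_cast (mem_Icc.1 hr).1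
        rw [sum_const, nsmul_eq_mul]
        have : (((range r).filter fun a => Nat.gcd a r = 1).card : ℝ) ≤ r := by
          exact_mod_cast (card_filter_le _ _).trans (card_range r).le
        calc _ ≤ (r : ℝ) * (K * (2 / (r * Q))) := by gcongr
          _ = _ := by field_simp
    _ ≤ (m * P) * (K * (2 / Q)) := by
        rw [sum_const, nsmul_eq_mul, Nat.card_Icc, Nat.add_sub_cancel]
        gcongr
        exact Nat.floor_le (by positivity)
    _ = _ := by rw [hK]; field_simp; norm_num

/-- The `r ^ 9` of the complete sum cancels, and the substitution `θ ↦ m θ` supplies the factor `m`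
that turns `m ^ (-9)` into `m ^ (-8)`. -/
theorem main_term_eq (h : IsAdmissible Y Z P Q m) (hodd : Odd m) {B₀ : V ℤ} (h₀ : (m : ℤ) ∣ q B₀)
    (hB : ∀ p : ℕ, p.Prime → p ∣ m → ∃ i, ¬ (p : ℤ) ∣ B₀ i) :
    ∑ r ∈ Icc 1 ⌊(m : ℝ) * P⌋₊, ∑ a ∈ (range r).filter (fun a => Nat.gcd a r = 1),
        1 / ((r * m : ℕ) : ℂ) ^ 9 * fullRes m r a B₀ *
          ∫ θ in (-(1 / (r * Q)))..(1 / (r * Q)), boxIntegral Y (θ / m) =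
      1 / (m : ℂ) ^ 8 * ∑ r ∈ Icc 1 ⌊(m : ℝ) * P⌋₊, (if r.Coprime m then C r else 0) *
        ∫ θ in (-(1 / (r * Q) / m))..(1 / (r * Q) / m), boxIntegral Y θ := by
  have hm : (m : ℝ) ≠ 0 := by exact_mod_cast h.m_pos.ne'
  have hmc : (m : ℂ) ≠ 0 := by exact_mod_cast h.m_pos.ne'
  rw [mul_sum]
  refine sum_congr rfl fun r hr => ?_
  have hr0 : r ≠ 0 := by have := (mem_Icc.1 hr).1; omega
  have : NeZero r := ⟨hr0⟩
  have hrc : (r : ℂ) ≠ 0 := by exact_mod_cast hr0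
  rw [← sum_mul, ← mul_sum]
  unfold fullRes
  rw [sum_residues_eq r hodd B₀ h₀ hB, intervalIntegral.integral_comp_div _ hm, neg_div,
    Complex.real_smul]
  push_cast
  field_simp

theorem norm_tsum_sub_sum_le {c : ℕ → ℂ} (hc : ∀ r, ‖c r‖ ≤ ‖C r‖) {n : ℕ} (hn : 1 ≤ n) :
    ‖∑' r, c r - ∑ r ∈ Icc 1 n, c r‖ ≤ 2 / (n * (n + 1) : ℝ) := by
  have hsum : Summable c :=
    (Summable.of_nonneg_of_le (fun _ => norm_nonneg _) hc summable_norm_C).of_norm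
  have h1 : ∑ r ∈ Icc 1 n, c r = ∑ r ∈ range (n + 1), c r := by
    refine sum_subset (fun r hr => ?_) fun r hr hr' => ?_
    · rw [mem_Icc] at hr; rw [mem_range]; omega
    · have h0 : r = 0 := by rw [mem_Icc] at hr'; rw [mem_range] at hr; omega
      have := hc 0
      rwa [C_zero, norm_zero, norm_le_zero_iff, ← h0] at this
  have hs : Summable fun i => ‖C (i + (n + 1))‖ :=
    summable_norm_C.comp_injective (add_left_injective (n + 1))
  have hs' : Summable fun i => ‖c (i + (n + 1))‖ :=
    Summable.of_nonneg_of_le (fun _ => norm_nonneg _) (fun i => hc _) hs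
  rw [h1, ← hsum.sum_add_tsum_nat_add (n + 1), add_sub_cancel_left]
  exact (norm_tsum_le_tsum_norm hs').trans ((hs'.tsum_le_tsum (fun i => hc _) hs).trans
    (tsum_tail_le n hn))

theorem norm_coprimeSeries_sub_le (m : ℕ) {n : ℕ} (hn : 1 ≤ n) :
    ‖coprimeSeries m - ∑ r ∈ Icc 1 n, (if r.Coprime m then C r else 0)‖ ≤
      2 / (n * (n + 1) : ℝ) :=
  norm_tsum_sub_sum_le (fun r => by split_ifs <;> simp) hn

/-- Cutting the singular integral at `1 / (r Q m)` costs a multiple of `(r Q m) ^ 2`. Against `‖C r‖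
≤ 4 / r ^ 3` this leaves `1 / r`, whose sum is the logarithm. The tail of the series costs `4 / (m
P) ^ 2` times the bound for the singular integral. -/
theorem norm_main_sub_le (h : IsAdmissible Y Z P Q m) :
    ‖∑ r ∈ Icc 1 ⌊(m : ℝ) * P⌋₊, (if r.Coprime m then C r else 0) *
        (∫ θ in (-(1 / (r * Q) / m))..(1 / (r * Q) / m), boxIntegral Y θ) -
      coprimeSeries m * singularIntegral Y‖ ≤
      5000000 * Y 3 ^ 7 * (1 + Real.log (m * P)) / (m * P) ^ 2 := by
  have hb := h.balanced
  have hm : (0 : ℝ) < m := by exact_mod_cast h.m_pos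
  have hm1 : (1 : ℝ) ≤ m := by exact_mod_cast h.m_pos
  have hP : 0 < P := by linarith [h.one_le_P]
  have hQ : 0 < Q := by linarith [h.one_le_Q]
  have hV := hb.pos 3
  set R := (m : ℝ) * P with hR
  have hR1 : 1 ≤ R := by nlinarith [h.one_le_P]
  set n := ⌊R⌋₊ with hn
  have hn1 : 1 ≤ n := Nat.le_floor (by simpa using hR1)
  have hnR : (n : ℝ) ≤ R := Nat.floor_le (by linarith)
  have hRn : R < n + 1 := Nat.lt_floor_add_one R
  set c : ℕ → ℂ := fun r => if r.Coprime m then C r else 0 with hc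
  have hcC : ∀ r, ‖c r‖ ≤ ‖C r‖ := fun r => by simp only [hc]; split_ifs <;> simp
  have htail : ‖coprimeSeries m - ∑ r ∈ Icc 1 n, c r‖ ≤ 4 / R ^ 2 := by
    refine (norm_coprimeSeries_sub_le m hn1).trans ?_
    have hn1' : (1 : ℝ) ≤ n := by exact_mod_cast hn1
    rw [div_le_div_iff₀ (by positivity) (by positivity)]
    nlinarith
  have hS := norm_singularIntegral_le hb
  have hterm : ∀ r ∈ Icc 1 n, ‖c r * (∫ θ in (-(1 / (r * Q) / m))..(1 / (r * Q) / m), boxIntegral Y θ) -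
      c r * singularIntegral Y‖ ≤ 524288 * Y 3 ^ 7 / R ^ 2 * (1 / r) := by
    intro r hr
    have hr' : (0 : ℝ) < r := by exact_mod_cast (mem_Icc.1 hr).1
    rw [← mul_sub, norm_mul, norm_sub_rev (∫ θ in _.._, _)]
    calc _ ≤ 4 / (r : ℝ) ^ 3 * (131072 * Y 3 ^ 2 * Y 3 / (1 / (r * Q) / m) ^ 2) := by
          gcongr
          · exact (hcC r).trans (norm_C_le r)
          · exact norm_singularIntegral_sub_le hb (by positivity)
      _ = 524288 * Y 3 ^ 3 * (Q * m) ^ 2 * (1 / r) := by field_simp; ring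
      _ = _ := by
          have : Q * m = Y 3 ^ 2 / R := by
            rw [hR, ← h.Q_eq]; field_simp
          rw [this]; field_simp
  have hharm : ∑ r ∈ Icc 1 n, (1 : ℝ) / r ≤ 1 + Real.log R := by
    have h1 : ∑ r ∈ Icc 1 n, (1 : ℝ) / r = (harmonic n : ℝ) := by
      rw [harmonic_eq_sum_Icc, Rat.cast_sum]
      refine sum_congr rfl fun r _ => ?_
      push_cast; rw [one_div]
    rw [h1]
    refine (harmonic_le_one_add_log n).trans ?_
    have : Real.log n ≤ Real.log R := Real.log_le_log (by exact_mod_cast hn1) hnR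
    linarith
  have heq : ∑ r ∈ Icc 1 n, c r * (∫ θ in (-(1 / (r * Q) / m))..(1 / (r * Q) / m), boxIntegral Y θ) -
      coprimeSeries m * singularIntegral Y =
      ∑ r ∈ Icc 1 n, (c r * (∫ θ in (-(1 / (r * Q) / m))..(1 / (r * Q) / m), boxIntegral Y θ) -
        c r * singularIntegral Y) -
        (coprimeSeries m - ∑ r ∈ Icc 1 n, c r) * singularIntegral Y := by
    rw [sum_sub_distrib, ← sum_mul]; ring
  rw [heq]
  have hlogR := Real.log_nonneg hR1
  calc _ ≤ ∑ r ∈ Icc 1 n, 524288 * Y 3 ^ 7 / R ^ 2 * (1 / (r : ℝ)) +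
        4 / R ^ 2 * (262144 * Real.pi * (Y 3 ^ 2) ^ 3 * Y 3) := by
        refine (norm_sub_le _ _).trans (add_le_add ?_ ?_)
        · exact (norm_sum_le _ _).trans (sum_le_sum hterm)
        · rw [norm_mul]; gcongr
    _ ≤ 524288 * Y 3 ^ 7 / R ^ 2 * (1 + Real.log R) +
        4 / R ^ 2 * (262144 * 4 * (Y 3 ^ 2) ^ 3 * Y 3) * (1 + Real.log R) := by
        rw [← mul_sum]
        refine add_le_add (by gcongr) ?_
        calc _ ≤ 4 / R ^ 2 * (262144 * 4 * (Y 3 ^ 2) ^ 3 * Y 3) * 1 := by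
              rw [mul_one]; gcongr; exact Real.pi_le_four
          _ ≤ _ := mul_le_mul_of_nonneg_left (by linarith) (by positivity)
    _ = 4718592 * Y 3 ^ 7 * (1 + Real.log R) / R ^ 2 := by ring
    _ ≤ _ := by gcongr; norm_num

theorem norm_count_sub_le (h : IsAdmissible Y Z P Q m) (hodd : Odd m) {B₀ : V ℤ}
    (h₀ : (m : ℤ) ∣ q B₀) (hB : ∀ p : ℕ, p.Prime → p ∣ m → ∃ i, ¬ (p : ℤ) ∣ B₀ i) {D : ℝ}
    (hD : ∀ n : ℕ, n ≠ 0 → (n : ℝ) ≤ Y 3 ^ 2 → (n.divisors.card : ℝ) ≤ D) (hD0 : 0 ≤ D) :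
    ‖(count Y m B₀ : ℂ) - 1 / (m : ℂ) ^ 8 * (coprimeSeries m * singularIntegral Y)‖ ≤
      (64 * (1 + Real.log Q) * Q) ^ 2 * (3 * Y 3 / m) *
        (36 * (Y 3 ^ 2 * D + Z ^ 2) / (m : ℝ) ^ 2) +
      6000000 * (m * P) ^ 2 * Z * Y 3 ^ 7 / (Q * (m : ℝ) ^ 8) +
      1 / (m : ℝ) ^ 8 * (5000000 * Y 3 ^ 7 * (1 + Real.log (m * P)) / (m * P) ^ 2) := by
  have hR1 : (1 : ℝ) ≤ m * P := by
    have hm1 : (1 : ℝ) ≤ m := by exact_mod_cast h.m_pos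
    nlinarith [h.one_le_P]
  have h1 := norm_integral_minor_le h B₀ hD hD0
  have h2 := norm_major_sub_le h B₀
  rw [main_term_eq h hodd h₀ hB] at h2
  have h3 := norm_main_sub_le h
  rw [count_eq_integral Y h.m_pos h₀ (-(1 / Q)),
    integral_eq_major_add_minor h.le_Q hR1 (continuous_boxSum Y m B₀)]
  set J := ∑ r ∈ Icc 1 ⌊(m : ℝ) * P⌋₊, ∑ a ∈ (range r).filter (fun a => Nat.gcd a r = 1),
        (∫ θ in (-(1 / (r * Q)))..(1 / (r * Q)), boxSum Y m B₀ (a / r + θ))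
  set S := ∑ r ∈ Icc 1 ⌊(m : ℝ) * P⌋₊, (if r.Coprime m then C r else 0) *
        (∫ θ in (-(1 / (r * Q) / m))..(1 / (r * Q) / m), boxIntegral Y θ)
  set I := ∫ β in minor Q (m * P), boxSum Y m B₀ β
  have heq : J + I - 1 / (m : ℂ) ^ 8 * (coprimeSeries m * singularIntegral Y) =
      I + (J - 1 / (m : ℂ) ^ 8 * S) +
        1 / (m : ℂ) ^ 8 * (S - coprimeSeries m * singularIntegral Y) := by ring
  rw [heq]
  refine (norm_add₃_le).trans (add_le_add (add_le_add h1 h2) ?_)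
  rw [norm_mul, norm_div, norm_one, norm_pow, Complex.norm_natCast]
  gcongr

end

/-! ### The numerical choice of parameters -/

theorem count_le {Y : V ℝ} (hY : ∀ i, 0 ≤ Y i) {m : ℕ} (hm : 0 < m) {B₀ : V ℤ}
    (h₀ : (m : ℤ) ∣ q B₀) : (count Y m B₀ : ℝ) ≤ ∏ i, (2 * Y i / m + 1) := by
  have h1 : ‖(count Y m B₀ : ℂ)‖ ≤ (Fintype.piFinset fun i => prog (Y i) m (B₀ i)).card := by
    rw [count_eq_integral Y hm h₀ 0]
    refine (intervalIntegral.norm_integral_le_of_norm_le_const fun β _ =>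
      norm_sum_e_le_card _ _).trans (le_of_eq ?_)
    simp
  rw [Complex.norm_natCast, Fintype.card_piFinset, Nat.cast_prod] at h1
  exact h1.trans (prod_le_prod (fun _ _ => by positivity) fun i _ => card_prog_le (hY i) hm _)

theorem norm_coprimeSeries_le (m : ℕ) : ‖coprimeSeries m‖ ≤ ∑' r, ‖C r‖ := by
  refine (norm_tsum_le_tsum_norm (summable_norm_coprime m)).trans
    ((summable_norm_coprime m).tsum_le_tsum (fun r => ?_) summable_norm_C)
  split_ifs <;> simp

/-- Lets each logarithm be paid for by a single factor `t = X ^ (1/600)`. -/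
theorem one_add_log_le {x a t : ℝ} {k : ℕ} (hx : 0 < x) (ha : 0 < a) (ht : 1 ≤ t)
    (h : x ≤ a * t ^ k) : 1 + Real.log x ≤ (1 + a + k) * t := by
  have ht0 : 0 < t := by linarith
  have h1 : Real.log x ≤ Real.log a + k * Real.log t := by
    rw [← Real.log_pow, ← Real.log_mul ha.ne' (by positivity)]
    exact Real.log_le_log hx h
  have h2 : Real.log a ≤ a := by linarith [Real.log_le_sub_one_of_pos ha]
  have h3 : Real.log t ≤ t := by linarith [Real.log_le_sub_one_of_pos ht0]
  have h4 : k * Real.log t ≤ k * t := by gcongr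
  nlinarith

section

variable {c₁ c₂ c₃ D s t : ℝ}

/-- In units of `t = X ^ (1/600)` and `s = √m`, the exponents are `2 (1 + 1140) + 600 + 1224 = 4106`
for `t` and `-14` for `s`. The target `4110` is `6.85 * 600`. -/
theorem minor_error_le (h₁ : 0 < c₁) (h₂ : 0 < c₂) (hD : 0 < D) (hs : 1 ≤ s) (ht : 1 ≤ t)
    {ℓ : ℝ} (hℓ0 : 0 ≤ ℓ) (hℓ : ℓ ≤ (1 + c₂ ^ 2 + (1140 : ℕ)) * t) :
    (64 * ℓ * (c₂ ^ 2 * t ^ 1140 / s ^ 4)) ^ 2 * (3 * (c₂ * t ^ 600) / s ^ 2) *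
        (36 * ((c₂ * t ^ 600) ^ 2 * (D * t ^ 12) + (c₁ * t ^ 612) ^ 2) / (s ^ 2) ^ 2) ≤
      ((64 * (1141 + c₂ ^ 2) * c₂ ^ 2) ^ 2 * (3 * c₂) * (36 * (c₂ ^ 2 * D + c₁ ^ 2))) *
        (t ^ 4110 / s ^ 11) := by
  have hs0 : 0 < s := by linarith
  have ht0 : 0 < t := by linarith
  have hℓ' : ℓ ≤ (1141 + c₂ ^ 2) * t := hℓ.trans_eq (by push_cast; ring)
  have e1 : (c₂ * t ^ 600) ^ 2 * (D * t ^ 12) ≤ c₂ ^ 2 * D * t ^ 1224 := by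
    have : t ^ 1212 ≤ t ^ 1224 := pow_le_pow_right₀ ht (by norm_num)
    calc _ = c₂ ^ 2 * D * t ^ 1212 := by ring
      _ ≤ _ := by gcongr
  calc _ ≤ (64 * ((1141 + c₂ ^ 2) * t) * (c₂ ^ 2 * t ^ 1140 / s ^ 4)) ^ 2 *
        (3 * (c₂ * t ^ 600) / s ^ 2) *
        (36 * (c₂ ^ 2 * D * t ^ 1224 + (c₁ * t ^ 612) ^ 2) / (s ^ 2) ^ 2) := by gcongr
    _ = ((64 * (1141 + c₂ ^ 2) * c₂ ^ 2) ^ 2 * (3 * c₂) * (36 * (c₂ ^ 2 * D + c₁ ^ 2))) *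
        (t ^ 4106 / s ^ 14) := by ring
    _ ≤ _ := by
        gcongr <;> first | assumption | norm_num

/-- The bound is `t ^ 3792 / s ^ 8`. Reaching `s ^ 11` in the denominator costs `s ^ 3`, a constant
times `t ^ 300`; the hypothesis `m ≤ c₃ X ^ (1/3)` is spent here. -/
theorem major_error_le (h₁ : 0 < c₁) (h₂ : 0 < c₂) (h₃ : 0 < c₃) (hs : 1 ≤ s) (ht : 1 ≤ t)
    (hst : s ≤ (1 + c₃) * t ^ 100) :
    6000000 * (s ^ 2 * t ^ 60) ^ 2 * (c₁ * t ^ 612) * (c₂ * t ^ 600) ^ 7 /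
        ((c₂ ^ 2 * t ^ 1140 / s ^ 4) * (s ^ 2) ^ 8) ≤
      (6000000 * c₁ * c₂ ^ 5 * (1 + c₃) ^ 3) * (t ^ 4110 / s ^ 11) := by
  have hs0 : 0 < s := by linarith
  have ht0 : 0 < t := by linarith
  calc _ = (6000000 * c₁ * c₂ ^ 5) * (s ^ 3 * t ^ 3792 / s ^ 11) := by field_simp
    _ ≤ (6000000 * c₁ * c₂ ^ 5) * (((1 + c₃) * t ^ 100) ^ 3 * t ^ 3792 / s ^ 11) := by gcongr
    _ = (6000000 * c₁ * c₂ ^ 5 * (1 + c₃) ^ 3) * (t ^ 4092 / s ^ 11) := by ring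
    _ ≤ _ := by
        gcongr ; norm_num

theorem series_error_le (h₂ : 0 < c₂) (hs : 1 ≤ s) (ht : 1 ≤ t)
    {ℓ : ℝ} (hℓ : ℓ ≤ (1 + c₃ + (260 : ℕ)) * t) (h₃ : 0 < c₃) :
    1 / (s ^ 2) ^ 8 * (5000000 * (c₂ * t ^ 600) ^ 7 * ℓ / (s ^ 2 * t ^ 60) ^ 2) ≤
      (5000000 * c₂ ^ 7 * (261 + c₃)) * (t ^ 4110 / s ^ 11) := by
  have hs0 : 0 < s := by linarith
  have ht0 : 0 < t := by linarith
  have hℓ' : ℓ ≤ (261 + c₃) * t := hℓ.trans_eq (by push_cast; ring)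
  calc _ ≤ 1 / (s ^ 2) ^ 8 * (5000000 * (c₂ * t ^ 600) ^ 7 * ((261 + c₃) * t) /
        (s ^ 2 * t ^ 60) ^ 2) := by gcongr
    _ = (5000000 * c₂ ^ 7 * (261 + c₃)) * (t ^ 4081 / s ^ 20) := by field_simp
    _ ≤ _ := by
        gcongr <;> first | assumption | norm_num

/-- Each condition holds with powers of `t` to spare, so the lower bounds on `t` serve only to
absorb the constants `c₁`, `c₂`, `c₃`. -/
theorem isAdmissible (h₁ : 0 < c₁) (h₂ : 0 < c₂) (h₃ : 0 < c₃) (hs : 1 ≤ s) (ht : 1 ≤ t)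
    {Y : V ℝ} {m : ℕ} (hb : IsBalanced Y (Y 3 ^ 2))
    (hY : ∀ i, c₁⁻¹ * t ^ 588 ≤ Y i ∧ Y i ≤ c₁ * t ^ 612) (hY3 : Y 3 = c₂ * t ^ 600)
    (hsm : s ^ 2 = m) (hst : s ^ 2 ≤ c₃ * t ^ 200) (ht₁ : c₁ * c₃ ^ 2 ≤ t)
    (ht₂ : c₁ * c₃ / c₂ ^ 2 ≤ t) (ht₃ : 3 * c₃ ^ 3 / c₂ ^ 2 ≤ t) :
    IsAdmissible Y (c₁ * t ^ 612) (t ^ 60) (c₂ ^ 2 * t ^ 1140 / s ^ 4) m := by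
  have hs0 : 0 < s := by linarith
  have ht0 : 0 < t := by linarith
  have hm : 0 < m := by
    have : (0 : ℝ) < m := hsm ▸ by positivity
    exact_mod_cast this
  have hP : 1 ≤ t ^ 60 := one_le_pow₀ ht
  have hs2 : 1 ≤ s ^ 2 := one_le_pow₀ hs
  refine ⟨hb, fun i => (hY i).2, hm, hP, ?_, ?_, fun i => le_trans ?_ (hY i).1, ?_⟩
  · rw [hY3, ← hsm]; field_simp
  · rw [← hsm]
    have h1 : 1 ≤ s ^ 2 * t ^ 60 := one_le_mul_of_one_le_of_one_le hs2 hP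
    have h2 : 3 * (s ^ 2 * t ^ 60) ≤ c₂ ^ 2 * t ^ 1140 / s ^ 4 := by
      rw [le_div_iff₀ (by positivity)]
      calc 3 * (s ^ 2 * t ^ 60) * s ^ 4 = 3 * (s ^ 2) ^ 3 * t ^ 60 := by ring
        _ ≤ 3 * (c₃ * t ^ 200) ^ 3 * t ^ 60 := by gcongr
        _ = c₂ ^ 2 * (3 * c₃ ^ 3 / c₂ ^ 2 * t ^ 660) := by field_simp
        _ ≤ c₂ ^ 2 * (t * t ^ 660) := by gcongr
        _ = c₂ ^ 2 * t ^ 661 := by ring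
        _ ≤ _ := by gcongr ; norm_num
    linarith
  · rw [← hsm, inv_mul_eq_div, le_div_iff₀ h₁]
    calc s ^ 2 * (s ^ 2 * t ^ 60) * c₁ = (s ^ 2) ^ 2 * t ^ 60 * c₁ := by ring
      _ ≤ (c₃ * t ^ 200) ^ 2 * t ^ 60 * c₁ := by gcongr
      _ = c₁ * c₃ ^ 2 * t ^ 460 := by ring
      _ ≤ t * t ^ 460 := by gcongr
      _ = t ^ 461 := by ring
      _ ≤ _ := by gcongr ; norm_num
  · rw [← hsm, hY3]
    calc c₁ * t ^ 612 * (s ^ 2 * t ^ 60) ≤ c₁ * t ^ 612 * (c₃ * t ^ 200 * t ^ 60) := by gcongr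
      _ = c₂ ^ 2 * (c₁ * c₃ / c₂ ^ 2 * t ^ 872) := by field_simp
      _ ≤ c₂ ^ 2 * (t * t ^ 872) := by gcongr
      _ = c₂ ^ 2 * t ^ 873 := by ring
      _ ≤ c₂ ^ 2 * t ^ 1200 := by gcongr ; norm_num
      _ = _ := by ring

/-- The asymptotic formula for boxes of large size, with `X = t ^ 600` and `m = s ^ 2`. -/
theorem norm_count_sub_le_of_large (h₁ : 0 < c₁) (h₂ : 0 < c₂) (h₃ : 0 < c₃) :
    ∃ K : ℝ, 0 < K ∧ ∀ (s t : ℝ) (Y : V ℝ) (m : ℕ) (B₀ : V ℤ), 1 ≤ s → 1 ≤ t →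
      c₁ * c₃ ^ 2 ≤ t → c₁ * c₃ / c₂ ^ 2 ≤ t → 3 * c₃ ^ 3 / c₂ ^ 2 ≤ t →
      IsBalanced Y (Y 3 ^ 2) → (∀ i, c₁⁻¹ * t ^ 588 ≤ Y i ∧ Y i ≤ c₁ * t ^ 612) →
      Y 3 = c₂ * t ^ 600 → s ^ 2 = m → s ^ 2 ≤ c₃ * t ^ 200 → s ≤ (1 + c₃) * t ^ 100 → Odd m →
      (m : ℤ) ∣ q B₀ → (∀ p : ℕ, p.Prime → p ∣ m → ∃ i, ¬ (p : ℤ) ∣ B₀ i) →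
      ‖(count Y m B₀ : ℂ) - 1 / (m : ℂ) ^ 8 * (coprimeSeries m * singularIntegral Y)‖ ≤
        K * (t ^ 4110 / s ^ 11) := by
  obtain ⟨D₀, hD₀, hdiv⟩ := exists_card_divisors_le (ε := 1 / 100) (by norm_num)
  set D := D₀ * (c₂ ^ 2) ^ (1 / 100 : ℝ) with hD
  have hDpos : 0 < D := by positivity
  refine ⟨(64 * (1141 + c₂ ^ 2) * c₂ ^ 2) ^ 2 * (3 * c₂) * (36 * (c₂ ^ 2 * D + c₁ ^ 2)) +
    6000000 * c₁ * c₂ ^ 5 * (1 + c₃) ^ 3 + 5000000 * c₂ ^ 7 * (261 + c₃), by positivity,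
    fun s t Y m B₀ hs ht ht₁ ht₂ ht₃ hb hY hY3 hsm hst hst' hodd h₀ hB => ?_⟩
  have hs0 : 0 < s := by linarith
  have ht0 : 0 < t := by linarith
  have hadm := isAdmissible h₁ h₂ h₃ hs ht hb hY hY3 hsm hst ht₁ ht₂ ht₃
  have hDt : ∀ n : ℕ, n ≠ 0 → (n : ℝ) ≤ Y 3 ^ 2 → (n.divisors.card : ℝ) ≤ D * t ^ 12 := by
    intro n hn hle
    refine (hdiv n hn).trans ?_
    rw [hY3] at hle
    calc D₀ * (n : ℝ) ^ (1 / 100 : ℝ) ≤ D₀ * (c₂ ^ 2 * t ^ 1200) ^ (1 / 100 : ℝ) := by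
          gcongr
          exact hle.trans_eq (by ring)
      _ = _ := by
          rw [Real.mul_rpow (by positivity) (by positivity), ← Real.rpow_natCast t 1200,
            ← Real.rpow_mul ht0.le, hD, mul_assoc, ← Real.rpow_natCast t 12]
          norm_num
  refine (norm_count_sub_le hadm hodd h₀ hB hDt (by positivity)).trans ?_
  have hQ : 1 + Real.log (c₂ ^ 2 * t ^ 1140 / s ^ 4) ≤ (1 + c₂ ^ 2 + (1140 : ℕ)) * t := by
    refine one_add_log_le (by positivity) (by positivity) ht (div_le_self (by positivity) ?_)
    exact one_le_pow₀ hs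
  have hQ0 := Real.log_nonneg hadm.one_le_Q
  have hR : 1 + Real.log (s ^ 2 * t ^ 60) ≤ (1 + c₃ + (260 : ℕ)) * t := by
    refine one_add_log_le (by positivity) (by positivity) ht ?_
    calc s ^ 2 * t ^ 60 ≤ c₃ * t ^ 200 * t ^ 60 := by gcongr
      _ = _ := by ring
  rw [← hsm, hY3]
  refine (add_le_add (add_le_add (minor_error_le h₁ h₂ hDpos hs ht (by linarith) hQ)
    (major_error_le h₁ h₂ h₃ hs ht hst')) (series_error_le h₂ hs ht hR h₃)).trans ?_
  rw [← add_mul, ← add_mul]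

/-- The trivial bound for boxes of bounded size. -/
theorem norm_count_sub_le_of_small (h₁ : 0 < c₁) (h₂ : 0 < c₂) (h₃ : 0 < c₃) (T : ℝ) :
    ∃ K : ℝ, 0 < K ∧ ∀ (s t : ℝ) (Y : V ℝ) (m : ℕ) (B₀ : V ℤ), 1 ≤ s → 1 ≤ t → t ≤ T →
      IsBalanced Y (Y 3 ^ 2) → (∀ i, Y i ≤ c₁ * t ^ 612) →
      Y 3 = c₂ * t ^ 600 → s ^ 2 = m → s ≤ (1 + c₃) * t ^ 100 → (m : ℤ) ∣ q B₀ →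
      ‖(count Y m B₀ : ℂ) - 1 / (m : ℂ) ^ 8 * (coprimeSeries m * singularIntegral Y)‖ ≤
        K * (t ^ 4110 / s ^ 11) := by
  set S := ∑' r, ‖C r‖
  have hS : 0 ≤ S := tsum_nonneg fun _ => norm_nonneg _
  by_cases hT : 1 ≤ T
  swap
  · exact ⟨1, one_pos, fun s t Y m B₀ _ h h' => absurd (h.trans h') hT⟩
  have hT0 : 0 < T := by linarith
  set E := (2 * (c₁ * T ^ 612) + 1) ^ 9 + S * (262144 * Real.pi * (c₂ * T ^ 600) ^ 7) with hE
  refine ⟨E * ((1 + c₃) * T ^ 100) ^ 11, by positivity,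
    fun s t Y m B₀ hs ht htT hb hY hY3 hsm hst h₀ => ?_⟩
  have hs0 : 0 < s := by linarith
  have ht0 : 0 < t := by linarith
  have hm1 : (1 : ℝ) ≤ m := hsm ▸ one_le_pow₀ hs
  have hm : 0 < m := by exact_mod_cast hm1
  have hsT : s ≤ (1 + c₃) * T ^ 100 := hst.trans (by gcongr)
  have hcount : (count Y m B₀ : ℝ) ≤ (2 * (c₁ * T ^ 612) + 1) ^ 9 := by
    refine (count_le (fun i => (hb.pos i).le) hm h₀).trans ?_
    calc _ ≤ ∏ _i : Fin 9, (2 * (c₁ * T ^ 612) + 1) := by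
          refine prod_le_prod (fun i _ => ?_) fun i _ => ?_
          · have := hb.pos i
            positivity
          · have h1 : Y i ≤ c₁ * T ^ 612 := (hY i).trans (by gcongr)
            have h2 : 2 * Y i / m ≤ 2 * Y i := div_le_self (by linarith [hb.pos i]) hm1
            linarith
      _ = _ := by simp
  have hmain : ‖1 / (m : ℂ) ^ 8 * (coprimeSeries m * singularIntegral Y)‖ ≤
      S * (262144 * Real.pi * (c₂ * T ^ 600) ^ 7) := by
    rw [norm_mul, norm_mul, norm_div, norm_one, norm_pow, Complex.norm_natCast]
    have h1 : 1 / (m : ℝ) ^ 8 ≤ 1 := by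
      rw [div_le_one (by positivity)]; exact one_le_pow₀ hm1
    have h2 : ‖singularIntegral Y‖ ≤ 262144 * Real.pi * (c₂ * T ^ 600) ^ 7 := by
      refine (norm_singularIntegral_le hb).trans ?_
      rw [hY3]
      calc _ = 262144 * Real.pi * (c₂ * t ^ 600) ^ 7 := by ring
        _ ≤ _ := by gcongr
    refine (mul_le_of_le_one_left (by positivity) h1).trans ?_
    gcongr
    exact norm_coprimeSeries_le m
  calc _ ≤ E := by
        refine (norm_sub_le _ _).trans (add_le_add ?_ hmain)
        rwa [Complex.norm_natCast]
    -- For bounded `t`, `s` is bounded as well, so one factor `s ^ 11` can be traded for a constant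
    -- to reach the required shape.
    _ = E * (s ^ 11 / s ^ 11) := by rw [div_self (by positivity), mul_one]
    _ ≤ E * (((1 + c₃) * T ^ 100) ^ 11 * t ^ 4110 / s ^ 11) := by
        gcongr
        refine (pow_le_pow_left₀ hs0.le hsT 11).trans (le_mul_of_one_le_right (by positivity) ?_)
        exact one_le_pow₀ ht
    _ = _ := by ring

theorem exists_norm_count_sub_le (h₁ : 0 < c₁) (h₂ : 0 < c₂) (h₃ : 0 < c₃) :
    ∃ K : ℝ, 0 < K ∧ ∀ (s t : ℝ) (Y : V ℝ) (m : ℕ) (B₀ : V ℤ), 1 ≤ s → 1 ≤ t →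
      IsBalanced Y (Y 3 ^ 2) → (∀ i, c₁⁻¹ * t ^ 588 ≤ Y i ∧ Y i ≤ c₁ * t ^ 612) →
      Y 3 = c₂ * t ^ 600 → s ^ 2 = m → s ^ 2 ≤ c₃ * t ^ 200 → Odd m →
      (m : ℤ) ∣ q B₀ → (∀ p : ℕ, p.Prime → p ∣ m → ∃ i, ¬ (p : ℤ) ∣ B₀ i) →
      ‖(count Y m B₀ : ℂ) - 1 / (m : ℂ) ^ 8 * (coprimeSeries m * singularIntegral Y)‖ ≤
        K * (t ^ 4110 / s ^ 11) := by
  set T := max (c₁ * c₃ ^ 2) (max (c₁ * c₃ / c₂ ^ 2) (3 * c₃ ^ 3 / c₂ ^ 2)) with hT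
  obtain ⟨K₁, hK₁, H₁⟩ := norm_count_sub_le_of_large h₁ h₂ h₃
  obtain ⟨K₂, hK₂, H₂⟩ := norm_count_sub_le_of_small h₁ h₂ h₃ T
  refine ⟨K₁ + K₂, by positivity, fun s t Y m B₀ hs ht hb hY hY3 hsm hst hodd h₀ hB => ?_⟩
  have hs0 : 0 < s := by linarith
  have ht0 : 0 < t := by linarith
  have hst' : s ≤ (1 + c₃) * t ^ 100 := by
    refine (sq_le_sq₀ hs0.le (by positivity)).1 ?_
    calc s ^ 2 ≤ c₃ * t ^ 200 := hst
      _ ≤ (1 + c₃) ^ 2 * t ^ 200 := by gcongr; nlinarith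
      _ = _ := by ring
  have hpos : 0 ≤ t ^ 4110 / s ^ 11 := by positivity
  rcases le_total T t with h | h
  · refine (H₁ s t Y m B₀ hs ht ((le_max_left _ _).trans h)
      ((le_max_left _ _).trans ((le_max_right _ _).trans h))
      ((le_max_right _ _).trans ((le_max_right _ _).trans h)) hb hY hY3 hsm hst hst' hodd h₀
      hB).trans ?_
    gcongr; linarith
  · refine (H₂ s t Y m B₀ hs ht h hb (fun i => (hY i).2) hY3 hsm hst' h₀).trans ?_
    gcongr; linarith

end

end QuadricCount

/-! ### The theorem, translated back from `t` and `s` to `X` and `m` -/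

theorem mainTheorem7 :
    -- the singular series and the local series converge absolutely, to positive real numbers
    (Summable (fun r : ℕ+ => ‖QuadricCount.C (r : ℕ)‖) ∧
      QuadricCount.singularSeries.im = 0 ∧ 0 < QuadricCount.singularSeries.re) ∧
    (∀ p : ℕ, p.Prime →
      Summable (fun l : ℕ => ‖QuadricCount.C (p ^ l)‖) ∧
      (QuadricCount.localSeries p).im = 0 ∧ 0 < (QuadricCount.localSeries p).re) ∧
    -- the implied constant `K` depends only on the constants `c₁`, `c₂`, `c₃`
    (∀ c₁ c₂ c₃ : ℝ, 0 < c₁ → 0 < c₂ → 0 < c₃ → ∃ K : ℝ, 0 < K ∧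
      ∀ (δ X : ℝ) (Y : QuadricCount.V ℝ), 0 < δ → δ < 0.01 → 2 ≤ X →
        (∀ i, c₁⁻¹ * X ^ (1 - 2 * δ) ≤ Y i ∧ Y i ≤ c₁ * X ^ (1 + 2 * δ)) →
        Y 3 = c₂ * X →
        Y 0 * Y 8 = c₂ ^ 2 * X ^ 2 → Y 4 * Y 6 = c₂ ^ 2 * X ^ 2 →
        Y 1 * Y 7 = c₂ ^ 2 * X ^ 2 → Y 2 * Y 5 = c₂ ^ 2 * X ^ 2 →
        -- the singular integral converges absolutely, to a positive real number
        (MeasureTheory.Integrable (QuadricCount.boxIntegral Y) ∧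
          (QuadricCount.singularIntegral Y).im = 0 ∧
          0 < (QuadricCount.singularIntegral Y).re) ∧
        -- the asymptotic count
        ∀ (m : ℕ) (B₀ : QuadricCount.V ℤ), Odd m → Squarefree m →
          (m : ℝ) ≤ c₃ * X ^ (1 / 3 : ℝ) →
          (m : ℤ) ∣ QuadricCount.q B₀ →
          (∀ p : ℕ, p.Prime → p ∣ m → ∃ i, ¬ (p : ℤ) ∣ B₀ i) →
          ‖(QuadricCount.count Y m B₀ : ℂ) -
              1 / (m : ℂ) ^ 8 * (∏ p ∈ m.primeFactors, (QuadricCount.localSeries p)⁻¹) *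
                QuadricCount.singularSeries * QuadricCount.singularIntegral Y‖
            ≤ K * (X ^ (6.85 * (1 + 2 * δ)) / (m : ℝ) ^ (5.5 : ℝ) * Real.log X)) := by
  refine ⟨⟨QuadricCount.summable_norm_C.comp_injective PNat.coe_injective,
    QuadricCount.singularSeries_pos⟩, fun p hp => ⟨QuadricCount.summable_local hp,
    QuadricCount.localSeries_pos hp⟩, fun c₁ c₂ c₃ h₁ h₂ h₃ => ?_⟩
  obtain ⟨K, hK, H⟩ := QuadricCount.exists_norm_count_sub_le h₁ h₂ h₃
  have hl2 : 0 < Real.log 2 := Real.log_pos one_lt_two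
  -- The bound obtained has no logarithm; dividing by `log 2 ≤ log X` brings it to the stated form.
  refine ⟨K / Real.log 2, by positivity,
    fun δ X Y hδ hδ' hX hY hY3 h08 h46 h17 h25 => ?_⟩
  have hX0 : 0 < X := by linarith
  have hX1 : 1 ≤ X := by linarith
  have hsq : Y 3 ^ 2 = c₂ ^ 2 * X ^ 2 := by rw [hY3]; ring
  have hb : QuadricCount.IsBalanced Y (Y 3 ^ 2) :=
    ⟨fun i => (by positivity : 0 < c₁⁻¹ * X ^ (1 - 2 * δ)).trans_le (hY i).1,
      h08.trans hsq.symm, h46.trans hsq.symm, h17.trans hsq.symm, h25.trans hsq.symm⟩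
  refine ⟨⟨QuadricCount.integrable_boxIntegral hb, QuadricCount.singularIntegral_pos hb⟩,
    fun m B₀ hodd _ hmX h₀ hB => ?_⟩
  have hm : m ≠ 0 := by rintro rfl; simp at hodd
  have hm1 : (1 : ℝ) ≤ m := by exact_mod_cast Nat.pos_of_ne_zero hm
  -- The denominator `600` makes all exponents in use integral: `X ^ 0.98`, `X ^ 1.02`, `X ^ (1/3)`,
  -- `X ^ 0.1` and `X ^ 6.85`.
  set t := X ^ (1 / 600 : ℝ) with ht
  have ht1 : 1 ≤ t := Real.one_le_rpow hX1 (by norm_num)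
  have htn : ∀ n : ℕ, t ^ n = X ^ ((n : ℝ) / 600) := fun n => by
    rw [ht, ← Real.rpow_natCast, ← Real.rpow_mul hX0.le]; congr 1; ring
  have hs1 : 1 ≤ √(m : ℝ) := Real.one_le_sqrt.2 hm1
  have hs2 : √(m : ℝ) ^ 2 = m := Real.sq_sqrt (by positivity)
  have hs11 : √(m : ℝ) ^ 11 = (m : ℝ) ^ (5.5 : ℝ) := by
    rw [Real.sqrt_eq_rpow, ← Real.rpow_natCast, ← Real.rpow_mul (by positivity)]; norm_num
  have key := H √(m : ℝ) t Y m B₀ hs1 ht1 hb (fun i => ⟨?_, ?_⟩) ?_ hs2 ?_ hodd h₀ hB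
  · have hfac : 1 / (m : ℂ) ^ 8 * (∏ p ∈ m.primeFactors, (QuadricCount.localSeries p)⁻¹) *
        QuadricCount.singularSeries * QuadricCount.singularIntegral Y =
        1 / (m : ℂ) ^ 8 * (QuadricCount.coprimeSeries m * QuadricCount.singularIntegral Y) := by
      rw [← QuadricCount.coprimeSeries_eq m hm]; ring
    rw [hfac]
    refine key.trans ?_
    rw [hs11, htn]
    have h1 : X ^ (((4110 : ℕ) : ℝ) / 600) ≤ X ^ (6.85 * (1 + 2 * δ)) := by
      refine Real.rpow_le_rpow_of_exponent_le hX1 ?_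
      push_cast; linarith
    have h2 : Real.log 2 ≤ Real.log X := Real.log_le_log two_pos hX
    calc K * (X ^ (((4110 : ℕ) : ℝ) / 600) / (m : ℝ) ^ (5.5 : ℝ))
        ≤ K * (X ^ (6.85 * (1 + 2 * δ)) / (m : ℝ) ^ (5.5 : ℝ)) := by gcongr
      _ = K / Real.log 2 * (X ^ (6.85 * (1 + 2 * δ)) / (m : ℝ) ^ (5.5 : ℝ) * Real.log 2) := by
          field_simp
      _ ≤ _ := by gcongr
  -- Since `δ < 0.01`, the side bounds may be weakened to `X ^ 0.98 = t ^ 588` and, in the next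
  -- case, `X ^ 1.02 = t ^ 612`. This makes the constant independent of `δ`.
  · refine le_trans ?_ (hY i).1
    rw [htn]
    gcongr ?_ * ?_
    refine Real.rpow_le_rpow_of_exponent_le hX1 ?_
    push_cast; linarith
  · refine (hY i).2.trans ?_
    rw [htn]
    gcongr ?_ * ?_
    refine Real.rpow_le_rpow_of_exponent_le hX1 ?_
    push_cast; linarith
  · rw [hY3, htn]; norm_num
  · rw [hs2, htn]; refine hmX.trans_eq ?_; norm_num
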